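/- Write $\mathbf x=(x_1,\mathbf x_\perp)\in\mathbb R\times\mathbb R^2$. Let $V:\mathbb R^3\to\mathbb R$ be a measurable potential with $$\sup_{\mathbf x\in\mathbb R^3}\int_{|\mathbf x-\mathbf y|\le 1}|V(\mathbf y)|^2\,d\mathbf y<\infty,\qquad \lim_{R\to\infty}\ \sup_{x_1\in\mathbb R,\ |\mathbf x_\perp|\ge R}\ \int_{|\mathbf x-\mathbf y|\le 1}|V(\mathbf y)|^2\,d\mathbf y=0,$$ and let $H=-\Delta+V$ be the corresponding self-adjoint Schrödinger operator in $L^2(\mathbb R^3)$. Let $\sigma_0$ be an isolated part of the spectrum of $H$, that is, a nonempty set $\sigma_0\subset\sigma(H)$ with $\operatorname{dist}(\sigma_0,\sigma(H)\setminus\sigma_0)>0$, and suppose that $-E_+:=\sup\sigma_0<0$. Let $$P_0=\frac{i}{2\pi}\int_\Gamma (H-z)^{-1}\,dz$$ be the corresponding spectral projection, where $\Gamma$ is a positively oriented contour of finite length in the resolvent set of $H$ enclosing $\sigma_0$ (and no other point of $\sigma(H)$); $\Gamma$ may consist of finitely many closed curves. For $a\in\mathbb R$ let $\langle X_{\parallel,a}\rangle$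 and $\langle X_\perp\rangle$ be the operators of multiplication by $\sqrt{(x_1-a)^2+1}$ and $\sqrt{|\mathbf x_\perp|^2+1}$. Then there is $\alpha_\parallel>0$ such that for every $\alpha_\perp$ with $0<\alpha_\perp<\sqrt{E_+}$ there is $M<\infty$ with $$\sup_{a\in\mathbb R}\big\|e^{\alpha_\parallel\langle X_{\parallel,a}\rangle}P_0\,e^{-\alpha_\parallel\langle X_{\parallel,a}\rangle}\big\|\le M\qquad\text{and}\qquad \big\|e^{\alpha_\perp\langle X_\perp\rangle}P_0\,e^{\alpha_\perp\langle X_\perp\rangle}\big\|\le M.$$ -/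

import Mathlib

open MeasureTheory Set Filter Topology
open scoped ENNReal NNReal SchwartzMap Laplacian

noncomputable section

namespace QuasiOneD

/-- Physical space `ℝ³` with the Euclidean norm; `x 0` is the axial coordinate `x₁`, and
`(x 1, x 2)` are the transversal coordinates. -/
abbrev Space : Type := EuclideanSpace ℝ (Fin 3)

/-- The Hilbert space `L²(ℝ³)`. -/
abbrev L2 : Type := Lp ℂ 2 (volume : Measure Space)

/-! ### Unbounded operators: multiplication operators and `P² = -Δ` -/

theorem memLp_mul_zero (w : Space → ℝ) :
    MemLp (fun x => (w x : ℂ) * (0 : L2) x) 2 volume := by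
  refine (memLp_congr_ae ?_).mpr (MemLp.zero' (μ := (volume : Measure Space)) (p := 2) (ε := ℂ))
  filter_upwards [Lp.coeFn_zero ℂ 2 (volume : Measure Space)] with x hx
  rw [hx, Pi.zero_apply, mul_zero]

theorem mul_add_ae (w : Space → ℝ) (u v : L2) :
    (fun x => (w x : ℂ) * (u + v) x) =ᵐ[volume]
      (fun x => (w x : ℂ) * u x) + (fun x => (w x : ℂ) * v x) := by
  filter_upwards [Lp.coeFn_add u v] with x hx
  rw [hx, Pi.add_apply, Pi.add_apply, mul_add]

theorem mul_smul_ae (w : Space → ℝ) (c : ℂ) (u : L2) :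
    (fun x => (w x : ℂ) * (c • u) x) =ᵐ[volume] c • (fun x => (w x : ℂ) * u x) := by
  filter_upwards [Lp.coeFn_smul c u] with x hx
  rw [hx, Pi.smul_apply, Pi.smul_apply, smul_eq_mul, smul_eq_mul]
  ring

/-- The domain `{u ∈ L² : w u ∈ L²}` of multiplication by `w`. -/
def mulDomain (w : Space → ℝ) : Submodule ℂ L2 where
  carrier := {u | MemLp (fun x => (w x : ℂ) * u x) 2 volume}
  zero_mem' := memLp_mul_zero w
  add_mem' := fun {u v} hu hv => (memLp_congr_ae (mul_add_ae w u v)).mpr (hu.add hv)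
  smul_mem' := fun c u hu => (memLp_congr_ae (mul_smul_ae w c u)).mpr (hu.const_smul c)

/-- The operator of multiplication by a real function `w`, with its maximal domain. -/
def mulOp (w : Space → ℝ) : L2 →ₗ.[ℂ] L2 where
  domain := mulDomain w
  toFun :=
    { toFun := fun u => MemLp.toLp (fun x => (w x : ℂ) * (u : L2) x) u.2
      map_add' := fun u v =>
        (MemLp.toLp_congr _ (u.2.add v.2) (mul_add_ae w u v)).trans (MemLp.toLp_add u.2 v.2)
      map_smul' := fun c u =>
        (MemLp.toLp_congr _ (u.2.const_smul c) (mul_smul_ae w c u)).trans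
          (MemLp.toLp_const_smul c u.2) }

/-- The distributional Laplacian of `u ∈ L²` is (given by) the function `f ∈ L²`. -/
def HasLaplacian (u f : L2) : Prop := Δ (u : 𝓢'(Space, ℂ)) = (f : 𝓢'(Space, ℂ))

theorem hasLaplacian_iff (u f : L2) : HasLaplacian u f ↔
    LineDeriv.laplacianCLM ℂ Space 𝓢'(Space, ℂ)
      (Lp.toTemperedDistributionCLM ℂ (volume : Measure Space) 2 u) =
      Lp.toTemperedDistributionCLM ℂ (volume : Measure Space) 2 f := by
  rw [TemperedDistribution.laplacianCLM_apply]
  rfl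

theorem HasLaplacian.unique {u f g : L2} (hf : HasLaplacian u f) (hg : HasLaplacian u g) :
    f = g := by
  rw [hasLaplacian_iff] at hf hg
  exact LinearMap.ker_eq_bot.mp
    (Lp.ker_toTemperedDistributionCLM_eq_bot (F := ℂ) (μ := (volume : Measure Space)) (p := 2))
    (hf.symm.trans hg)

theorem hasLaplacian_zero : HasLaplacian 0 0 := by
  rw [hasLaplacian_iff, map_zero, map_zero]

theorem HasLaplacian.add {u v f g : L2} (hf : HasLaplacian u f) (hg : HasLaplacian v g) :
    HasLaplacian (u + v) (f + g) := by
  rw [hasLaplacian_iff] at hf hg ⊢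
  rw [map_add, map_add, map_add, hf, hg]

theorem HasLaplacian.smul {u f : L2} (c : ℂ) (hf : HasLaplacian u f) :
    HasLaplacian (c • u) (c • f) := by
  rw [hasLaplacian_iff] at hf ⊢
  rw [map_smul, map_smul, map_smul, hf]

/-- The Sobolev space `H²(ℝ³)`: all `u ∈ L²` whose distributional Laplacian is in `L²`. -/
def kineticDomain : Submodule ℂ L2 where
  carrier := {u | ∃ f : L2, HasLaplacian u f}
  zero_mem' := ⟨0, hasLaplacian_zero⟩
  add_mem' := fun ⟨f, hf⟩ ⟨g, hg⟩ => ⟨f + g, hf.add hg⟩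
  smul_mem' := fun c _ ⟨f, hf⟩ => ⟨c • f, hf.smul c⟩

/-- The `L²` function that represents the distributional Laplacian of `u ∈ H²(ℝ³)`. -/
def lap (u : kineticDomain) : L2 := Classical.choose u.2

theorem lap_spec (u : kineticDomain) : HasLaplacian u (lap u) := Classical.choose_spec u.2

theorem lap_add (u v : kineticDomain) : lap (u + v) = lap u + lap v :=
  (lap_spec (u + v)).unique ((lap_spec u).add (lap_spec v))

theorem lap_smul (c : ℂ) (u : kineticDomain) : lap (c • u) = c • lap u :=
  (lap_spec (c • u)).unique ((lap_spec u).smul c)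

/-- The operator `P² = -Δ` with its self-adjoint domain, the Sobolev space `H²(ℝ³)`. -/
def kinetic : L2 →ₗ.[ℂ] L2 where
  domain := kineticDomain
  toFun :=
    { toFun := fun u => -lap u
      map_add' := fun u v => by rw [lap_add, neg_add]
      map_smul' := fun c u => by rw [lap_smul, smul_neg, RingHom.id_apply] }

/-- The Hamiltonian `H = P² + V`, as an operator sum (its domain is the intersection of the
domains of `P²` and of multiplication by `V`). For uniformly locally square integrable `V` this is
the self-adjoint operator which is the closure of its restriction to `C_0^∞(ℝ³)`. -/
def hamiltonian (V : Space → ℝ) : L2 →ₗ.[ℂ] L2 := kinetic + mulOp V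

/-! ### Assumptions on the potential -/

/-- The distance `|x_⊥|` of `x` to the `x₁`-axis. -/
def perpNorm (x : Space) : ℝ := √((x 1) ^ 2 + (x 2) ^ 2)

/-- `∫_{|x - y| ≤ 1} |V(y)|² dy`, as an extended nonnegative number. -/
def localMass (V : Space → ℝ) (x : Space) : ℝ≥0∞ :=
  ∫⁻ y in Metric.closedBall x 1, ‖V y‖ₑ ^ 2

/-- `V` is uniformly locally square integrable. -/
def UniformlyLocallyL2 (V : Space → ℝ) : Prop :=
  AEStronglyMeasurable V volume ∧ (⨆ x : Space, localMass V x) < ∞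

/-- `I_V(R)`: the supremum of `∫_{|x - y| ≤ 1} |V(y)|² dy` over all `x` with `|x_⊥| ≥ R`. -/
def tailMass (V : Space → ℝ) (R : ℝ) : ℝ≥0∞ :=
  ⨆ (x : Space) (_ : R ≤ perpNorm x), localMass V x

/-! ### Resolvent and spectrum of an unbounded operator -/

/-- `R` is the bounded, everywhere defined two-sided inverse of `A - z`. -/
def IsResolventAt (A : L2 →ₗ.[ℂ] L2) (z : ℂ) (R : L2 →L[ℂ] L2) : Prop :=
  (∀ f : L2, ∃ h : R f ∈ A.domain, A ⟨R f, h⟩ - z • R f = f) ∧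
    ∀ u : A.domain, R (A u - z • (u : L2)) = u

/-- The resolvent set of `A`. -/
def rho (A : L2 →ₗ.[ℂ] L2) : Set ℂ := {z | ∃ R, IsResolventAt A z R}

/-- The spectrum of `A`. -/
def sigma (A : L2 →ₗ.[ℂ] L2) : Set ℂ := (rho A)ᶜ

open Classical in
/-- The resolvent `(A - z)⁻¹` (for `z` in the resolvent set; `0` otherwise). -/
def resolventOp (A : L2 →ₗ.[ℂ] L2) (z : ℂ) : L2 →L[ℂ] L2 :=
  if h : ∃ R, IsResolventAt A z R then Classical.choose h else 0

/-- The real set `σ₀` is an isolated part of the spectrum of `A`: a nonempty part of the spectrum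
which lies at positive distance from the rest of the spectrum. -/
def IsIsolatedPart (A : L2 →ₗ.[ℂ] L2) (σ₀ : Set ℝ) : Prop :=
  σ₀.Nonempty ∧ (∀ E ∈ σ₀, (E : ℂ) ∈ sigma A) ∧
    ∃ d : ℝ, 0 < d ∧ ∀ E ∈ σ₀, ∀ z ∈ sigma A \ ((↑) '' σ₀ : Set ℂ), d ≤ dist (E : ℂ) z

/-! ### Contours of finite length -/

/-- A closed curve of finite length in the complex plane, in a Lipschitz parametrization (every
rectifiable curve has one, by rescaled arc length). -/
structure ClosedCurve where
  toFun : ℝ → ℂ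
  lipschitz : ∃ K : ℝ≥0, LipschitzOnWith K toFun (Icc 0 1)
  closed : toFun 0 = toFun 1

/-- A contour: finitely many closed curves of finite length. -/
structure Contour where
  n : ℕ
  curve : Fin n → ClosedCurve

/-- The set of points on the contour. -/
def Contour.trace (Γ : Contour) : Set ℂ := ⋃ k, (Γ.curve k).toFun '' Icc 0 1

/-- The contour integral `∫_Γ f(z) dz`. -/
def Contour.integral {F : Type*} [NormedAddCommGroup F] [NormedSpace ℂ F]
    (Γ : Contour) (f : ℂ → F) : F :=
  ∑ k, ∫ t in (0 : ℝ)..1, deriv (Γ.curve k).toFun t • f ((Γ.curve k).toFun t)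

/-- The winding number of the contour around `z`. -/
def Contour.index (Γ : Contour) (z : ℂ) : ℂ :=
  (2 * Real.pi * Complex.I)⁻¹ * Γ.integral (fun w => (w - z)⁻¹)

/-- `Γ` is a positively oriented contour in the resolvent set of `A` which encloses the part `σ₀`
of the spectrum of `A`: it winds once, counterclockwise, around each point of `σ₀`, and does not
wind around the rest of the spectrum. -/
def Contour.Encloses (Γ : Contour) (A : L2 →ₗ.[ℂ] L2) (σ₀ : Set ℝ) : Prop :=
  Γ.trace ⊆ rho A ∧ (∀ E ∈ σ₀, Γ.index (E : ℂ) = 1) ∧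
    ∀ z ∈ sigma A \ ((↑) '' σ₀ : Set ℂ), Γ.index z = 0

/-- `(i / 2π) ∫_Γ (A - z)⁻¹ dz`. -/
def spectralProjection (A : L2 →ₗ.[ℂ] L2) (Γ : Contour) : L2 →L[ℂ] L2 :=
  (Complex.I / (2 * Real.pi)) • Γ.integral (fun z => resolventOp A z)

/-! ### Weights -/

/-- `g_a(x) = √((x₁ - a)² + 1)`. -/
def gPar (a : ℝ) (x : Space) : ℝ := √((x 0 - a) ^ 2 + 1)

/-- `g_⊥(x) = √(|x_⊥|² + 1)`. -/
def gPerp (x : Space) : ℝ := √(perpNorm x ^ 2 + 1)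

/-- The operator `e^{h₁} B e^{h₂}` (with `e^{h₁}`, `e^{h₂}` multiplication operators on their
maximal domains) is bounded with norm at most `M`: the domain of `e^{h₂}` is dense, `B e^{h₂}` maps
it into the domain of `e^{h₁}`, and `‖e^{h₁} B e^{h₂} f‖ ≤ M ‖f‖` there. -/
def WeightedNormLE (h₁ : Space → ℝ) (B : L2 →L[ℂ] L2) (h₂ : Space → ℝ) (M : ℝ) : Prop :=
  Dense ((mulOp fun x => Real.exp (h₂ x)).domain : Set L2) ∧
    ∀ f : (mulOp fun x => Real.exp (h₂ x)).domain,
      ∃ h : B (mulOp (fun x => Real.exp (h₂ x)) f) ∈ (mulOp fun x => Real.exp (h₁ x)).domain,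
        ‖mulOp (fun x => Real.exp (h₁ x)) ⟨_, h⟩‖ ≤ M * ‖(f : L2)‖

end QuasiOneD

end

noncomputable section

namespace QuasiOneD

/-! ### Closed curves of finite length -/

/-! The two bounds have different sources. The longitudinal one needs only that `Γ` is a compact
subset of the resolvent set. If a weight `w` has small logarithmic slope, then `[Δ, w]` is small
relative to `H`, so conjugating the resolvent by `w` costs at most a factor 2, uniformly on `Γ` and
in the centre `a` (`exists_conjugated_resolvent_bound`). Integrating over `Γ` gives
`exists_weightedNormLE_par`.

The transversal bound must reach every `α < √E₊`, which a perturbative argument on `Γ` does not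
give. Instead, `P₀` reduces `H` to a bounded operator `B = H P₀` with `B ≤ -E₊ P₀` as forms
(`exists_isReducedBy_spectralProjection`). Far from the axis `V` is form-small, and near the axis
the weight is bounded. The localization formula therefore gives, for `α² < κ < E₊`, an Agmon
inequality `-Re⟨wu, wHu⟩ ≤ κ‖wu‖² + C(‖Hu‖² + ‖u‖²)` with `C` independent of the bounded weight `w ≤
e^{α g_⊥}` of slope at most `α` (`exists_agmon_bound`). Put `T = w P₀`. At a near-maximizer `x` of
`‖Tx‖` one has `T*T x ≈ ‖T‖² x`, so `Re⟨Tx, TBx⟩ ≈ ‖T‖² Re⟨x, Bx⟩ ≤ -E₊ ‖T‖² ‖P₀x‖²`. Comparison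
with the Agmon inequality bounds `‖T‖²` by `C' / (E₊ - κ)` with `C' = C(‖B‖² + 1)`
(`opNorm_sq_mul_le_of_lyapunov`). No eigenfunctions are involved, so `σ₀` may be continuous
spectrum. The two-sided bound follows from `P₀ = P₀²` and duality.

Three tools support this. Every resolvent is a continuous function of one self-adjoint resolvent `(H
- r)⁻¹` with `r` real, so the projection is handled by the bounded functional calculus. `H²` is
treated as the closure of Schwartz functions together with gradient and Laplacian (`IsJet`).
Exponential weights are replaced by bounded smooth ones (`expWeight`), and the uniform bounds pass
to the limit by Fatou (`exists_mulOp_le_of_tendsto`). -/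

theorem _root_.LipschitzOnWith.intervalIntegrable_deriv {f : ℝ → ℂ} {K : ℝ≥0}
    (hf : LipschitzOnWith K f (Icc 0 1)) : IntervalIntegrable (deriv f) volume 0 1 := by
  rw [intervalIntegrable_iff_integrableOn_Ioo_of_le zero_le_one]
  refine Measure.integrableOn_of_bounded (M := K) (by simp) (aestronglyMeasurable_deriv f _) ?_
  refine (ae_restrict_iff' measurableSet_Ioo).mpr (Eventually.of_forall fun t ht => ?_)
  exact norm_deriv_le_of_lipschitzOn (Icc_mem_nhds ht.1 ht.2) hf

theorem _root_.LipschitzOnWith.ae_hasDerivAt {f : ℝ → ℂ} {K : ℝ≥0}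
    (hf : LipschitzOnWith K f (Icc 0 1)) :
    ∀ᵐ t, t ∈ Ioo (0 : ℝ) 1 → HasDerivAt f (deriv f t) t := by
  filter_upwards [hf.ae_differentiableWithinAt_of_mem_real] with t ht h
  exact ((ht (Ioo_subset_Icc_self h)).differentiableAt (Icc_mem_nhds h.1 h.2)).hasDerivAt

theorem ae_ne_endpoints : ∀ᵐ t : ℝ, t ∈ Icc (0 : ℝ) 1 → t ∈ Ioo (0 : ℝ) 1 := by
  have h : volume ({0, 1} : Set ℝ) = 0 := (Set.toFinite _).measure_zero _
  filter_upwards [measure_eq_zero_iff_ae_notMem.mp h] with t ht h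
  simp only [mem_insert_iff, mem_singleton_iff, not_or] at ht
  exact ⟨lt_of_le_of_ne h.1 (Ne.symm ht.1), lt_of_le_of_ne h.2 ht.2⟩

/-- The fundamental theorem of calculus for Lipschitz curves. -/
theorem _root_.LipschitzOnWith.integral_deriv_eq_sub {f : ℝ → ℂ} {K : ℝ≥0}
    (hf : LipschitzOnWith K f (Icc 0 1)) : ∫ t in (0 : ℝ)..1, deriv f t = f 1 - f 0 := by
  have hi := hf.intervalIntegrable_deriv
  -- Both `f` and the primitive of its derivative are Lipschitz, hence absolutely continuous. Their
  -- difference has derivative zero almost everywhere, so it is constant.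
  have hac : AbsolutelyContinuousOnInterval f 0 1 :=
    LipschitzOnWith.absolutelyContinuousOnInterval (K := K) (by rwa [uIcc_of_le zero_le_one])
  have hprim : LipschitzOnWith K (fun x => ∫ t in (0 : ℝ)..x, deriv f t) (uIcc 0 1) := by
    rw [uIcc_of_le zero_le_one]
    refine LipschitzOnWith.of_dist_le_mul fun x hx y hy => ?_
    have hsub : ∀ z ∈ Icc (0 : ℝ) 1, IntervalIntegrable (deriv f) volume 0 z := fun z hz =>
      hi.mono_set (by rw [uIcc_of_le hz.1, uIcc_of_le zero_le_one]; exact Icc_subset_Icc_right hz.2)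
    rw [dist_eq_norm, intervalIntegral.integral_interval_sub_left (hsub x hx) (hsub y hy),
      Real.dist_eq]
    refine intervalIntegral.norm_integral_le_of_norm_le_const_ae ?_
    filter_upwards [ae_ne_endpoints] with t h1 ht
    have h2 := h1 ((uIcc_subset_Icc hy hx) (uIoc_subset_uIcc ht))
    exact norm_deriv_le_of_lipschitzOn (Icc_mem_nhds h2.1 h2.2) hf
  have hg := hac.sub hprim.absolutelyContinuousOnInterval
  obtain ⟨C, hC⟩ := hg.const_of_ae_hasDerivAt_zero (by
    filter_upwards [hf.ae_hasDerivAt, ae_ne_endpoints, hi.ae_hasDerivAt_integral] with t h1 h2 h3 ht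
    have h4 := h2 (by rwa [uIcc_of_le zero_le_one] at ht)
    simpa using! (h1 h4).sub (h3 ht 0 (by simp)))
  have h0 := hC 0 (by simp)
  have h1 := hC 1 (by simp)
  simp only [Pi.sub_apply, intervalIntegral.integral_same, sub_zero] at h0 h1
  rw [h0, ← h1]; ring

/-- The integral of a derivative along a Lipschitz curve. -/
theorem integral_deriv_comp_curve {γ : ℝ → ℂ} {K : ℝ≥0} (hγ : LipschitzOnWith K γ (Icc 0 1))
    {φ φ' : ℂ → ℂ} (hφ : ∀ t ∈ Icc (0 : ℝ) 1, HasDerivAt φ (φ' (γ t)) (γ t))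
    (hc : ∀ t ∈ Icc (0 : ℝ) 1, ContDiffAt ℂ 1 φ (γ t)) :
    ∫ t in (0 : ℝ)..1, deriv γ t * φ' (γ t) = φ (γ 1) - φ (γ 0) := by
  -- A `C¹` function is locally Lipschitz, and compactness of the interval makes `φ ∘ γ` globally
  -- Lipschitz, so the fundamental theorem applies to it.
  have hl : LocallyLipschitzOn (Icc 0 1) (φ ∘ γ) := by
    intro t ht
    obtain ⟨C, s, hs, hCs⟩ := (hc t ht).exists_lipschitzOnWith
    refine ⟨C * K, γ ⁻¹' s ∩ Icc 0 1,
      inter_mem ((hγ.continuousOn t ht).preimage_mem_nhdsWithin hs) self_mem_nhdsWithin, ?_⟩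
    exact hCs.comp (hγ.mono inter_subset_right) (fun x hx => hx.1)
  obtain ⟨C, hC⟩ := hl.exists_lipschitzOnWith_of_compact isCompact_Icc
  rw [← Function.comp_apply (f := φ), ← Function.comp_apply (f := φ) (g := γ) (x := 0),
    ← hC.integral_deriv_eq_sub]
  refine intervalIntegral.integral_congr_ae ?_
  filter_upwards [hγ.ae_hasDerivAt, ae_ne_endpoints] with t h1 h2 ht
  rw [uIoc_of_le zero_le_one] at ht
  have h3 := h1 (h2 (Ioc_subset_Icc_self ht))
  rw [mul_comm]
  exact ((hφ t (Ioc_subset_Icc_self ht)).comp t h3).deriv.symm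

namespace ClosedCurve

variable (c : ClosedCurve)

theorem continuousOn : ContinuousOn c.toFun (Icc 0 1) := c.lipschitz.choose_spec.continuousOn

theorem integral_deriv : ∫ t in (0 : ℝ)..1, deriv c.toFun t = 0 := by
  rw [c.lipschitz.choose_spec.integral_deriv_eq_sub, c.closed, sub_self]

theorem intervalIntegrable_smul {F : Type*} [NormedAddCommGroup F] [NormedSpace ℂ F]
    {f : ℂ → F} (hf : ContinuousOn f (c.toFun '' Icc 0 1)) :
    IntervalIntegrable (fun t => deriv c.toFun t • f (c.toFun t)) volume 0 1 := by
  refine c.lipschitz.choose_spec.intervalIntegrable_deriv.smul_continuousOn ?_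
  rw [uIcc_of_le zero_le_one]
  exact hf.comp c.continuousOn (mapsTo_image _ _)

/-- On the slit plane the logarithm is a primitive of the integrand, and the curve is closed. -/
theorem integral_inv_sub_eq_zero {E : ℝ}
    (h : ∀ t ∈ Icc (0 : ℝ) 1, c.toFun t - E ∈ Complex.slitPlane) :
    ∫ t in (0 : ℝ)..1, deriv c.toFun t • (c.toFun t - E)⁻¹ = 0 := by
  obtain ⟨K, hK⟩ := c.lipschitz
  have := integral_deriv_comp_curve hK (φ := fun z => Complex.log (z - E))
    (φ' := fun z => (z - E)⁻¹)
    (fun t ht => by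
      simpa using! ((hasDerivAt_id (c.toFun t)).sub_const (E : ℂ)).clog (h t ht))
    (fun t ht => ContDiffAt.comp (g := Complex.log) (f := fun z => z - (E : ℂ)) _
      (Complex.contDiffAt_log (h t ht)) (contDiffAt_id.sub contDiffAt_const))
  simp only [smul_eq_mul, this, c.closed, sub_self]

end ClosedCurve

/-! ### Contour integrals and winding numbers. -/

namespace Contour

variable (Γ : Contour)

theorem isCompact_trace : IsCompact Γ.trace :=
  isCompact_iUnion fun k => isCompact_Icc.image_of_continuousOn (Γ.curve k).continuousOn

theorem image_subset_trace (k : Fin Γ.n) : (Γ.curve k).toFun '' Icc 0 1 ⊆ Γ.trace :=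
  subset_iUnion (fun k => (Γ.curve k).toFun '' Icc 0 1) k

/-- A contour that misses the real axis stays in the slit plane based at `E`, hence has index zero.
The real point found here is where a self-adjoint resolvent is available. -/
theorem exists_real_mem_trace {E : ℝ} (h : Γ.index E = 1) :
    ∃ r : ℝ, (r : ℂ) ∈ Γ.trace := by
  by_contra! hr
  have : Γ.index E = 0 := by
    rw [index, integral, Finset.sum_eq_zero, mul_zero]
    intro k _
    refine (Γ.curve k).integral_inv_sub_eq_zero fun t ht => ?_
    rw [Complex.mem_slitPlane_iff]
    by_contra! hc
    have him : ((Γ.curve k).toFun t).im = 0 := by simpa using hc.2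
    refine hr ((Γ.curve k).toFun t).re (Γ.image_subset_trace k ⟨t, ht, ?_⟩)
    exact Complex.ext (by simp) (by simp [him])
  rw [this] at h
  exact zero_ne_one h

/-- Continuous linear maps commute with contour integrals of continuous functions. -/
theorem integral_map {F G : Type*} [NormedAddCommGroup F] [NormedSpace ℂ F] [CompleteSpace F]
    [NormedAddCommGroup G] [NormedSpace ℂ G] [CompleteSpace G] (T : F →L[ℂ] G) {f : ℂ → F}
    (hf : ContinuousOn f Γ.trace) : Γ.integral (fun z => T (f z)) = T (Γ.integral f) := by
  rw [integral, integral, map_sum]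
  refine Finset.sum_congr rfl fun k _ => ?_
  rw [← T.intervalIntegral_comp_comm
    ((Γ.curve k).intervalIntegrable_smul (hf.mono (Γ.image_subset_trace k)))]
  simp only [map_smul]

theorem integral_congr {F : Type*} [NormedAddCommGroup F] [NormedSpace ℂ F] {f g : ℂ → F}
    (h : ∀ z ∈ Γ.trace, f z = g z) : Γ.integral f = Γ.integral g := by
  refine Finset.sum_congr rfl fun k _ => intervalIntegral.integral_congr fun t ht => ?_
  rw [uIcc_of_le zero_le_one] at ht
  simp only [h _ (Γ.image_subset_trace k ⟨t, ht, rfl⟩)]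

theorem integral_const (c : ℂ) : Γ.integral (fun _ => c) = 0 := by
  refine Finset.sum_eq_zero fun k _ => ?_
  simp only [smul_eq_mul, intervalIntegral.integral_mul_const, (Γ.curve k).integral_deriv, zero_mul]

theorem integral_add {f g : ℂ → ℂ} (hf : ContinuousOn f Γ.trace) (hg : ContinuousOn g Γ.trace) :
    Γ.integral (fun z => f z + g z) = Γ.integral f + Γ.integral g := by
  rw [integral, integral, integral, ← Finset.sum_add_distrib]
  refine Finset.sum_congr rfl fun k _ => ?_
  simp only [smul_add]
  exact intervalIntegral.integral_add
    ((Γ.curve k).intervalIntegrable_smul (hf.mono (Γ.image_subset_trace k)))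
    ((Γ.curve k).intervalIntegrable_smul (hg.mono (Γ.image_subset_trace k)))

theorem integral_const_mul (c : ℂ) (f : ℂ → ℂ) :
    Γ.integral (fun z => c * f z) = c * Γ.integral f := by
  rw [integral, integral, Finset.mul_sum]
  refine Finset.sum_congr rfl fun k _ => ?_
  rw [← intervalIntegral.integral_const_mul]
  simp only [smul_eq_mul, mul_left_comm]

theorem exists_norm_integral_le : ∃ L : ℝ, 0 ≤ L ∧ ∀ {F : Type} [NormedAddCommGroup F]
    [NormedSpace ℂ F] (f : ℂ → F) (C : ℝ), (∀ z ∈ Γ.trace, ‖f z‖ ≤ C) → 0 ≤ C →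
      ‖Γ.integral f‖ ≤ L * C := by
  -- Each parameter interval has length 1, so the Lipschitz constants bound the lengths of the
  -- curves.
  refine ⟨∑ k, ((Γ.curve k).lipschitz.choose : ℝ), by positivity, fun f C hf hC => ?_⟩
  rw [integral, Finset.sum_mul]
  refine norm_sum_le_of_le _ fun k _ => ?_
  have hK := (Γ.curve k).lipschitz.choose_spec
  set K := (Γ.curve k).lipschitz.choose
  have := intervalIntegral.norm_integral_le_of_norm_le_const_ae (a := 0) (b := 1)
    (f := fun t => deriv (Γ.curve k).toFun t • f ((Γ.curve k).toFun t)) (C := K * C) (by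
      filter_upwards [ae_ne_endpoints] with t h1 ht
      rw [uIoc_of_le zero_le_one] at ht
      have h2 := h1 (Ioc_subset_Icc_self ht)
      rw [norm_smul]
      exact mul_le_mul (norm_deriv_le_of_lipschitzOn (Icc_mem_nhds h2.1 h2.2) hK)
        (hf _ (Γ.image_subset_trace k ⟨t, Ioc_subset_Icc_self ht, rfl⟩)) (norm_nonneg _) K.2)
  simpa using this

end Contour

/-! ### Resolvents of unbounded operators -/

namespace IsResolventAt

variable {A : L2 →ₗ.[ℂ] L2} {z w : ℂ} {R S : L2 →L[ℂ] L2}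

theorem sub_smul_mul (hR : IsResolventAt A z R) (hS : IsResolventAt A w S) :
    R - (z - w) • (R * S) = S := by
  ext1 f
  obtain ⟨h, hf⟩ := hS.1 f
  have h2 := hR.2 ⟨S f, h⟩
  rw [sub_eq_iff_eq_add.mp hf] at h2
  simp only [map_add, map_sub, map_smul] at h2
  simp only [_root_.sub_apply, _root_.smul_apply, mul_apply_eq_comp]
  rw [sub_smul, ← sub_eq_zero]
  rw [← sub_eq_zero] at h2
  rw [← h2]; abel

/-- `1 - (z - w) (A - w)⁻¹` has the inverse `1 + (z - w) (A - z)⁻¹`. -/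
theorem mul_eq_one (hR : IsResolventAt A z R) (hS : IsResolventAt A w S) :
    (1 + (z - w) • R) * (1 - (z - w) • S) = 1 ∧ (1 - (z - w) • S) * (1 + (z - w) • R) = 1 := by
  have h1 := hR.sub_smul_mul hS
  have h2 := hS.sub_smul_mul hR
  constructor
  · have : (1 + (z - w) • R) * (1 - (z - w) • S)
        = 1 + (z - w) • ((R - (z - w) • (R * S)) - S) := by
      simp only [add_mul, mul_sub, one_mul, mul_one, smul_mul_smul_comm, smul_sub, smul_smul]
      abel
    rw [this, h1, sub_self, smul_zero, add_zero]
  · have : (1 - (z - w) • S) * (1 + (z - w) • R)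
        = 1 + (z - w) • (R - (S - (w - z) • (S * R))) := by
      simp only [sub_mul, mul_add, one_mul, mul_one, smul_mul_smul_comm, smul_sub, smul_smul,
        sub_smul, mul_sub, sub_mul]
      abel
    rw [this, h2, sub_self, smul_zero, add_zero]

theorem eq_mul (hR : IsResolventAt A z R) (hS : IsResolventAt A w S) :
    R = S * (1 + (z - w) • R) := by
  have h2 := hS.sub_smul_mul hR
  rw [mul_add, mul_one, mul_smul_comm]
  rw [← neg_sub w z, neg_smul, ← sub_eq_add_neg, h2]

/-- This form of the resolvent identity expresses every resolvent through a single one. It yields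
both continuity in `z` and the functional calculus formula. -/
theorem eq_mul_inverse (hR : IsResolventAt A z R) (hS : IsResolventAt A w S) :
    R = S * Ring.inverse (1 - (z - w) • S) := by
  obtain ⟨h1, h2⟩ := hR.mul_eq_one hS
  have : Ring.inverse (1 - (z - w) • S) = 1 + (z - w) • R :=
    Ring.inverse_unit ⟨1 - (z - w) • S, 1 + (z - w) • R, h2, h1⟩
  rw [this]
  exact hR.eq_mul hS

theorem isUnit (hR : IsResolventAt A z R) (hS : IsResolventAt A w S) :
    IsUnit (1 - (z - w) • S) := by
  obtain ⟨h1, h2⟩ := hR.mul_eq_one hS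
  exact ⟨⟨1 - (z - w) • S, 1 + (z - w) • R, h2, h1⟩, rfl⟩

/-- Symmetry of `A` and one real point of the resolvent set suffice; self-adjointness of `A` need
not be established separately. -/
theorem isSelfAdjoint {r : ℝ} (hR : IsResolventAt A r R)
    (hA : ∀ u v : A.domain, inner ℂ (A u) (v : L2) = inner ℂ (u : L2) (A v)) :
    IsSelfAdjoint R := by
  rw [ContinuousLinearMap.isSelfAdjoint_iff_isSymmetric]
  intro f g
  obtain ⟨hu, hf⟩ := hR.1 f
  obtain ⟨hv, hg⟩ := hR.1 g
  change inner ℂ (R f) g = inner ℂ f (R g)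
  conv_lhs => rw [← hg]
  conv_rhs => rw [← hf]
  have := hA ⟨R f, hu⟩ ⟨R g, hv⟩
  simp only at this
  rw [inner_sub_left, inner_sub_right, this, inner_smul_left, inner_smul_right]
  simp

end IsResolventAt

theorem isResolventAt_resolventOp {A : L2 →ₗ.[ℂ] L2} {z : ℂ} (hz : z ∈ rho A) :
    IsResolventAt A z (resolventOp A z) := by
  have h : ∃ R, IsResolventAt A z R := hz
  rw [resolventOp, dif_pos h]
  exact h.choose_spec

theorem continuousOn_resolventOp (A : L2 →ₗ.[ℂ] L2) : ContinuousOn (resolventOp A) (rho A) := by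
  intro w hw
  have hS := isResolventAt_resolventOp hw
  have hc : ContinuousAt (fun z : ℂ => resolventOp A w *
      Ring.inverse (1 - (z - w) • resolventOp A w)) w := by
    refine continuousAt_const.mul ?_
    refine ContinuousAt.comp (g := Ring.inverse)
      (f := fun z : ℂ => 1 - (z - w) • resolventOp A w) ?_ (by fun_prop)
    obtain ⟨U, hU⟩ := hS.isUnit hS
    rw [← hU]
    exact NormedRing.inverse_continuousAt U
  refine hc.continuousWithinAt.congr (fun z hz => ?_) ?_
  · exact (isResolventAt_resolventOp hz).eq_mul_inverse hS
  · exact hS.eq_mul_inverse hS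

/-! ### The Riesz projection through the functional calculus of one resolvent. -/

/-- What the Riesz projection of a symmetric operator `A` gives: an orthogonal projection which
reduces `A` to a bounded operator `B`, bounded above by the supremum of the enclosed part of the
spectrum. -/
structure IsReducedBy (A : L2 →ₗ.[ℂ] L2) (P B : L2 →L[ℂ] L2) : Prop where
  isSelfAdjoint : IsSelfAdjoint P
  mul_self : P * P = P
  proj_mul : P * B = B
  mul_proj : B * P = B
  apply_eq : ∀ x, ∃ h : P x ∈ A.domain, A ⟨P x, h⟩ = B x

/-- A point `x ≠ 0` of the spectrum of `R = (A - r)⁻¹` corresponds to the spectral value `r + x⁻¹`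
of `A`. The function identity `x (a - r χ) = χ` puts the range of `χ(R)` into the range of `R`,
which is the domain of `A`, and shows that `A χ(R) = a(R)`. -/
theorem IsReducedBy.of_cfcHom {A : L2 →ₗ.[ℂ] L2} {r : ℝ} {R : L2 →L[ℂ] L2}
    (hR : IsResolventAt A r R) (hn : IsStarNormal R)
    {χ a : C(spectrum ℂ R, ℂ)}
    (hχ : ∀ x, (χ x = 0 ∧ a x = 0) ∨ (χ x = 1 ∧ (x : ℂ) ≠ 0 ∧ a x = r + (x : ℂ)⁻¹)) :
    IsReducedBy A (cfcHom hn χ) (cfcHom hn a) := by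
  have hstar : star χ = χ := by
    ext x
    rcases hχ x with h | h <;> simp [h.1]
  have hsq : χ * χ = χ := by
    ext x
    rcases hχ x with h | h <;> simp [h.1]
  have hmul : χ * a = a := by
    ext x
    rcases hχ x with h | h <;> simp [h.1, h.2]
  have hres : (ContinuousMap.id ℂ).restrict (spectrum ℂ R) * (a - (r : ℂ) • χ) = χ := by
    ext x
    rcases hχ x with h | h
    · simp [h.1, h.2]
    · simp [h.1, h.2]
  refine ⟨?_, ?_, ?_, ?_, fun x => ?_⟩
  · rw [IsSelfAdjoint, ← map_star, hstar]
  · rw [← map_mul, hsq]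
  · rw [← map_mul, hmul]
  · rw [← map_mul, mul_comm, hmul]
  · have h : R * (cfcHom hn a - (r : ℂ) • cfcHom hn χ) = cfcHom hn χ := by
      have hid := cfcHom_id (R := ℂ) hn
      calc _ = cfcHom hn ((ContinuousMap.id ℂ).restrict (spectrum ℂ R)) *
            cfcHom hn (a - (r : ℂ) • χ) := by rw [hid, map_sub, map_smul]
        _ = _ := by rw [← map_mul, hres]
    have hx : R ((cfcHom hn a - (r : ℂ) • cfcHom hn χ) x) = cfcHom hn χ x := by
      rw [← mul_apply_eq_comp, h]
    obtain ⟨hd, he⟩ := hR.1 ((cfcHom hn a - (r : ℂ) • cfcHom hn χ) x)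
    refine ⟨hx ▸ hd, ?_⟩
    simp only [hx] at he
    exact (sub_eq_iff_eq_add.mp he).trans
      (by rw [_root_.sub_apply, _root_.smul_apply, sub_add_cancel])

theorem re_inner_cfcHom_le {R : L2 →L[ℂ] L2} (hn : IsStarNormal R)
    {χ a : C(spectrum ℂ R, ℂ)} {e : ℝ}
    (hχ : ∀ x, (χ x = 0 ∧ a x = 0) ∨ (χ x = 1 ∧ (a x).re ≤ -e ∧ (a x).im = 0))
    (hP : IsSelfAdjoint (cfcHom hn χ)) (hPP : cfcHom hn χ * cfcHom hn χ = cfcHom hn χ) (u : L2) :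
    (inner ℂ u (cfcHom hn a u)).re ≤ -e * ‖cfcHom hn χ u‖ ^ 2 := by
  -- The function `-(a + e χ)` is nonnegative, so it is the square of this continuous real function,
  -- and the operator inequality follows by writing it as `t(R)* t(R)`.
  let t : C(spectrum ℂ R, ℂ) :=
    ⟨fun x => (√(-(a x + e * χ x).re) : ℝ), Complex.continuous_ofReal.comp
      (Complex.continuous_re.comp
        (a.continuous.add (continuous_const.mul χ.continuous))).neg.sqrt⟩
  have ht : star t * t = -(a + (e : ℂ) • χ) := by
    ext x
    have h0 : star t x * t x = ((√(-(a x + e * χ x).re) * √(-(a x + e * χ x).re) : ℝ) : ℂ) := by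
      simp [t, Complex.conj_ofReal]
    rw [ContinuousMap.mul_apply, h0, Real.mul_self_sqrt]
    · rcases hχ x with h | h
      · simp [h.1, h.2]
      · simp only [h.1, ContinuousMap.neg_apply, ContinuousMap.add_apply, ContinuousMap.smul_apply]
        apply Complex.ext <;> simp [h.2.2]
    · rcases hχ x with h | h
      · simp [h.1, h.2]
      · simp [h.1]; linarith [h.2.1]
  have h1 : star (cfcHom hn t) * cfcHom hn t = -(cfcHom hn a + (e : ℂ) • cfcHom hn χ) := by
    rw [← map_star, ← map_mul, ht, map_neg, map_add, map_smul]
  have h2 : (0 : ℝ) ≤ (inner ℂ u ((star (cfcHom hn t) * cfcHom hn t) u)).re := by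
    rw [mul_apply_eq_comp, ContinuousLinearMap.star_eq_adjoint,
      ContinuousLinearMap.adjoint_inner_right]
    exact inner_self_nonneg (𝕜 := ℂ)
  have h3 : (inner ℂ u (cfcHom hn χ u)).re = ‖cfcHom hn χ u‖ ^ 2 := by
    conv_lhs => rw [← hPP]
    rw [mul_apply_eq_comp, ← ContinuousLinearMap.adjoint_inner_left,
      ← ContinuousLinearMap.star_eq_adjoint, hP.star_eq]
    exact inner_self_eq_norm_sq (𝕜 := ℂ) _
  rw [h1] at h2
  simp only [_root_.neg_apply, _root_.add_apply, _root_.smul_apply, inner_neg_right,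
    inner_add_right, inner_smul_right, Complex.neg_re, Complex.add_re, Complex.re_ofReal_mul, h3]
    at h2
  linarith

/-- The function `x ↦ x / (1 - w x)` on a compact set. -/
def resolventFun (K : Set ℂ) (w : ℂ) : C(K, ℂ) :=
  (ContinuousMap.id ℂ).restrict K * Ring.inverse (1 - w • (ContinuousMap.id ℂ).restrict K)

section resolventFun

variable {K : Set ℂ} {w : ℂ}

theorem isUnit_one_sub_smul (hw : ∀ x ∈ K, 1 - w * x ≠ 0) :
    IsUnit (1 - w • (ContinuousMap.id ℂ).restrict K) :=
  ContinuousMap.isUnit_iff_forall_ne_zero _ |>.mpr fun x => by simpa using hw x x.2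

theorem resolventFun_mul (hw : ∀ x ∈ K, 1 - w * x ≠ 0) :
    resolventFun K w * (1 - w • (ContinuousMap.id ℂ).restrict K) =
      (ContinuousMap.id ℂ).restrict K := by
  rw [resolventFun, mul_assoc, Ring.inverse_mul_cancel _ (isUnit_one_sub_smul hw), mul_one]

theorem resolventFun_apply (hw : ∀ x ∈ K, 1 - w * x ≠ 0) (x : K) :
    resolventFun K w x = x / (1 - w * x) := by
  rw [eq_div_iff (hw x x.2)]
  simpa using DFunLike.congr_fun (resolventFun_mul hw) x

theorem continuousAt_resolventFun [CompactSpace K] (hw : ∀ x ∈ K, 1 - w * x ≠ 0) :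
    ContinuousAt (resolventFun K) w := by
  refine continuousAt_const.mul ?_
  refine ContinuousAt.comp (g := Ring.inverse)
    (f := fun w : ℂ => 1 - w • (ContinuousMap.id ℂ).restrict K) ?_ (by fun_prop)
  obtain ⟨U, hU⟩ := isUnit_one_sub_smul hw
  rw [← hU]
  exact NormedRing.inverse_continuousAt U

end resolventFun

/-- A zero would force `x = (z - w)⁻¹`, and then `x - S` is a multiple of the invertible operator `1
- (z - w) S`. -/
theorem IsResolventAt.one_sub_mul_ne_zero {A : L2 →ₗ.[ℂ] L2} {z w : ℂ} {R S : L2 →L[ℂ] L2}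
    (hR : IsResolventAt A z R) (hS : IsResolventAt A w S) :
    ∀ x ∈ spectrum ℂ S, 1 - (z - w) * x ≠ 0 := by
  intro x hx h0
  have hzw : z - w ≠ 0 := fun h => by simp [h] at h0
  refine hx ?_
  have h1 : algebraMap ℂ (L2 →L[ℂ] L2) x - S = (z - w)⁻¹ • (1 - (z - w) • S) := by
    have hx' : x = (z - w)⁻¹ := by
      rw [← mul_left_inj' hzw, inv_mul_cancel₀ hzw]; linear_combination -h0
    rw [smul_sub, smul_smul, inv_mul_cancel₀ hzw, one_smul, Algebra.algebraMap_eq_smul_one, hx']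
  rw [spectrum.mem_resolventSet_iff, h1]
  exact (hR.isUnit hS).smul (Units.mk0 _ (inv_ne_zero hzw))

theorem IsResolventAt.cfcHom_resolventFun {A : L2 →ₗ.[ℂ] L2} {z w : ℂ} {R S : L2 →L[ℂ] L2}
    (hR : IsResolventAt A z R) (hS : IsResolventAt A w S) (hn : IsStarNormal S) :
    cfcHom hn (resolventFun (spectrum ℂ S) (z - w)) = R := by
  have h := congrArg (cfcHom hn) (resolventFun_mul (hR.one_sub_mul_ne_zero hS))
  rw [map_mul, map_sub, map_smul, map_one, cfcHom_id hn] at h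
  calc _ = cfcHom hn (resolventFun (spectrum ℂ S) (z - w)) *
        ((1 - (z - w) • S) * (1 + (z - w) • R)) := by rw [(hR.mul_eq_one hS).2, mul_one]
    _ = R := by rw [← mul_assoc, h, ← hR.eq_mul hS]

theorem mem_sigma_of_mem_spectrum {A : L2 →ₗ.[ℂ] L2} {w x : ℂ} {S : L2 →L[ℂ] L2}
    (hS : IsResolventAt A w S) (hx : x ∈ spectrum ℂ S) (h0 : x ≠ 0) : w + x⁻¹ ∈ sigma A := by
  rintro ⟨R, hR⟩
  exact hR.one_sub_mul_ne_zero hS x hx (by simp [h0])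

/-- The projection equals `χ(R)`, where `χ(x)` is the winding number of `Γ` around `E = r + x⁻¹`, so
`χ` takes only the values 0 and 1. The operator `B` is `a(R)` with `a(x) = E χ(x)`. -/
theorem exists_isReducedBy_spectralProjection {A : L2 →ₗ.[ℂ] L2}
    (hA : ∀ u v : A.domain, inner ℂ (A u) (v : L2) = inner ℂ (u : L2) (A v))
    {σ₀ : Set ℝ} (hne : σ₀.Nonempty)
    {Γ : Contour} (hΓ : Γ.Encloses A σ₀) {e : ℝ} (he : ∀ E ∈ σ₀, E ≤ -e) :
    ∃ B, IsReducedBy A (spectralProjection A Γ) B ∧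
      ∀ u, (inner ℂ u (B u)).re ≤ -e * ‖spectralProjection A Γ u‖ ^ 2 := by
  obtain ⟨hΓρ, hin, hout⟩ := hΓ
  obtain ⟨E₀, hE₀⟩ := hne
  obtain ⟨r, hr⟩ := Γ.exists_real_mem_trace (hin E₀ hE₀)
  have hR := isResolventAt_resolventOp (hΓρ hr)
  set R := resolventOp A r
  have hsa : IsSelfAdjoint R := hR.isSelfAdjoint hA
  have hn : IsStarNormal R := hsa.isStarNormal
  have hne0 : ∀ z ∈ Γ.trace, ∀ x ∈ spectrum ℂ R, 1 - (z - r) * x ≠ 0 := fun z hz =>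
    (isResolventAt_resolventOp (hΓρ hz)).one_sub_mul_ne_zero hR
  -- Integrating in the Banach space of continuous functions makes `χ` and `a` continuous from the
  -- outset; their values are then computed pointwise.
  let F : ℂ → C(spectrum ℂ R, ℂ) := fun z => resolventFun (spectrum ℂ R) (z - r)
  have hF : ContinuousOn F Γ.trace := fun z hz =>
    (ContinuousAt.comp (f := fun z : ℂ => z - r) (continuousAt_resolventFun (hne0 z hz))
      (by fun_prop)).continuousWithinAt
  have hF' : ContinuousOn (fun z => z • F z) Γ.trace := continuousOn_id.smul hF
  let c : ℂ := Complex.I / (2 * Real.pi)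
  let χ := c • Γ.integral F
  let a := c • Γ.integral (fun z => z • F z)
  let T : C(spectrum ℂ R, ℂ) →L[ℂ] (L2 →L[ℂ] L2) :=
    ⟨(cfcHom hn : C(spectrum ℂ R, ℂ) →⋆ₐ[ℂ] (L2 →L[ℂ] L2)).toAlgHom.toLinearMap,
      cfcHom_continuous hn⟩
  have hP : spectralProjection A Γ = cfcHom hn χ := by
    rw [spectralProjection, map_smul]
    congr 1
    refine Eq.trans (Γ.integral_congr fun z hz => ?_) (Γ.integral_map (f := F) T hF)
    exact ((isResolventAt_resolventOp (hΓρ hz)).cfcHom_resolventFun hR hn).symm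
  have hev : ∀ (x : spectrum ℂ R) {f : ℂ → C(spectrum ℂ R, ℂ)}, ContinuousOn f Γ.trace →
      (Γ.integral f) x = Γ.integral (fun z => f z x) := fun x f hf =>
    (Γ.integral_map (f := f) (ContinuousMap.evalCLM ℂ x) hf).symm
  have hval : ∀ x : spectrum ℂ R, (χ x = 0 ∧ a x = 0) ∨ (χ x = 1 ∧ (x : ℂ) ≠ 0 ∧
      ∃ E ∈ σ₀, r + (x : ℂ)⁻¹ = (E : ℂ) ∧ a x = E) := by
    intro x
    have hχx : χ x = c * Γ.integral (fun z => (x : ℂ) / (1 - (z - r) * x)) := by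
      simp only [χ, ContinuousMap.smul_apply, smul_eq_mul, hev x hF]
      congr 1
      exact Γ.integral_congr fun z hz => resolventFun_apply (hne0 z hz) x
    have hax : a x = c * Γ.integral (fun z => z * ((x : ℂ) / (1 - (z - r) * x))) := by
      simp only [a, ContinuousMap.smul_apply, smul_eq_mul, hev x hF']
      congr 1
      refine Γ.integral_congr fun z hz => ?_
      exact congrArg (z * ·) (resolventFun_apply (hne0 z hz) x)
    -- The point `x = 0` corresponds to `E = ∞`; there the integrands vanish or are zero multiples
    -- of `z`.
    by_cases hx0 : (x : ℂ) = 0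
    · left
      rw [hχx, hax]
      simp [hx0, Contour.integral_const]
    have hσ := mem_sigma_of_mem_spectrum hR x.2 hx0
    obtain ⟨E, hE⟩ : ∃ E : ℝ, r + (x : ℂ)⁻¹ = (E : ℂ) := by
      have := hsa.mem_spectrum_eq_re x.2
      exact ⟨r + (x : ℂ).re⁻¹, by conv_lhs => rw [this]
                                  push_cast; rfl⟩
    have hEz : ∀ z ∈ Γ.trace, z - E ≠ 0 := fun z hz h => by
      rw [hE, ← sub_eq_zero.mp h] at hσ
      exact hσ (hΓρ hz)
    have hfz : ∀ z ∈ Γ.trace, (x : ℂ) / (1 - (z - r) * x) = -(z - E)⁻¹ := fun z hz => by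
      have h1 := hne0 z hz x x.2
      have h2 := hEz z hz
      have h3 : 1 - (z - r) * x = -((z - E) * x) := by
        rw [← hE]; linear_combination -(inv_mul_cancel₀ hx0)
      rw [h3, div_neg, ← div_div, div_right_comm, div_self hx0, one_div]
    have hcont : ContinuousOn (fun z : ℂ => (z - E)⁻¹) Γ.trace :=
      (continuousOn_id.sub continuousOn_const).inv₀ hEz
    -- The sign reconciles `(E - z)⁻¹`, coming from the resolvent, with `(z - E)⁻¹` in the winding
    -- number.
    have h2πI : c * -1 = (2 * Real.pi * Complex.I)⁻¹ := by
      simp only [c]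
      field_simp
      simp
    have hχi : χ x = Γ.index E := by
      rw [hχx, Γ.integral_congr hfz, Contour.index, ← h2πI]
      simp_rw [← neg_one_mul ((_ : ℂ)⁻¹)]
      rw [Γ.integral_const_mul, mul_assoc]
    have hai : a x = E * Γ.index E := by
      have key : Γ.integral (fun z => z * ((x : ℂ) / (1 - (z - r) * x))) =
          E * (-1 * Γ.integral (fun z => (z - E)⁻¹)) := by
        -- Since `z / (z - E) = 1 + E / (z - E)`, the constant part integrates to zero over closed
        -- curves.
        rw [Γ.integral_congr (g := fun z => -1 + E * (-1 * (z - E)⁻¹)) fun z hz => ?_]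
        · rw [Γ.integral_add continuousOn_const (by fun_prop), Γ.integral_const, zero_add,
            Γ.integral_const_mul, Γ.integral_const_mul]
        · rw [hfz z hz]
          have := hEz z hz
          field_simp
          ring
      rw [hax, key, Contour.index, ← h2πI]
      ring
    rw [hE] at hσ
    by_cases hEσ : E ∈ σ₀
    · right
      rw [hin E hEσ] at hχi hai
      exact ⟨hχi, hx0, E, hEσ, hE, by simpa using hai⟩
    · left
      rw [hout E ⟨hσ, fun ⟨E', hE', h⟩ => hEσ (Complex.ofReal_injective h ▸ hE')⟩] at hχi hai
      exact ⟨hχi, by simpa using hai⟩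
  have hred : IsReducedBy A (cfcHom hn χ) (cfcHom hn a) := by
    refine .of_cfcHom hR hn fun x => (hval x).imp_right ?_
    rintro ⟨h1, h2, E, -, h3, h4⟩
    exact ⟨h1, h2, h4.trans h3.symm⟩
  refine ⟨cfcHom hn a, hP ▸ hred, fun u => ?_⟩
  rw [hP]
  refine re_inner_cfcHom_le hn (fun x => (hval x).imp_right ?_) hred.isSelfAdjoint hred.mul_self u
  rintro ⟨h1, h2, E, hE, h3, h4⟩
  simpa [h1, h4] using he E hE

open scoped LineDeriv

/-! ### The Sobolev space `H²` as a closure of Schwartz functions -/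

/-- The `i`-th coordinate direction. -/
def dir (i : Fin 3) : Space := EuclideanSpace.single i 1

theorem laplacian_eq_sum_dir (ψ : 𝓢(Space, ℂ)) : Δ ψ = ∑ i, ∂_{dir i} (∂_{dir i} ψ) := by
  rw [SchwartzMap.laplacian_eq_sum (EuclideanSpace.basisFun (Fin 3) ℝ)]
  simp [dir]

/-- The `L²` class of a Schwartz function. -/
def cls : 𝓢(Space, ℂ) →L[ℂ] L2 := SchwartzMap.toLpCLM ℂ ℂ 2 (volume : Measure Space)

theorem coeFn_cls (ψ : 𝓢(Space, ℂ)) : cls ψ =ᵐ[volume] ψ := ψ.coeFn_toLp 2 volume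

theorem schwartz_laplacian_sub (φ ψ : 𝓢(Space, ℂ)) : Δ (φ - ψ) = Δ φ - Δ ψ :=
  map_sub (LineDeriv.laplacianCLM ℝ Space 𝓢(Space, ℂ)) φ ψ

/-- The triple of the `L²` classes of `ψ`, of its gradient and of its Laplacian. -/
def jet : 𝓢(Space, ℂ) →ₗ[ℂ] L2 × (Fin 3 → L2) × L2 where
  toFun ψ := (cls ψ, fun i => cls (∂_{dir i} ψ), cls (Δ ψ))
  map_add' φ ψ := by
    refine Prod.ext (map_add cls φ ψ) (Prod.ext (funext fun i => ?_) ?_)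
    · exact (congrArg cls (LineDeriv.lineDerivOp_add (dir i) φ ψ)).trans (map_add cls _ _)
    · exact (congrArg cls (map_add (LineDeriv.laplacianCLM ℝ Space 𝓢(Space, ℂ)) φ ψ)).trans
        (map_add cls _ _)
  map_smul' c ψ := by
    refine Prod.ext (map_smul cls c ψ) (Prod.ext (funext fun i => ?_) ?_)
    · exact (congrArg cls (LineDeriv.lineDerivOp_smul (dir i) c ψ)).trans (map_smul cls c _)
    · have h := map_smul (LineDeriv.laplacianCLM ℂ Space 𝓢(Space, ℂ)) c ψ
      simp only [SchwartzMap.laplacianCLM_eq] at h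
      exact (congrArg cls h).trans (map_smul cls c _)

theorem jet_apply (ψ : 𝓢(Space, ℂ)) :
    jet ψ = (cls ψ, fun i => cls (∂_{dir i} ψ), cls (Δ ψ)) := rfl

/-- `(u, G, f)` is an `H²` function with its gradient and its Laplacian. -/
def IsJet (u : L2) (G : Fin 3 → L2) (f : L2) : Prop := (u, G, f) ∈ closure (range jet)

/-- The working principle for `H²`: closed properties need only be checked on Schwartz functions. -/
theorem IsJet.induction {p : L2 × (Fin 3 → L2) × L2 → Prop} (hp : IsClosed {x | p x})
    (h : ∀ ψ, p (jet ψ)) {u f : L2} {G : Fin 3 → L2} (hu : IsJet u G f) : p (u, G, f) :=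
  closure_minimal (range_subset_iff.mpr h) hp hu

theorem inner_laplacian_schwartz (φ ψ : 𝓢(Space, ℂ)) :
    inner ℂ (cls (Δ φ)) (cls ψ) =
      -∑ i, inner ℂ (cls (∂_{dir i} φ)) (cls (∂_{dir i} ψ)) := by
  -- The inner product is only sesquilinear over `ℂ`; viewed over `ℝ` it is bilinear, as the
  -- integration by parts formula requires.
  let L : ℂ →L[ℝ] ℂ →L[ℝ] ℂ := (ContinuousLinearMap.mul ℝ ℂ).comp Complex.conjCLE.toContinuousLinearMap
  have hL : ∀ f g : 𝓢(Space, ℂ), inner ℂ (cls f) (cls g) = ∫ x, L (f x) (g x) := by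
    intro f g
    refine (SchwartzMap.inner_toL2_toL2_eq f g volume).trans ?_
    refine integral_congr_ae (Eventually.of_forall fun x => ?_)
    simp [L, mul_comm]
  rw [laplacian_eq_sum_dir, map_sum, sum_inner,
    ← Finset.sum_neg_distrib]
  refine Finset.sum_congr rfl fun i _ => ?_
  rw [hL, hL,
    SchwartzMap.integral_bilinear_lineDerivOp_right_eq_neg_left, neg_neg]

/-- Integration by parts in `H²`. -/
theorem IsJet.inner_laplacian {u f u' f' : L2} {G G' : Fin 3 → L2} (h : IsJet u G f)
    (h' : IsJet u' G' f') : inner ℂ f u' = -∑ i, inner ℂ (G i) (G' i) := by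
  refine h.induction (p := fun x => inner ℂ x.2.2 u' = -∑ i, inner ℂ (x.2.1 i) (G' i))
    (isClosed_eq (by fun_prop) (by fun_prop)) fun φ => ?_
  refine h'.induction (p := fun x => inner ℂ (jet φ).2.2 x.1 =
    -∑ i, inner ℂ ((jet φ).2.1 i) (x.2.1 i)) (isClosed_eq (by fun_prop) (by fun_prop)) fun ψ => ?_
  exact inner_laplacian_schwartz φ ψ

/-- Integration by parts gives `‖ψ - Δψ‖² = ‖ψ‖² + 2‖∇ψ‖² + ‖Δψ‖²`. -/
theorem norm_jet_le (ψ : 𝓢(Space, ℂ)) : ‖jet ψ‖ ≤ ‖(cls (ψ - Δ ψ))‖ := by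
  have hj : IsJet (cls ψ) (fun i => cls (∂_{dir i} ψ)) (cls (Δ ψ)) :=
    subset_closure ⟨ψ, jet_apply ψ⟩
  have h1 := congrArg Complex.re (hj.inner_laplacian hj)
  have h2 : (cls (ψ - Δ ψ)) = cls ψ - cls (Δ ψ) :=
    map_sub cls ψ (Δ ψ)
  have h3 := norm_sub_sq (𝕜 := ℂ) (cls (Δ ψ)) (cls ψ)
  have h4 : ∀ i, (inner ℂ (cls (∂_{dir i} ψ)) (cls (∂_{dir i} ψ))).re =
    ‖(cls (∂_{dir i} ψ))‖ ^ 2 := fun i => inner_self_eq_norm_sq (𝕜 := ℂ) _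
  simp only [Complex.neg_re, Complex.re_sum, h4] at h1
  rw [norm_sub_rev, ← h2, RCLike.re_eq_complex_re, h1] at h3
  have h5 : ∀ i, ‖cls (∂_{dir i} ψ)‖ ^ 2 ≤ ∑ i, ‖cls (∂_{dir i} ψ)‖ ^ 2 := fun i =>
    Finset.single_le_sum (f := fun i => ‖cls (∂_{dir i} ψ)‖ ^ 2) (fun i _ => sq_nonneg _)
      (Finset.mem_univ i)
  have h6 := sq_nonneg ‖cls ψ‖
  have h7 := sq_nonneg ‖cls (Δ ψ)‖
  have h8 := (sq_nonneg _).trans (h5 0)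
  rw [jet_apply, Prod.norm_mk, Prod.norm_mk]
  generalize ∑ i, ‖cls (∂_{dir i} ψ)‖ ^ 2 = S at *
  refine max_le ?_ (max_le ?_ ?_)
  · exact (abs_le_of_sq_le_sq' (by linarith) (norm_nonneg _)).2
  · refine (pi_norm_le_iff_of_nonneg (norm_nonneg _)).mpr fun i => ?_
    have := h5 i
    exact (abs_le_of_sq_le_sq' (by linarith) (norm_nonneg _)).2
  · exact (abs_le_of_sq_le_sq' (by linarith) (norm_nonneg _)).2

theorem IsJet.hasLaplacian {u f : L2} {G : Fin 3 → L2} (h : IsJet u G f) : HasLaplacian u f := by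
  rw [hasLaplacian_iff]
  refine h.induction (p := fun x => LineDeriv.laplacianCLM ℂ Space 𝓢'(Space, ℂ)
      (Lp.toTemperedDistributionCLM ℂ (volume : Measure Space) 2 x.1) =
      Lp.toTemperedDistributionCLM ℂ (volume : Measure Space) 2 x.2.2)
    (isClosed_eq (by fun_prop) (by fun_prop)) fun ψ => ?_
  rw [← hasLaplacian_iff, HasLaplacian]
  rw [jet_apply]
  have hc : ∀ φ : 𝓢(Space, ℂ), ((cls φ : L2) : 𝓢'(Space, ℂ)) = (φ : 𝓢'(Space, ℂ)) := fun φ =>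
    Lp.toTemperedDistribution_toLp_eq φ
  rw [hc, hc]
  exact TemperedDistribution.laplacian_toTemperedDistributionCLM_eq ψ

/-- The solution has Fourier multiplier `(1 + 4π²|ξ|²)⁻¹`, a smooth function of temperate growth, so
it preserves Schwartz space. -/
theorem exists_schwartz_sub_laplacian (g : 𝓢(Space, ℂ)) : ∃ ψ : 𝓢(Space, ℂ), ψ - Δ ψ = g := by
  let m : Space → ℝ := fun x => 1 + (2 * Real.pi) ^ 2 * ‖x‖ ^ 2
  let e : Space →L[ℝ] Space := (2 * Real.pi) • ContinuousLinearMap.id ℝ Space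
  let k : Space → ℝ := (fun x => (1 + ‖x‖ ^ 2) ^ (-1 : ℝ)) ∘ e
  have hk : k.HasTemperateGrowth :=
    (Function.hasTemperateGrowth_one_add_norm_sq_rpow Space (-1)).comp e.hasTemperateGrowth
  have hn : (fun x : Space => ‖x‖ ^ 2).HasTemperateGrowth := by fun_prop
  refine ⟨SchwartzMap.fourierMultiplierCLM ℂ k g, ?_⟩
  rw [SchwartzMap.laplacian_eq_fourierMultiplierCLM]
  have h0 : (‖·‖ ^ 2 : Space → ℝ) = fun x => ‖x‖ ^ 2 := rfl
  rw [h0, SchwartzMap.fourierMultiplierCLM_fourierMultiplierCLM_apply hn hk]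
  have h1 : SchwartzMap.fourierMultiplierCLM ℂ k g +
      (2 * Real.pi) ^ 2 • SchwartzMap.fourierMultiplierCLM ℂ ((fun x => ‖x‖ ^ 2) * k) g =
      SchwartzMap.fourierMultiplierCLM ℂ (fun _ => (1 : ℝ)) g := by
    simp only [SchwartzMap.fourierMultiplierCLM_apply]
    rw [← FourierTransform.fourierInv_smul, ← FourierTransform.fourierInv_add]
    congr 1
    ext x
    have hx : k x = (1 + (2 * Real.pi) ^ 2 * ‖x‖ ^ 2)⁻¹ := by
      simp [k, e, norm_smul, Real.rpow_neg_one, mul_pow, abs_of_pos Real.pi_pos]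
    rw [add_apply, smul_apply, SchwartzMap.smulLeftCLM_apply_apply hk,
      SchwartzMap.smulLeftCLM_apply_apply (hn.mul hk),
      SchwartzMap.smulLeftCLM_apply_apply (by fun_prop), Pi.mul_apply, hx, smul_smul, ← add_smul]
    congr 1
    field_simp
  rw [neg_smul, sub_neg_eq_add, h1]
  simp

/-- Schwartz functions `s n` approximate `u - f`. The solutions of `ψ - Δψ = s n` have Cauchy jets
by `norm_jet_le`, and their limit is identified with `u` by uniqueness for `1 - Δ`. -/
theorem HasLaplacian.exists_isJet {u f : L2} (h : HasLaplacian u f) : ∃ G, IsJet u G f := by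
  obtain ⟨s, hs⟩ : ∃ s : ℕ → 𝓢(Space, ℂ), Tendsto (fun n => cls (s n)) atTop (𝓝 (u - f)) := by
    have hd : DenseRange cls :=
      SchwartzMap.denseRange_toLpCLM (E := Space) (F := ℂ) (p := 2) (μ := volume) (by simp)
    obtain ⟨t, ht, htu⟩ := mem_closure_iff_seq_limit.mp (hd (u - f))
    choose s hs using ht
    exact ⟨s, by simpa only [hs] using htu⟩
  choose ψ hψ using fun n => exists_schwartz_sub_laplacian (s n)
  have hd : ∀ n m, dist (jet (ψ n)) (jet (ψ m)) ≤ dist (cls (s n)) (cls (s m)) := by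
    intro n m
    rw [dist_eq_norm, dist_eq_norm, ← map_sub]
    refine (norm_jet_le _).trans_eq (congrArg norm ?_)
    rw [← hψ n, ← hψ m, schwartz_laplacian_sub, sub_sub_sub_comm]
    exact map_sub cls _ _
  have hc : CauchySeq fun n => jet (ψ n) := by
    rw [Metric.cauchySeq_iff]
    intro ε hε
    obtain ⟨N, hN⟩ := Metric.cauchySeq_iff.mp hs.cauchySeq ε hε
    exact ⟨N, fun m hm n hn => (hd m n).trans_lt (hN m hm n hn)⟩
  obtain ⟨⟨u', G, f'⟩, hlim⟩ := cauchySeq_tendsto_of_complete hc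
  have hj : IsJet u' G f' := mem_closure_of_tendsto hlim (Eventually.of_forall fun n => ⟨_, rfl⟩)
  have huf : u' - f' = u - f := by
    refine tendsto_nhds_unique (hlim.fst_nhds.sub hlim.snd_nhds.snd_nhds) (hs.congr fun n => ?_)
    rw [← hψ, jet_apply]
    exact map_sub cls (ψ n) (Δ (ψ n))
  have hv : u = u' := by
    rw [← sub_eq_zero]
    have h1 : HasLaplacian (u - u') (u - u') := by
      have := h.add (hj.hasLaplacian.smul (-1))
      rw [neg_one_smul, neg_one_smul, ← sub_eq_add_neg, ← sub_eq_add_neg] at this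
      convert this using 1
      rw [sub_eq_sub_iff_sub_eq_sub] at huf
      rw [← sub_eq_zero] at huf ⊢
      rw [← neg_eq_zero, ← huf]; abel
    -- A distribution with `Δv = v` annihilates every `φ - Δφ`, hence every Schwartz function.
    have h2 : ((u - u' : L2) : 𝓢'(Space, ℂ)) = 0 := by
      ext g
      obtain ⟨φ, hφ⟩ := exists_schwartz_sub_laplacian g
      have h3 := DFunLike.congr_fun h1 φ
      rw [TemperedDistribution.laplacian_apply_apply] at h3
      rw [← hφ, map_sub, h3, sub_self]
      rfl
    exact LinearMap.ker_eq_bot'.mp (Lp.ker_toTemperedDistributionCLM_eq_bot (F := ℂ)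
      (μ := (volume : Measure Space)) (p := 2)) _ h2
  subst hv
  rw [sub_right_inj] at huf
  exact ⟨G, huf ▸ hj⟩

/-! ### Multiplication by bounded functions -/

/-- `w` is measurable and bounded. -/
structure IsBdd (w : Space → ℝ) : Prop where
  aesm : AEStronglyMeasurable w volume
  bdd : ∃ C, ∀ x, |w x| ≤ C

namespace IsBdd

variable {w v : Space → ℝ}

theorem memLp_mul (hw : IsBdd w) (u : L2) : MemLp (fun x => (w x : ℂ) * u x) 2 volume := by
  obtain ⟨C, hC⟩ := hw.bdd
  refine MemLp.of_le_mul (c := C) (Lp.memLp u)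
    ((Complex.continuous_ofReal.comp_aestronglyMeasurable hw.aesm).mul (Lp.aestronglyMeasurable u))
    (Eventually.of_forall fun x => ?_)
  rw [norm_mul, Complex.norm_real, Real.norm_eq_abs]
  exact mul_le_mul_of_nonneg_right (hC x) (norm_nonneg _)

theorem mem_domain (hw : IsBdd w) (u : L2) : u ∈ (mulOp w).domain := hw.memLp_mul u

theorem mul (hw : IsBdd w) (hv : IsBdd v) : IsBdd fun x => w x * v x := by
  obtain ⟨C, hC⟩ := hw.bdd
  obtain ⟨D, hD⟩ := hv.bdd
  refine ⟨hw.aesm.mul hv.aesm, C * D, fun x => ?_⟩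
  rw [abs_mul]
  exact mul_le_mul (hC x) (hD x) (abs_nonneg _) ((abs_nonneg _).trans (hC x))

end IsBdd

theorem coeFn_mulOp {w : Space → ℝ} (u : (mulOp w).domain) :
    mulOp w u =ᵐ[volume] fun x => (w x : ℂ) * (u : L2) x :=
  MemLp.coeFn_toLp u.2

theorem norm_mulOp_le {w : Space → ℝ} {C : ℝ} (u : (mulOp w).domain) (hC : ∀ x, |w x| ≤ C) :
    ‖mulOp w u‖ ≤ C * ‖(u : L2)‖ := by
  refine Lp.norm_le_mul_norm_of_ae_le_mul ?_
  filter_upwards [coeFn_mulOp u] with x hx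
  rw [hx, norm_mul, Complex.norm_real, Real.norm_eq_abs]
  exact mul_le_mul_of_nonneg_right (hC x) (norm_nonneg _)

/-- Multiplication by a bounded function, as a bounded operator. -/
def mulL (w : Space → ℝ) (hw : IsBdd w) : L2 →L[ℂ] L2 :=
  LinearMap.mkContinuous
    { toFun := fun u => mulOp w ⟨u, hw.mem_domain u⟩
      map_add' := fun u v => (mulOp w).map_add ⟨u, hw.mem_domain u⟩ ⟨v, hw.mem_domain v⟩
      map_smul' := fun c u => (mulOp w).map_smul c ⟨u, hw.mem_domain u⟩ }
    hw.bdd.choose fun _ => norm_mulOp_le _ hw.bdd.choose_spec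

section mulL

variable {w v : Space → ℝ} (hw : IsBdd w) (hv : IsBdd v)

theorem coeFn_mulL (u : L2) : mulL w hw u =ᵐ[volume] fun x => (w x : ℂ) * u x :=
  coeFn_mulOp (w := w) ⟨u, hw.mem_domain u⟩

theorem norm_mulL_le {C : ℝ} (hC : ∀ x, |w x| ≤ C) (u : L2) : ‖mulL w hw u‖ ≤ C * ‖u‖ :=
  norm_mulOp_le (w := w) ⟨u, hw.mem_domain u⟩ hC

theorem norm_mulL_le_mul {c : ℝ} (h : ∀ x, |w x| ≤ c * |v x|) (u : L2) :
    ‖mulL w hw u‖ ≤ c * ‖mulL v hv u‖ := by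
  refine Lp.norm_le_mul_norm_of_ae_le_mul ?_
  filter_upwards [coeFn_mulL hw u, coeFn_mulL hv u] with x hx hy
  rw [hx, hy, norm_mul, norm_mul, Complex.norm_real, Complex.norm_real, Real.norm_eq_abs,
    Real.norm_eq_abs, ← mul_assoc]
  exact mul_le_mul_of_nonneg_right (h x) (norm_nonneg _)

theorem mulL_mulL (u : L2) : mulL w hw (mulL v hv u) = mulL _ (hw.mul hv) u := by
  refine Lp.ext ?_
  filter_upwards [coeFn_mulL hw (mulL v hv u), coeFn_mulL hv u, coeFn_mulL (hw.mul hv) u]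
    with x h1 h2 h3
  rw [h1, h2, h3]
  push_cast
  ring

theorem mulL_congr (h : w = v) (u : L2) : mulL w hw u = mulL v hv u := by
  subst h; rfl

theorem mulL_comm (u : L2) : mulL w hw (mulL v hv u) = mulL v hv (mulL w hw u) := by
  rw [mulL_mulL, mulL_mulL]
  exact mulL_congr _ _ (funext fun x => mul_comm _ _) u

theorem inner_mulL (u u' : L2) : inner ℂ (mulL w hw u) u' = inner ℂ u (mulL w hw u') := by
  refine integral_congr_ae ?_
  filter_upwards [coeFn_mulL hw u, coeFn_mulL hw u'] with x h1 h2
  rw [h1, h2]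
  simp only [RCLike.inner_apply, map_mul, Complex.conj_ofReal]
  ring

end mulL

/-! ### Multiplication of `H²` functions by weights -/

/-- `w` is a bounded smooth function with the bounded first and second derivatives `∂ᵢw = dw i` and
`∂ᵢ²w = ddw i`. -/
structure IsWeight (w : Space → ℝ) (dw ddw : Fin 3 → Space → ℝ) : Prop where
  temperate : w.HasTemperateGrowth
  bdd : IsBdd w
  bdd_deriv : ∀ i, IsBdd (dw i)
  bdd_deriv_two : ∀ i, IsBdd (ddw i)
  hasDeriv : ∀ i x, HasLineDerivAt ℝ w (dw i x) x (dir i)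
  hasDeriv_two : ∀ i x, HasLineDerivAt ℝ (dw i) (ddw i x) x (dir i)

section weight

variable {w : Space → ℝ} {dw ddw : Fin 3 → Space → ℝ}

/-- The product rule for a real and a complex function. -/
theorem _root_.HasLineDerivAt.ofReal_mul {a : Space → ℝ} {a' : ℝ} {f : Space → ℂ} {f' : ℂ}
    {x v : Space} (ha : HasLineDerivAt ℝ a a' x v) (hf : HasLineDerivAt ℝ f f' x v) :
    HasLineDerivAt ℝ (fun y => (a y : ℂ) * f y) (a x * f' + a' * f x) x v := by
  have := (HasDerivAt.ofReal_comp ha).mul hf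
  unfold HasLineDerivAt
  refine HasDerivAt.congr_deriv (f := fun t : ℝ => (a (x + t • v) : ℂ) * f (x + t • v)) this ?_
  simp [add_comm]

theorem schwartz_hasLineDerivAt (ψ : 𝓢(Space, ℂ)) (x v : Space) :
    HasLineDerivAt ℝ ψ (∂_{v} ψ x) x v := by
  rw [SchwartzMap.lineDerivOp_apply_eq_fderiv]
  exact (ψ.hasFDerivAt x).hasLineDerivAt v

theorem IsWeight.mul_apply (hw : IsWeight w dw ddw) (ψ : 𝓢(Space, ℂ)) (x : Space) :
    SchwartzMap.smulLeftCLM ℂ w ψ x = w x * ψ x := by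
  rw [SchwartzMap.smulLeftCLM_apply_apply hw.temperate, Complex.real_smul]

theorem IsWeight.lineDeriv_mul (hw : IsWeight w dw ddw) (ψ : 𝓢(Space, ℂ)) (i : Fin 3) (x : Space) :
    ∂_{dir i} (SchwartzMap.smulLeftCLM ℂ w ψ) x = w x * ∂_{dir i} ψ x + dw i x * ψ x := by
  have h : ⇑(SchwartzMap.smulLeftCLM ℂ w ψ) = fun x => (w x : ℂ) * ψ x := funext (hw.mul_apply ψ)
  rw [SchwartzMap.lineDerivOp_apply, h]
  exact ((hw.hasDeriv i x).ofReal_mul (schwartz_hasLineDerivAt ψ x (dir i))).lineDeriv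

theorem IsWeight.lineDeriv_lineDeriv_mul (hw : IsWeight w dw ddw) (ψ : 𝓢(Space, ℂ)) (i : Fin 3)
    (x : Space) : ∂_{dir i} (∂_{dir i} (SchwartzMap.smulLeftCLM ℂ w ψ)) x =
      w x * ∂_{dir i} (∂_{dir i} ψ) x + (2 * (dw i x * ∂_{dir i} ψ x) + ddw i x * ψ x) := by
  have h : ⇑(∂_{dir i} (SchwartzMap.smulLeftCLM ℂ w ψ) : 𝓢(Space, ℂ)) =
      fun x => w x * ∂_{dir i} ψ x + dw i x * ψ x := funext (hw.lineDeriv_mul ψ i)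
  rw [SchwartzMap.lineDerivOp_apply, h]
  have h1 := (hw.hasDeriv i x).ofReal_mul (schwartz_hasLineDerivAt (∂_{dir i} ψ) x (dir i))
  have h2 := (hw.hasDeriv_two i x).ofReal_mul (schwartz_hasLineDerivAt ψ x (dir i))
  unfold HasLineDerivAt at h1 h2
  refine (HasDerivAt.deriv (h1.fun_add h2)).trans ?_
  ring

theorem IsWeight.jet_mul (hw : IsWeight w dw ddw) (ψ : 𝓢(Space, ℂ)) :
    jet (SchwartzMap.smulLeftCLM ℂ w ψ) = (mulL w hw.bdd (cls ψ),
      fun i => mulL w hw.bdd (cls (∂_{dir i} ψ)) + mulL (dw i) (hw.bdd_deriv i) (cls ψ),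
      mulL w hw.bdd (cls (Δ ψ)) + ∑ i, ((2 : ℂ) • mulL (dw i) (hw.bdd_deriv i) (cls (∂_{dir i} ψ)) +
        mulL (ddw i) (hw.bdd_deriv_two i) (cls ψ))) := by
  have h1 : ∀ i, cls (∂_{dir i} (∂_{dir i} (SchwartzMap.smulLeftCLM ℂ w ψ))) =
      mulL w hw.bdd (cls (∂_{dir i} (∂_{dir i} ψ))) +
        ((2 : ℂ) • mulL (dw i) (hw.bdd_deriv i) (cls (∂_{dir i} ψ)) +
        mulL (ddw i) (hw.bdd_deriv_two i) (cls ψ)) := by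
    intro i
    refine Lp.ext ?_
    filter_upwards [coeFn_cls (∂_{dir i} (∂_{dir i} (SchwartzMap.smulLeftCLM ℂ w ψ))),
      Lp.coeFn_add (mulL w hw.bdd (cls (∂_{dir i} (∂_{dir i} ψ))))
        ((2 : ℂ) • mulL (dw i) (hw.bdd_deriv i) (cls (∂_{dir i} ψ)) +
          mulL (ddw i) (hw.bdd_deriv_two i) (cls ψ)),
      Lp.coeFn_add ((2 : ℂ) • mulL (dw i) (hw.bdd_deriv i) (cls (∂_{dir i} ψ)))
          (mulL (ddw i) (hw.bdd_deriv_two i) (cls ψ)),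
      Lp.coeFn_smul (2 : ℂ) (mulL (dw i) (hw.bdd_deriv i) (cls (∂_{dir i} ψ))),
      coeFn_mulL hw.bdd (cls (∂_{dir i} (∂_{dir i} ψ))),
      coeFn_mulL (hw.bdd_deriv i) (cls (∂_{dir i} ψ)), coeFn_mulL (hw.bdd_deriv_two i) (cls ψ),
      coeFn_cls ψ, coeFn_cls (∂_{dir i} ψ), coeFn_cls (∂_{dir i} (∂_{dir i} ψ))]
      with x e1 e2 e3 e4 e5 e6 e7 e8 e9 e10
    rw [e1, e2, Pi.add_apply, e3, Pi.add_apply, e4, Pi.smul_apply, e5, e6, e7, e8, e9, e10,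
      hw.lineDeriv_lineDeriv_mul, smul_eq_mul]
  rw [jet_apply]
  refine Prod.ext ?_ (Prod.ext (funext fun i => ?_) ?_)
  · refine Lp.ext ?_
    filter_upwards [coeFn_cls (SchwartzMap.smulLeftCLM ℂ w ψ), coeFn_mulL hw.bdd (cls ψ),
      coeFn_cls ψ] with x e1 e2 e3
    rw [e1, e2, e3, hw.mul_apply]
  · refine Lp.ext ?_
    filter_upwards [coeFn_cls (∂_{dir i} (SchwartzMap.smulLeftCLM ℂ w ψ)),
      Lp.coeFn_add (mulL w hw.bdd (cls (∂_{dir i} ψ))) (mulL (dw i) (hw.bdd_deriv i) (cls ψ)),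
      coeFn_mulL hw.bdd (cls (∂_{dir i} ψ)), coeFn_mulL (hw.bdd_deriv i) (cls ψ),
      coeFn_cls ψ, coeFn_cls (∂_{dir i} ψ)] with x e1 e2 e3 e4 e5 e6
    rw [e1, e2, Pi.add_apply, e3, e4, e5, e6, hw.lineDeriv_mul]
  · dsimp only
    rw [laplacian_eq_sum_dir, laplacian_eq_sum_dir ψ, map_sum, map_sum, map_sum,
      ← Finset.sum_add_distrib]
    exact Finset.sum_congr rfl fun i _ => h1 i

/-- The product rule holds on Schwartz functions and survives the closure, because multiplication by
`w` and its derivatives is bounded on `L²`. -/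
theorem IsJet.mul (hw : IsWeight w dw ddw) {u f : L2} {G : Fin 3 → L2} (h : IsJet u G f) :
    IsJet (mulL w hw.bdd u) (fun i => mulL w hw.bdd (G i) + mulL (dw i) (hw.bdd_deriv i) u)
      (mulL w hw.bdd f + ∑ i, ((2 : ℂ) • mulL (dw i) (hw.bdd_deriv i) (G i) +
        mulL (ddw i) (hw.bdd_deriv_two i) u)) := by
  refine h.induction (p := fun x => IsJet (mulL w hw.bdd x.1)
    (fun i => mulL w hw.bdd (x.2.1 i) + mulL (dw i) (hw.bdd_deriv i) x.1)
    (mulL w hw.bdd x.2.2 + ∑ i, ((2 : ℂ) • mulL (dw i) (hw.bdd_deriv i) (x.2.1 i) +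
        mulL (ddw i) (hw.bdd_deriv_two i) x.1))) ?_ fun ψ => ?_
  · exact isClosed_closure.preimage (f := fun x : L2 × (Fin 3 → L2) × L2 => (mulL w hw.bdd x.1,
      (fun i => mulL w hw.bdd (x.2.1 i) + mulL (dw i) (hw.bdd_deriv i) x.1),
      mulL w hw.bdd x.2.2 + ∑ i, ((2 : ℂ) • mulL (dw i) (hw.bdd_deriv i) (x.2.1 i) +
        mulL (ddw i) (hw.bdd_deriv_two i) x.1))) (by fun_prop)
  · exact subset_closure ⟨SchwartzMap.smulLeftCLM ℂ w ψ, hw.jet_mul ψ⟩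

end weight

/-! ### A local Sobolev inequality -/

theorem rpow_mul_rpow_le (a b : ℝ≥0∞) {δ : ℝ≥0} (hδ : 0 < δ) :
    a ^ (1 / 4 : ℝ) * b ^ (3 / 4 : ℝ) ≤ δ * b + (δ ^ 3)⁻¹ * a := by
  have hδ' : (δ : ℝ≥0∞) ≠ 0 := by simpa using hδ.ne'
  have h1 : ∀ x : ℝ≥0∞, x ^ (1 / 4 : ℝ) * x ^ (3 / 4 : ℝ) = x := fun x => by
    rw [← ENNReal.rpow_add_of_nonneg _ _ (by norm_num) (by norm_num)]; norm_num
  -- Young's inequality by cases: the larger of `a` and `δ⁴ b` replaces the other factor.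
  rcases le_total a (δ ^ 4 * b) with h | h
  · refine le_trans ?_ (le_add_right le_rfl)
    calc a ^ (1 / 4 : ℝ) * b ^ (3 / 4 : ℝ) ≤ (δ ^ 4 * b) ^ (1 / 4 : ℝ) * b ^ (3 / 4 : ℝ) := by gcongr
      _ = δ * (b ^ (1 / 4 : ℝ) * b ^ (3 / 4 : ℝ)) := by
        rw [ENNReal.mul_rpow_of_nonneg _ _ (by norm_num), ← ENNReal.rpow_natCast, ← ENNReal.rpow_mul]
        norm_num [mul_assoc]
      _ = δ * b := by rw [h1]
  · refine le_trans ?_ (le_add_left le_rfl)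
    have h2 : b ≤ (δ ^ 4 : ℝ≥0∞)⁻¹ * a := by
      rw [mul_comm, ← div_eq_mul_inv, ENNReal.le_div_iff_mul_le (by simp [hδ']) (by simp), mul_comm]
      exact h
    calc a ^ (1 / 4 : ℝ) * b ^ (3 / 4 : ℝ)
        ≤ a ^ (1 / 4 : ℝ) * ((δ ^ 4 : ℝ≥0∞)⁻¹ * a) ^ (3 / 4 : ℝ) := by gcongr
      _ = (δ ^ 3 : ℝ≥0∞)⁻¹ * (a ^ (1 / 4 : ℝ) * a ^ (3 / 4 : ℝ)) := by
        rw [ENNReal.mul_rpow_of_nonneg _ _ (by norm_num), ENNReal.inv_rpow, ← ENNReal.rpow_natCast,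
          ← ENNReal.rpow_mul, ← ENNReal.rpow_natCast]
        norm_num
        ring
      _ = _ := by rw [h1, ENNReal.coe_inv (by positivity), ENNReal.coe_pow]

/-- Hölder interpolates `L⁴` between `L²` and `L⁶`, the three-dimensional Sobolev inequality bounds
`L⁶` by the gradient, and Young's inequality makes the gradient coefficient small. -/
theorem exists_sqrt_lintegral_pow_four_le (ε : ℝ≥0) (hε : 0 < ε) : ∃ K : ℝ≥0, ∀ v : Space → ℂ,
    ContDiff ℝ 1 v → HasCompactSupport v →
    (∫⁻ x, ‖v x‖ₑ ^ 4) ^ (1 / 2 : ℝ) ≤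
      ε * (∫⁻ x, ‖fderiv ℝ v x‖ₑ ^ 2) + K * ∫⁻ x, ‖v x‖ₑ ^ 2 := by
  let C : ℝ≥0 := SNormLESNormFDerivOfEqConst ℂ (volume : Measure Space) 2
  -- The added 1 gives `δ C² ≤ ε` without requiring `C ≠ 0`.
  let δ : ℝ≥0 := ε / (C ^ 2 + 1)
  have hδ : 0 < δ := by positivity
  refine ⟨(δ ^ 3)⁻¹, fun v hv hv' => ?_⟩
  have hS := eLpNorm_le_eLpNorm_fderiv_of_eq (volume : Measure Space) hv hv' (p := 2) (p' := 6)
    (by norm_num) (by simp) (by simp; norm_num)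
  have hm : AEMeasurable (fun x => ‖v x‖ₑ) volume := hv.continuous.enorm.aemeasurable
  have hH := ENNReal.lintegral_mul_le_Lp_mul_Lq volume
    (Real.HolderConjugate.two_two) hm (hm.pow_const 3)
  have e2 : ∀ {F : Type} [NormedAddCommGroup F] (f : Space → F),
      eLpNorm f 2 volume = (∫⁻ x, ‖f x‖ₑ ^ 2) ^ (1 / 2 : ℝ) := fun f => by
    rw [eLpNorm_eq_lintegral_rpow_enorm_toReal (by simp) (by simp)]
    simp
  have e6 : eLpNorm v 6 volume = (∫⁻ x, ‖v x‖ₑ ^ 6) ^ (1 / 6 : ℝ) := by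
    rw [eLpNorm_eq_lintegral_rpow_enorm_toReal (by simp) (by simp)]
    simp
  set A := ∫⁻ x, ‖v x‖ₑ ^ 2
  set B := ∫⁻ x, ‖fderiv ℝ v x‖ₑ ^ 2
  set X := ∫⁻ x, ‖v x‖ₑ ^ 6
  have hQ : (∫⁻ x, ‖v x‖ₑ ^ 4) ≤ A ^ (1 / 2 : ℝ) * X ^ (1 / 2 : ℝ) := by
    refine (lintegral_mono fun x => ?_).trans (hH.trans_eq ?_)
    · simp only [Pi.mul_apply, ← pow_succ']
      exact le_rfl
    · simp only [ENNReal.rpow_ofNat, ← pow_mul]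
      rfl
  have hX : X ^ (1 / 2 : ℝ) ≤ (((C : ℝ≥0∞) ^ 2 * B) ^ (1 / 2 : ℝ)) ^ (3 : ℝ) := by
    rw [ENNReal.mul_rpow_of_nonneg _ _ (by norm_num), ← ENNReal.rpow_natCast (C : ℝ≥0∞),
      ← ENNReal.rpow_mul]
    have h1 : X ^ (1 / 6 : ℝ) ≤ C * B ^ (1 / 2 : ℝ) := by
      rw [← e6, ← e2]
      exact hS
    calc X ^ (1 / 2 : ℝ) = (X ^ (1 / 6 : ℝ)) ^ (3 : ℝ) := by rw [← ENNReal.rpow_mul]; norm_num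
      _ ≤ (C * B ^ (1 / 2 : ℝ)) ^ (3 : ℝ) := by gcongr
      _ = _ := by norm_num
  calc (∫⁻ x, ‖v x‖ₑ ^ 4) ^ (1 / 2 : ℝ)
      ≤ (A ^ (1 / 2 : ℝ) * (((C : ℝ≥0∞) ^ 2 * B) ^ (1 / 2 : ℝ)) ^ (3 : ℝ)) ^ (1 / 2 : ℝ) := by
        gcongr
        exact hQ.trans (by gcongr)
    _ = A ^ (1 / 4 : ℝ) * ((C : ℝ≥0∞) ^ 2 * B) ^ (3 / 4 : ℝ) := by
        rw [ENNReal.mul_rpow_of_nonneg _ _ (by norm_num), ← ENNReal.rpow_mul, ← ENNReal.rpow_mul,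
          ← ENNReal.rpow_mul]
        norm_num
    _ ≤ δ * ((C : ℝ≥0∞) ^ 2 * B) + (δ ^ 3)⁻¹ * A := rpow_mul_rpow_le _ _ hδ
    _ ≤ ε * B + ((δ ^ 3)⁻¹ : ℝ≥0) * A := by
        rw [← mul_assoc]
        have h2 : δ * C ^ 2 ≤ ε := by
          rw [div_mul_eq_mul_div, div_le_iff₀ (by positivity)]
          gcongr
          exact le_self_add
        have h3 : (δ : ℝ≥0∞) * (C : ℝ≥0∞) ^ 2 ≤ ε := by exact_mod_cast h2
        have h4 : ((δ : ℝ≥0∞) ^ 3)⁻¹ = ((δ ^ 3)⁻¹ : ℝ≥0) := by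
          rw [ENNReal.coe_inv (by positivity), ENNReal.coe_pow]
        gcongr

/-- A smooth function supported in the unit ball. -/
def bump : ContDiffBump (0 : Space) := ⟨1 / 2, 1, by norm_num, by norm_num⟩

theorem bump_sub_eq_zero {x y : Space} (h : x ∉ Metric.closedBall y 1) : bump (x - y) = 0 := by
  refine Function.notMem_support.mp fun h' => h ?_
  rw [bump.support_eq] at h'
  simpa [dist_eq_norm, bump] using (Metric.ball_subset_closedBall h')

theorem lintegral_bump_ne_zero : ∫⁻ x, ‖bump x‖ₑ ^ 2 ≠ 0 := by
  have hc : Continuous fun x => ‖bump x‖ₑ ^ 2 := by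
    have := bump.continuous
    fun_prop
  intro h
  rw [lintegral_eq_zero_iff hc.measurable] at h
  have h0 := congrFun ((Continuous.ae_eq_iff_eq volume hc continuous_const).mp h) 0
  have h1 : bump (0 : Space) = 1 := bump.one_of_mem_closedBall (by simp [bump])
  simp [h1] at h0

theorem lintegral_enorm_sq_lt_top {F : Type} [NormedAddCommGroup F] {f : Space → F}
    (hf : Continuous f) (hc : HasCompactSupport f) : ∫⁻ x, ‖f x‖ₑ ^ 2 < ∞ := by
  have h := (hf.memLp_of_hasCompactSupport (p := 2) (μ := (volume : Measure Space)) hc).2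
  rw [eLpNorm_eq_lintegral_rpow_enorm_toReal (by simp) (by simp)] at h
  by_contra! h'
  simp [top_le_iff.mp h'] at h

theorem enorm_add_sq_le {F : Type} [NormedAddCommGroup F] (a b : F) :
    ‖a + b‖ₑ ^ 2 ≤ 2 * (‖a‖ₑ ^ 2 + ‖b‖ₑ ^ 2) := by
  have h : ‖a + b‖₊ ^ 2 ≤ 2 * (‖a‖₊ ^ 2 + ‖b‖₊ ^ 2) := by
    refine (pow_le_pow_left₀ (by positivity) (nnnorm_add_le a b) 2).trans ?_
    simpa using add_pow_le (a := ‖a‖₊) (b := ‖b‖₊) zero_le zero_le 2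
  simp only [enorm]
  exact_mod_cast h

/-- The form bound for a uniformly locally square integrable function, for Schwartz functions. -/
theorem exists_schwartz_form_bound (ε : ℝ≥0) (hε : 0 < ε) : ∃ K : ℝ≥0, ∀ (W : Space → ℝ)
    (_ : AEStronglyMeasurable W volume) (m : ℝ≥0∞) (_ : ∀ x, localMass W x ≤ m ^ 2)
    (ψ : 𝓢(Space, ℂ)), ∫⁻ x, ‖W x‖ₑ * ‖ψ x‖ₑ ^ 2 ≤
      m * (ε * (∫⁻ x, ‖fderiv ℝ ψ x‖ₑ ^ 2) + K * ∫⁻ x, ‖ψ x‖ₑ ^ 2) := by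
  -- The half absorbs the factor 2 from `‖a + b‖² ≤ 2(‖a‖² + ‖b‖²)` in the gradient of a product.
  obtain ⟨K, hK⟩ := exists_sqrt_lintegral_pow_four_le (ε / 2) (by positivity)
  have hbc : Continuous bump := bump.continuous
  have hbd : ContDiff ℝ 1 bump := bump.contDiff
  have hdc : Continuous (fderiv ℝ bump) := hbd.continuous_fderiv one_ne_zero
  set c := ∫⁻ x, ‖bump x‖ₑ ^ 2 with hc
  set d := ∫⁻ x, ‖fderiv ℝ bump x‖ₑ ^ 2 with hd
  have hc0 : c ≠ 0 := lintegral_bump_ne_zero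
  have hctop : c < ∞ := lintegral_enorm_sq_lt_top hbc bump.hasCompactSupport
  have hdtop : d < ∞ := lintegral_enorm_sq_lt_top hdc (bump.hasCompactSupport.fderiv (𝕜 := ℝ))
  -- The second term pays for the derivative falling on the cutoff. The constant is independent of
  -- `W`, so a small local mass `m` makes the whole bound small.
  refine ⟨K + ε * (d / c).toNNReal, fun W hW m hm ψ => ?_⟩
  have hψc : Continuous ψ := ψ.continuous
  have hψd : Continuous (fderiv ℝ ψ) := (ψ.smooth 1).continuous_fderiv one_ne_zero
  set A := ∫⁻ x, ‖ψ x‖ₑ ^ 2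
  set B := ∫⁻ x, ‖fderiv ℝ ψ x‖ₑ ^ 2
  -- Cauchy–Schwarz on one unit ball, followed by the local Sobolev inequality for the cut-off
  -- function.
  have hloc : ∀ y, ∫⁻ x, ‖W x‖ₑ * (‖bump (x - y)‖ₑ ^ 2 * ‖ψ x‖ₑ ^ 2) ≤
      m * (ε * (∫⁻ x, (‖bump (x - y)‖ₑ ^ 2 * ‖fderiv ℝ ψ x‖ₑ ^ 2)) +
        ε * (∫⁻ x, ‖fderiv ℝ bump (x - y)‖ₑ ^ 2 * ‖ψ x‖ₑ ^ 2) +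
        K * (∫⁻ x, ‖bump (x - y)‖ₑ ^ 2 * ‖ψ x‖ₑ ^ 2)) := by
    intro y
    let v : Space → ℂ := fun x => bump (x - y) • ψ x
    have hvn : ∀ x, ‖v x‖ₑ = ‖bump (x - y)‖ₑ * ‖ψ x‖ₑ := fun x => enorm_smul _ _
    have hb' : ContDiff ℝ 1 fun x => bump (x - y) := hbd.comp (contDiff_id.sub contDiff_const)
    have hv : ContDiff ℝ 1 v := hb'.smul (ψ.smooth 1)
    have hvs : HasCompactSupport v :=
      (bump.hasCompactSupport.comp_homeomorph (Homeomorph.subRight y)).smul_right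
    have hvd : ∀ x, ‖fderiv ℝ v x‖ₑ ^ 2 ≤ 2 * (‖bump (x - y)‖ₑ ^ 2 * ‖fderiv ℝ ψ x‖ₑ ^ 2 +
        ‖fderiv ℝ bump (x - y)‖ₑ ^ 2 * ‖ψ x‖ₑ ^ 2) := by
      intro x
      have h1 : HasFDerivAt (fun x => bump (x - y)) (fderiv ℝ bump (x - y)) x := by
        have h2 := (hbd.differentiable one_ne_zero (x - y)).hasFDerivAt
        simpa using! h2.comp x ((hasFDerivAt_id x).sub_const y)
      have h3 : HasFDerivAt v _ x := h1.smul (ψ.hasFDerivAt x)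
      rw [h3.fderiv]
      refine (enorm_add_sq_le _ _).trans_eq ?_
      have h2 : ‖(fderiv ℝ bump (x - y)).smulRight (ψ x)‖ₑ =
          ‖fderiv ℝ bump (x - y)‖ₑ * ‖ψ x‖ₑ := by
        simp only [enorm, ContinuousLinearMap.nnnorm_smulRight_apply, ENNReal.coe_mul]
      rw [h2, enorm_smul, mul_pow, mul_pow]
    have hH := ENNReal.lintegral_mul_le_Lp_mul_Lq volume Real.HolderConjugate.two_two
      (hW.enorm.indicator (Metric.isClosed_closedBall (x := y) (ε := 1)).measurableSet)
      (g := fun x => ‖v x‖ₑ ^ 2) (by fun_prop)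
    calc ∫⁻ x, ‖W x‖ₑ * (‖bump (x - y)‖ₑ ^ 2 * ‖ψ x‖ₑ ^ 2)
        ≤ (∫⁻ x, (Metric.closedBall y 1).indicator (fun x => ‖W x‖ₑ) x ^ (2 : ℝ)) ^ (1 / 2 : ℝ) *
          (∫⁻ x, (‖v x‖ₑ ^ 2) ^ (2 : ℝ)) ^ (1 / 2 : ℝ) := by
          refine (lintegral_mono fun x => ?_).trans hH
          by_cases hx : x ∈ Metric.closedBall y 1
          · simp [indicator_of_mem hx, hvn, mul_pow]
          · simp [bump_sub_eq_zero hx]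
      _ = localMass W y ^ (1 / 2 : ℝ) * (∫⁻ x, ‖v x‖ₑ ^ 4) ^ (1 / 2 : ℝ) := by
          rw [localMass, ← lintegral_indicator Metric.isClosed_closedBall.measurableSet]
          congr 2
          · refine lintegral_congr fun x => ?_
            by_cases hx : x ∈ Metric.closedBall y 1 <;> simp [hx]
          · refine lintegral_congr fun x => ?_
            rw [ENNReal.rpow_ofNat, ← pow_mul]
      _ ≤ (m ^ 2) ^ (1 / 2 : ℝ) * ((ε / 2 : ℝ≥0) * (∫⁻ x, ‖fderiv ℝ v x‖ₑ ^ 2) +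
          K * ∫⁻ x, ‖v x‖ₑ ^ 2) := by
          gcongr
          · exact hm y
          · exact hK v hv hvs
      _ ≤ _ := by
          have h1 : (m ^ 2) ^ (1 / 2 : ℝ) = m := by
            rw [← ENNReal.rpow_natCast, ← ENNReal.rpow_mul]; norm_num
          have h2 : ((ε / 2 : ℝ≥0) : ℝ≥0∞) * 2 = ε := by
            exact_mod_cast (div_mul_cancel₀ ε two_ne_zero)
          have h3 : ∀ x, ‖v x‖ₑ ^ 2 = ‖bump (x - y)‖ₑ ^ 2 * ‖ψ x‖ₑ ^ 2 := fun x => by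
            rw [hvn, mul_pow]
          have h4 : ((ε / 2 : ℝ≥0) : ℝ≥0∞) * ∫⁻ x, ‖fderiv ℝ v x‖ₑ ^ 2 ≤
              ε * (∫⁻ x, (‖bump (x - y)‖ₑ ^ 2 * ‖fderiv ℝ ψ x‖ₑ ^ 2)) +
              ε * (∫⁻ x, ‖fderiv ℝ bump (x - y)‖ₑ ^ 2 * ‖ψ x‖ₑ ^ 2) := by
            rw [← mul_add, ← lintegral_add_left (by fun_prop), ← h2, mul_assoc]
            refine mul_le_mul' le_rfl ((lintegral_mono hvd).trans_eq ?_)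
            exact lintegral_const_mul _ (by fun_prop)
          rw [h1]
          simp only [h3]
          exact mul_le_mul' le_rfl (add_le_add h4 le_rfl)
  -- Integrating over the centre `y` turns the translated bumps into a continuous partition of unity
  -- with total weight `c`, so no covering argument is needed.
  have hswap : ∀ (b g : Space → ℝ≥0∞), Measurable b → AEMeasurable g →
      ∫⁻ y, ∫⁻ x, b (x - y) * g x = (∫⁻ x, b x) * ∫⁻ x, g x := by
    intro b g hb hg
    rw [lintegral_lintegral_swap]
    · rw [← lintegral_const_mul'' _ hg]
      refine lintegral_congr fun x => ?_
      rw [lintegral_mul_const _ (by fun_prop), lintegral_sub_left_eq_self b x]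
    · exact ((hb.comp (measurable_snd.sub measurable_fst)).aemeasurable).mul
        (hg.comp_quasiMeasurePreserving Measure.quasiMeasurePreserving_snd)
  have hbm : Measurable fun x => ‖bump x‖ₑ ^ 2 := hbc.enorm.measurable.pow_const 2
  have hdm : Measurable fun x => ‖fderiv ℝ bump x‖ₑ ^ 2 := hdc.enorm.measurable.pow_const 2
  have hψm : AEMeasurable (fun x => ‖ψ x‖ₑ ^ 2) volume := (hψc.enorm.measurable.pow_const 2).aemeasurable
  have hψm' : AEMeasurable (fun x => ‖fderiv ℝ ψ x‖ₑ ^ 2) volume := (hψd.enorm.measurable.pow_const 2).aemeasurable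
  have hmeas : ∀ (b g : Space → ℝ≥0∞), Measurable b → AEMeasurable g →
      AEMeasurable (fun y => ∫⁻ x, b (x - y) * g x) := fun b g hb hg =>
    AEMeasurable.lintegral_prod_right (((hb.comp
      (measurable_snd.sub measurable_fst)).aemeasurable).mul
        (hg.comp_quasiMeasurePreserving Measure.quasiMeasurePreserving_snd))
  have hint : c * ∫⁻ x, ‖W x‖ₑ * ‖ψ x‖ₑ ^ 2 ≤ m * (ε * (c * B) + ε * (d * A) + K * (c * A)) := by
    have hWψ : AEMeasurable (fun x => ‖W x‖ₑ * ‖ψ x‖ₑ ^ 2) volume := hW.enorm.mul hψm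
    rw [← hswap _ _ hbm hWψ, ← hswap _ _ hbm hψm, ← hswap _ _ hbm hψm', ← hswap _ _ hdm hψm]
    have m1 := hmeas _ _ hbm hψm
    have m2 := hmeas _ _ hbm hψm'
    have m3 := hmeas _ _ hdm hψm
    have m23 : AEMeasurable (fun y => ε * (∫⁻ x, ‖bump (x - y)‖ₑ ^ 2 * ‖fderiv ℝ ψ x‖ₑ ^ 2) +
        ε * (∫⁻ x, ‖fderiv ℝ bump (x - y)‖ₑ ^ 2 * ‖ψ x‖ₑ ^ 2)) volume :=
      (m2.const_mul _).add (m3.const_mul _)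
    have m123 : AEMeasurable (fun y => ε * (∫⁻ x, ‖bump (x - y)‖ₑ ^ 2 * ‖fderiv ℝ ψ x‖ₑ ^ 2) +
        ε * (∫⁻ x, ‖fderiv ℝ bump (x - y)‖ₑ ^ 2 * ‖ψ x‖ₑ ^ 2) +
        K * ∫⁻ x, ‖bump (x - y)‖ₑ ^ 2 * ‖ψ x‖ₑ ^ 2) volume := m23.add (m1.const_mul _)
    rw [← lintegral_const_mul'' _ m1, ← lintegral_const_mul'' _ m2, ← lintegral_const_mul'' _ m3,
      ← lintegral_add_left' (m2.const_mul _), ← lintegral_add_left' m23,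
      ← lintegral_const_mul'' _ m123]
    refine lintegral_mono fun y => (lintegral_mono fun x => ?_).trans (hloc y)
    exact le_of_eq (by ring)
  have hfin : c * ∫⁻ x, ‖W x‖ₑ * ‖ψ x‖ₑ ^ 2 ≤
      c * (m * (ε * B + (K + ε * (d / c).toNNReal : ℝ≥0) * A)) := by
    refine hint.trans_eq ?_
    have h1 : c * (d / c) = d := ENNReal.mul_div_cancel hc0 hctop.ne
    push_cast
    rw [ENNReal.coe_toNNReal (ENNReal.div_lt_top hdtop.ne hc0).ne]
    calc m * (ε * (c * B) + ε * (d * A) + K * (c * A))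
        = m * (ε * (c * B) + ε * (c * (d / c) * A) + K * (c * A)) := by rw [h1]
      _ = _ := by ring
  exact (ENNReal.mul_le_mul_iff_right hc0 hctop.ne).mp hfin

/-! ### Form bounds on `H²` -/

theorem enorm_sq_eq_lintegral (u : L2) : ‖u‖ₑ ^ 2 = ∫⁻ x, ‖u x‖ₑ ^ 2 := by
  rw [Lp.enorm_def, eLpNorm_eq_lintegral_rpow_enorm_toReal (by simp) (by simp),
    ← ENNReal.rpow_natCast, ← ENNReal.rpow_mul]
  simp

theorem enorm_sq_mulOp {w : Space → ℝ} (u : (mulOp w).domain) :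
    ‖mulOp w u‖ₑ ^ 2 = ∫⁻ x, ‖w x‖ₑ ^ 2 * ‖(u : L2) x‖ₑ ^ 2 := by
  rw [enorm_sq_eq_lintegral]
  refine lintegral_congr_ae ?_
  filter_upwards [coeFn_mulOp u] with x hx
  rw [hx, enorm_mul, mul_pow]
  congr 2
  rw [← ofReal_norm, ← ofReal_norm, Complex.norm_real]

theorem enorm_sq_mulL {w : Space → ℝ} (hw : IsBdd w) (u : L2) :
    ‖mulL w hw u‖ₑ ^ 2 = ∫⁻ x, ‖w x‖ₑ ^ 2 * ‖u x‖ₑ ^ 2 :=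
  enorm_sq_mulOp (w := w) ⟨u, hw.mem_domain u⟩

theorem mem_mulOp_domain {w : Space → ℝ} (hw : AEStronglyMeasurable w volume) {u : L2}
    (h : ∫⁻ x, ‖w x‖ₑ ^ 2 * ‖u x‖ₑ ^ 2 < ∞) : u ∈ (mulOp w).domain := by
  refine ⟨(Complex.continuous_ofReal.comp_aestronglyMeasurable hw).mul (Lp.aestronglyMeasurable u),
    ?_⟩
  rw [eLpNorm_eq_lintegral_rpow_enorm_toReal (by simp) (by simp)]
  refine ENNReal.rpow_lt_top_of_nonneg (by simp) (ne_of_lt ?_)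
  refine lt_of_eq_of_lt (lintegral_congr fun x => ?_) h
  rw [enorm_mul, ENNReal.toReal_ofNat, ENNReal.rpow_ofNat, mul_pow]
  congr 2
  rw [← ofReal_norm, ← ofReal_norm, Complex.norm_real]

theorem enorm_le_ofReal_iff {E : Type} [NormedAddCommGroup E] {a : E} {M : ℝ} (hM : 0 ≤ M) :
    ‖a‖ₑ ^ 2 ≤ ENNReal.ofReal M ^ 2 ↔ ‖a‖ ≤ M := by
  rw [← ofReal_norm, ENNReal.pow_le_pow_left_iff two_ne_zero,
    ENNReal.ofReal_le_ofReal_iff hM]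

/-- A uniform bound for bounded weights passes to their pointwise limit. -/
theorem exists_mulOp_le_of_tendsto {wn : ℕ → Space → ℝ} (hwn : ∀ n, IsBdd (wn n))
    {w : Space → ℝ} (hlim : ∀ x, Tendsto (fun n => wn n x) atTop (𝓝 (w x))) {M : ℝ} (hM : 0 ≤ M)
    {u : L2} (hu : ∀ n, ‖mulL (wn n) (hwn n) u‖ ≤ M) :
    ∃ h : u ∈ (mulOp w).domain, ‖mulOp w ⟨u, h⟩‖ ≤ M := by
  have hw : AEStronglyMeasurable w volume :=
    aestronglyMeasurable_of_tendsto_ae atTop (fun n => (hwn n).aesm) (Eventually.of_forall hlim)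
  have hum : AEMeasurable (fun x => ‖u x‖ₑ ^ 2) volume :=
    (Lp.aestronglyMeasurable u).enorm.pow_const 2
  have hle : ∫⁻ x, ‖w x‖ₑ ^ 2 * ‖u x‖ₑ ^ 2 ≤ ENNReal.ofReal M ^ 2 := by
    calc ∫⁻ x, ‖w x‖ₑ ^ 2 * ‖u x‖ₑ ^ 2
        = ∫⁻ x, liminf (fun n => ‖wn n x‖ₑ ^ 2 * ‖u x‖ₑ ^ 2) atTop := by
          refine lintegral_congr_ae ?_
          filter_upwards with x
          refine (Tendsto.liminf_eq ?_).symm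
          refine ENNReal.Tendsto.mul_const ?_ (Or.inr (by simp))
          exact (ENNReal.continuous_pow 2).continuousAt.tendsto.comp (hlim x).enorm
      _ ≤ liminf (fun n => ∫⁻ x, ‖wn n x‖ₑ ^ 2 * ‖u x‖ₑ ^ 2) atTop :=
          lintegral_liminf_le' fun n => ((hwn n).aesm.enorm.pow_const 2).mul hum
      _ ≤ ENNReal.ofReal M ^ 2 := by
          refine liminf_le_of_le (by isBoundedDefault) fun b hb => ?_
          obtain ⟨n, hn⟩ := hb.exists
          rw [← enorm_sq_mulL (hwn n)] at hn
          exact hn.trans ((enorm_le_ofReal_iff hM).mpr (hu n))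
  have hd := mem_mulOp_domain hw (hle.trans_lt (by simp))
  refine ⟨hd, (enorm_le_ofReal_iff hM).mp ?_⟩
  rw [enorm_sq_mulOp]
  exact hle

theorem enorm_fderiv_sq_le (ψ : 𝓢(Space, ℂ)) (x : Space) :
    ‖fderiv ℝ ψ x‖ₑ ^ 2 ≤ 3 * ∑ i, ‖∂_{dir i} ψ x‖ₑ ^ 2 := by
  have h1 : ‖fderiv ℝ ψ x‖₊ ≤ ∑ i, ‖∂_{dir i} ψ x‖₊ := by
    refine ContinuousLinearMap.opNNNorm_le_bound _ _ fun v => ?_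
    have hv : v = ∑ i, v i • dir i := by
      ext j
      simp [dir, Finset.sum_apply, Pi.single_apply]
    conv_lhs => rw [hv, map_sum]
    refine (nnnorm_sum_le _ _).trans ?_
    rw [Finset.sum_mul]
    refine Finset.sum_le_sum fun i _ => ?_
    rw [map_smul, nnnorm_smul, mul_comm, SchwartzMap.lineDerivOp_apply_eq_fderiv]
    gcongr
    exact PiLp.norm_apply_le v i
  have h2 : ‖fderiv ℝ ψ x‖₊ ^ 2 ≤ 3 * ∑ i, ‖∂_{dir i} ψ x‖₊ ^ 2 := by
    refine (pow_le_pow_left₀ (by positivity) h1 2).trans ?_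
    simpa using sq_sum_le_card_mul_sum_sq (s := Finset.univ) (f := fun i => ‖∂_{dir i} ψ x‖₊)
  simp only [enorm]
  exact_mod_cast h2

theorem enorm_sq_cls (ψ : 𝓢(Space, ℂ)) : ‖cls ψ‖ₑ ^ 2 = ∫⁻ x, ‖ψ x‖ₑ ^ 2 := by
  rw [enorm_sq_eq_lintegral]
  refine lintegral_congr_ae ?_
  filter_upwards [coeFn_cls ψ] with x hx
  rw [hx]

/-- The form bound for a uniformly locally square integrable function, on `H²`. -/
theorem exists_form_bound {ε : ℝ} (hε : 0 < ε) : ∃ K : ℝ, 0 ≤ K ∧ ∀ (W : Space → ℝ)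
    (_ : AEStronglyMeasurable W volume) (m : ℝ) (_ : 0 ≤ m)
    (_ : ∀ x, localMass W x ≤ ENNReal.ofReal m ^ 2) (u f : L2) (G : Fin 3 → L2), IsJet u G f →
    ∃ h : u ∈ (mulOp fun x => √|W x|).domain,
      ‖mulOp (fun x => √|W x|) ⟨u, h⟩‖ ^ 2 ≤ m * (ε * ∑ i, ‖G i‖ ^ 2 + K * ‖u‖ ^ 2) := by
  -- The third compensates for comparing the operator norm of the derivative with the three partial
  -- derivatives.
  obtain ⟨K, hK⟩ := exists_schwartz_form_bound (ε.toNNReal / 3) (by positivity)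
  refine ⟨K, K.2, fun W hW m hm hmW u f G hj => ?_⟩
  have hnn : 0 ≤ m * (ε * ∑ i, ‖G i‖ ^ 2 + K * ‖u‖ ^ 2) := by positivity
  -- For truncated `W` the inequality is a closed condition on jets; the truncation is removed by
  -- Fatou.
  have hwn : ∀ n : ℕ, IsBdd fun x => √(min |W x| n) := fun n => by
    refine ⟨?_, √n, fun x => ?_⟩
    · exact Real.continuous_sqrt.comp_aestronglyMeasurable (hW.norm.inf aestronglyMeasurable_const)
    · rw [abs_of_nonneg (Real.sqrt_nonneg _)]
      exact Real.sqrt_le_sqrt (min_le_right _ _)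
  have hbound : ∀ n : ℕ, ‖mulL _ (hwn n) u‖ ^ 2 ≤ m * (ε * ∑ i, ‖G i‖ ^ 2 + K * ‖u‖ ^ 2) := by
    intro n
    refine hj.induction (p := fun x => ‖mulL _ (hwn n) x.1‖ ^ 2 ≤
      m * (ε * ∑ i, ‖x.2.1 i‖ ^ 2 + K * ‖x.1‖ ^ 2)) (isClosed_le (by fun_prop) (by fun_prop))
      fun ψ => ?_
    rw [jet_apply]
    dsimp only
    have h1 := hK W hW _ hmW ψ
    have h2 : ‖mulL _ (hwn n) (cls ψ)‖ₑ ^ 2 ≤ ∫⁻ x, ‖W x‖ₑ * ‖ψ x‖ₑ ^ 2 := by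
      rw [enorm_sq_mulL]
      refine lintegral_mono_ae ?_
      filter_upwards [coeFn_cls ψ] with x hx
      rw [hx]
      gcongr
      rw [← ofReal_norm, ← ofReal_norm, ← ENNReal.ofReal_pow (norm_nonneg _)]
      refine ENNReal.ofReal_le_ofReal ?_
      rw [Real.norm_eq_abs, sq_abs, Real.sq_sqrt (by positivity)]
      exact min_le_left _ _
    have h3 : ∫⁻ x, ‖fderiv ℝ ψ x‖ₑ ^ 2 ≤ 3 * ∑ i, ‖cls (∂_{dir i} ψ)‖ₑ ^ 2 := by
      refine (lintegral_mono (enorm_fderiv_sq_le ψ)).trans_eq ?_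
      have hm : ∀ i, Measurable fun x => ‖∂_{dir i} ψ x‖ₑ ^ 2 := fun i =>
        (∂_{dir i} ψ).continuous.enorm.measurable.pow_const 2
      rw [lintegral_const_mul _ (Finset.measurable_fun_sum _ fun i _ => hm i),
        lintegral_finsetSum _ fun i _ => hm i]
      simp only [enorm_sq_cls]
    have h4 : ‖mulL _ (hwn n) (cls ψ)‖ₑ ^ 2 ≤ ENNReal.ofReal m *
        ((ε.toNNReal / 3 : ℝ≥0) * (3 * ∑ i, ‖cls (∂_{dir i} ψ)‖ₑ ^ 2) + K * ‖cls ψ‖ₑ ^ 2) := by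
      refine h2.trans (h1.trans ?_)
      rw [enorm_sq_cls ψ]
      gcongr
    have h5 : ((ε.toNNReal / 3 : ℝ≥0) : ℝ≥0∞) * 3 = ENNReal.ofReal ε := by
      rw [ENNReal.ofReal]
      exact_mod_cast (div_mul_cancel₀ ε.toNNReal three_ne_zero)
    rw [← mul_assoc, h5] at h4
    simp only [← ofReal_norm] at h4
    rw [← ENNReal.ofReal_coe_nnreal] at h4
    simp only [← ENNReal.ofReal_pow (norm_nonneg _)] at h4
    rw [← ENNReal.ofReal_sum_of_nonneg fun i _ => sq_nonneg _, ← ENNReal.ofReal_mul hε.le,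
      ← ENNReal.ofReal_mul K.coe_nonneg, ← ENNReal.ofReal_add (by positivity) (by positivity),
      ← ENNReal.ofReal_mul hm, ENNReal.ofReal_le_ofReal_iff (by positivity)] at h4
    exact h4
  have hlim : ∀ x, Tendsto (fun n : ℕ => √(min |W x| n)) atTop (𝓝 √|W x|) := fun x => by
    refine tendsto_const_nhds.congr' ?_
    filter_upwards [eventually_ge_atTop ⌈|W x|⌉₊] with n hn
    rw [min_eq_left (Nat.ceil_le.mp hn)]
  obtain ⟨h, hle⟩ := exists_mulOp_le_of_tendsto hwn hlim (Real.sqrt_nonneg _)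
    (fun n => Real.le_sqrt_of_sq_le (hbound n))
  exact ⟨h, (Real.le_sqrt (norm_nonneg _) hnn).mp hle⟩

/-- The form of a multiplication operator is controlled by the forms of dominating functions. -/
theorem norm_inner_mulOp_le {V W₁ W₂ : Space → ℝ} (hVW : ∀ x, |V x| ≤ |W₁ x| + |W₂ x|)
    {u : L2} (h : u ∈ (mulOp V).domain) (h₁ : u ∈ (mulOp fun x => √|W₁ x|).domain)
    (h₂ : u ∈ (mulOp fun x => √|W₂ x|).domain) (hW₁ : AEStronglyMeasurable W₁ volume) :
    ‖inner ℂ u (mulOp V ⟨u, h⟩)‖ ≤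
      ‖mulOp (fun x => √|W₁ x|) ⟨u, h₁⟩‖ ^ 2 + ‖mulOp (fun x => √|W₂ x|) ⟨u, h₂⟩‖ ^ 2 := by
  have hs : ∀ (W : Space → ℝ) x, ‖√|W x|‖ₑ ^ 2 = ‖W x‖ₑ := fun W x => by
    rw [← ofReal_norm, ← ofReal_norm, ← ENNReal.ofReal_pow (norm_nonneg _),
      Real.norm_eq_abs, sq_abs, Real.sq_sqrt (abs_nonneg _), Real.norm_eq_abs]
  have key : ‖inner ℂ u (mulOp V ⟨u, h⟩)‖ₑ ≤ ‖mulOp (fun x => √|W₁ x|) ⟨u, h₁⟩‖ₑ ^ 2 +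
      ‖mulOp (fun x => √|W₂ x|) ⟨u, h₂⟩‖ₑ ^ 2 := by
    rw [enorm_sq_mulOp, enorm_sq_mulOp, ← lintegral_add_left']
    · rw [L2.inner_def]
      refine (enorm_integral_le_lintegral_enorm _).trans (lintegral_mono_ae ?_)
      filter_upwards [coeFn_mulOp ⟨u, h⟩] with x hx
      rw [hx, hs, hs, ← add_mul, RCLike.inner_apply, enorm_mul, enorm_mul, mul_assoc]
      have h1 : ‖(V x : ℂ)‖ₑ ≤ ‖W₁ x‖ₑ + ‖W₂ x‖ₑ := by
        simp only [← ofReal_norm]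
        rw [← ENNReal.ofReal_add (norm_nonneg _) (norm_nonneg _), Complex.norm_real]
        exact ENNReal.ofReal_le_ofReal (hVW x)
      have h2 : ‖(starRingEnd ℂ) (u x)‖ₑ = ‖u x‖ₑ := by
        rw [← ofReal_norm, ← ofReal_norm, RCLike.norm_conj]
      rw [h2, ← sq]
      gcongr
    · simp only [hs]
      exact hW₁.enorm.mul ((Lp.aestronglyMeasurable u).enorm.pow_const 2)
  simp only [← ofReal_norm] at key
  rw [← ENNReal.ofReal_pow (norm_nonneg _), ← ENNReal.ofReal_pow (norm_nonneg _),
    ← ENNReal.ofReal_add (by positivity) (by positivity),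
    ENNReal.ofReal_le_ofReal_iff (by positivity)] at key
  exact key

/-! ### The Hamiltonian -/

section hamiltonian

variable {V : Space → ℝ}

theorem exists_isJet_of_mem_domain {u : L2} (h : u ∈ (hamiltonian V).domain) :
    ∃ G f, IsJet u G f ∧ ∃ hV : u ∈ (mulOp V).domain,
      hamiltonian V ⟨u, h⟩ = -f + mulOp V ⟨u, hV⟩ := by
  have hk : u ∈ kineticDomain := h.1
  obtain ⟨G, hG⟩ := (lap_spec ⟨u, hk⟩).exists_isJet
  exact ⟨G, _, hG, h.2, rfl⟩

theorem IsJet.exists_mem_domain {u f : L2} {G : Fin 3 → L2} (hj : IsJet u G f)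
    (hV : u ∈ (mulOp V).domain) :
    ∃ h : u ∈ (hamiltonian V).domain, hamiltonian V ⟨u, h⟩ = -f + mulOp V ⟨u, hV⟩ := by
  have hk : u ∈ kineticDomain := ⟨f, hj.hasLaplacian⟩
  refine ⟨⟨hk, hV⟩, ?_⟩
  have h1 : lap ⟨u, hk⟩ = f := (lap_spec ⟨u, hk⟩).unique hj.hasLaplacian
  rw [← h1]
  rfl

theorem inner_mulOp (u v : (mulOp V).domain) :
    inner ℂ (mulOp V u) (v : L2) = inner ℂ (u : L2) (mulOp V v) := by
  refine integral_congr_ae ?_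
  filter_upwards [coeFn_mulOp u, coeFn_mulOp v] with x h1 h2
  rw [h1, h2]
  simp only [RCLike.inner_apply, map_mul, Complex.conj_ofReal]
  ring

theorem hamiltonian_symm (u v : (hamiltonian V).domain) :
    inner ℂ (hamiltonian V u) (v : L2) = inner ℂ (u : L2) (hamiltonian V v) := by
  obtain ⟨u, hu⟩ := u
  obtain ⟨v, hv⟩ := v
  obtain ⟨G, f, hj, hVu, e⟩ := exists_isJet_of_mem_domain hu
  obtain ⟨G', f', hj', hVv, e'⟩ := exists_isJet_of_mem_domain hv
  rw [e, e', inner_add_left, inner_add_right, inner_mulOp ⟨u, hVu⟩ ⟨v, hVv⟩, inner_neg_left,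
    inner_neg_right, hj.inner_laplacian hj', ← inner_conj_symm u f', hj'.inner_laplacian hj]
  simp only [map_neg, map_sum, inner_conj_symm]

theorem exists_localMass_le (hV : UniformlyLocallyL2 V) :
    ∃ m : ℝ, 0 ≤ m ∧ ∀ x, localMass V x ≤ ENNReal.ofReal m ^ 2 := by
  set s := ⨆ x, localMass V x with hs
  refine ⟨1 + s.toReal, by positivity, fun x => (le_iSup _ x).trans ?_⟩
  rw [← ENNReal.ofReal_pow (by positivity)]
  refine (ENNReal.ofReal_toReal hV.2.ne).symm.le.trans (ENNReal.ofReal_le_ofReal ?_)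
  nlinarith [ENNReal.toReal_nonneg (a := s)]

/-- The gradient and the potential energy are controlled by the graph norm of the Hamiltonian. -/
theorem exists_energy_bound (hV : UniformlyLocallyL2 V) : ∃ C : ℝ, 0 ≤ C ∧
    ∀ (u f : L2) (G : Fin 3 → L2), IsJet u G f → ∀ hu : u ∈ (mulOp V).domain,
      ∑ i, ‖G i‖ ^ 2 ≤ C * (‖-f + mulOp V ⟨u, hu⟩‖ ^ 2 + ‖u‖ ^ 2) ∧
      ∃ h : u ∈ (mulOp fun x => √|V x|).domain, ‖mulOp (fun x => √|V x|) ⟨u, h⟩‖ ^ 2 ≤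
        C * (‖-f + mulOp V ⟨u, hu⟩‖ ^ 2 + ‖u‖ ^ 2) := by
  obtain ⟨m, hm, hmV⟩ := exists_localMass_le hV
  -- With this choice the potential costs at most a quarter of the kinetic energy, which is then
  -- absorbed.
  obtain ⟨K, hK, hform⟩ := exists_form_bound (ε := 1 / (4 * (m + 1))) (by positivity)
  refine ⟨1 + 4 * (m * K) , by positivity, fun u f G hj hu => ?_⟩
  obtain ⟨h, hle⟩ := hform V hV.1 m hm hmV u f G hj
  have h0 : u ∈ (mulOp fun x => √|(fun _ => (0 : ℝ)) x|).domain :=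
    mem_mulOp_domain (by fun_prop) (by simp)
  have hin := norm_inner_mulOp_le (V := V) (W₁ := V) (W₂ := fun _ => 0) (fun x => by simp) hu h h0 hV.1
  have hz : ‖mulOp (fun x => √|(fun _ => (0 : ℝ)) x|) ⟨u, h0⟩‖ ^ 2 = 0 := by
    have := norm_mulOp_le (C := 0) ⟨u, h0⟩ (fun x => by simp)
    rw [zero_mul] at this
    simp [le_antisymm this (norm_nonneg _)]
  rw [hz, add_zero] at hin
  set p := mulOp V ⟨u, hu⟩
  set q := ‖mulOp (fun x => √|V x|) ⟨u, h⟩‖ ^ 2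
  set g := ∑ i, ‖G i‖ ^ 2
  have hg : 0 ≤ g := Finset.sum_nonneg fun i _ => sq_nonneg _
  have hq : q ≤ g / 4 + m * K * ‖u‖ ^ 2 := by
    refine hle.trans ?_
    have : m * (1 / (4 * (m + 1))) ≤ 1 / 4 := by
      rw [mul_one_div, div_le_div_iff₀ (by positivity) (by norm_num)]; linarith
    nlinarith [mul_le_mul_of_nonneg_right this hg]
  have e1 : (inner ℂ u (-f + p)).re = g + (inner ℂ u p).re := by
    have h1 := hj.inner_laplacian hj
    have h2 : (inner ℂ u f).re = (inner ℂ f u).re := inner_re_symm (𝕜 := ℂ) u f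
    rw [inner_add_right, inner_neg_right, Complex.add_re, Complex.neg_re, h2, h1]
    simp only [Complex.neg_re, Complex.re_sum, neg_neg]
    congr 1
    exact Finset.sum_congr rfl fun i _ => inner_self_eq_norm_sq (𝕜 := ℂ) _
  have h3 : (inner ℂ u (-f + p)).re ≤ ‖u‖ * ‖-f + p‖ :=
    (Complex.re_le_norm _).trans (norm_inner_le_norm _ _)
  have h4 : -‖inner ℂ u p‖ ≤ (inner ℂ u p).re := (abs_le.mp (Complex.abs_re_le_norm _)).1
  have h5 : g ≤ ‖u‖ * ‖-f + p‖ + q := by linarith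
  have h6 : ‖u‖ * ‖-f + p‖ ≤ (‖-f + p‖ ^ 2 + ‖u‖ ^ 2) / 2 := by
    nlinarith [sq_nonneg (‖u‖ - ‖-f + p‖)]
  have h7 := sq_nonneg ‖-f + p‖
  have h8 := sq_nonneg ‖u‖
  have h9 : 0 ≤ m * K * ‖-f + p‖ ^ 2 := by positivity
  have h10 : 0 ≤ m * K * ‖u‖ ^ 2 := by positivity
  exact ⟨by linarith, h, by linarith⟩

theorem mulL_mem_mulOp_domain {w : Space → ℝ} (hw : IsBdd w) {u : L2} (hu : u ∈ (mulOp V).domain) :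
    ∃ h : mulL w hw u ∈ (mulOp V).domain,
      mulOp V ⟨mulL w hw u, h⟩ = mulL w hw (mulOp V ⟨u, hu⟩) := by
  have hae : (fun x => (V x : ℂ) * mulL w hw u x) =ᵐ[volume] mulL w hw (mulOp V ⟨u, hu⟩) := by
    filter_upwards [coeFn_mulL hw u, coeFn_mulL hw (mulOp V ⟨u, hu⟩), coeFn_mulOp ⟨u, hu⟩]
      with x h1 h2 h3
    rw [h1, h2, h3]
    ring
  have h : mulL w hw u ∈ (mulOp V).domain := (memLp_congr_ae hae).mpr (Lp.memLp _)
  exact ⟨h, Lp.ext ((coeFn_mulOp ⟨_, h⟩).trans hae)⟩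

end hamiltonian

/-! ### Weighted estimates -/

section weightedEstimates

variable {V : Space → ℝ}

/-- The commutator of `Δ` with multiplication by `w`, applied to `u` with gradient `G`. -/
theorem IsJet.exists_mulL_mem_domain {w : Space → ℝ} {dw ddw : Fin 3 → Space → ℝ}
    (hw : IsWeight w dw ddw) {u f : L2} {G : Fin 3 → L2} (hj : IsJet u G f)
    (hu : u ∈ (mulOp V).domain) :
    ∃ h : mulL w hw.bdd u ∈ (hamiltonian V).domain, hamiltonian V ⟨_, h⟩ =
      mulL w hw.bdd (-f + mulOp V ⟨u, hu⟩) - ∑ i, ((2 : ℂ) • mulL (dw i) (hw.bdd_deriv i) (G i) +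
        mulL (ddw i) (hw.bdd_deriv_two i) u) := by
  obtain ⟨hu', e⟩ := mulL_mem_mulOp_domain hw.bdd hu
  obtain ⟨h, e'⟩ := (hj.mul hw).exists_mem_domain hu'
  refine ⟨h, ?_⟩
  rw [e', e, map_add, map_neg]
  abel

/-- The Combes–Thomas estimate: conjugation by slowly varying weights at most doubles the bound on
the resolvent. -/
theorem exists_conjugated_resolvent_bound (hV : UniformlyLocallyL2 V) {r : ℝ} (hr : 0 ≤ r) :
    ∃ α : ℝ, 0 < α ∧ α ≤ 1 ∧ ∀ {w v : Space → ℝ} {dw ddw : Fin 3 → Space → ℝ}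
      (hw : IsWeight w dw ddw) (hv : IsBdd v), (∀ x, w x * v x = 1) →
      (∀ i x, |dw i x| ≤ α * |w x|) → (∀ i x, |ddw i x| ≤ 6 * α * |w x|) →
      ∀ {z : ℂ} {R : L2 →L[ℂ] L2}, IsResolventAt (hamiltonian V) z R → ‖R‖ ≤ r → ‖z‖ ≤ r →
      ∀ g : L2, ‖mulL w hw.bdd (R (mulL v hv g))‖ ≤ 2 * r * ‖g‖ := by
  obtain ⟨C, hC, hen⟩ := exists_energy_bound hV
  -- If `N = ‖(H - z)φ‖`, then `‖φ‖ ≤ rN` and `‖Hφ‖ ≤ (1 + r²)N`, so the energy bound controls each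
  -- component of the gradient of `φ` by `KN`.
  set K := √(C * ((1 + r ^ 2) ^ 2 + r ^ 2)) with hK
  have hK0 : 0 ≤ K := Real.sqrt_nonneg _
  have hK2 : K ^ 2 = C * ((1 + r ^ 2) ^ 2 + r ^ 2) := Real.sq_sqrt (by positivity)
  have hden : 1 ≤ 12 * K + 48 * r + 2 := by linarith
  refine ⟨1 / (12 * K + 48 * r + 2), by positivity, div_le_one_of_le₀ hden (by positivity), ?_⟩
  set α := 1 / (12 * K + 48 * r + 2) with hα
  have hα0 : 0 < α := by positivity
  have hα1 : α ≤ 1 := div_le_one_of_le₀ hden (by positivity)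
  have hα2 : α * (6 * K + 24 * r) ≤ 1 / 2 := by
    rw [hα, one_div_mul_eq_div, div_le_div_iff₀ (by positivity) (by norm_num)]; linarith
  intro w v dw ddw hw hv hwv h1 h2 z R hR hRr hzr g
  obtain ⟨hdom, hRg⟩ := hR.1 (mulL v hv g)
  set u := R (mulL v hv g) with hu
  obtain ⟨G, f, hj, huV, e⟩ := exists_isJet_of_mem_domain hdom
  obtain ⟨hφ, eφ⟩ := hj.exists_mulL_mem_domain hw huV
  obtain ⟨huV', eV⟩ := mulL_mem_mulOp_domain hw.bdd huV
  have hen' := (hen _ _ _ (hj.mul hw) huV').1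
  obtain ⟨_, eφ'⟩ := (hj.mul hw).exists_mem_domain huV'
  set S := ∑ i, ((2 : ℂ) • mulL (dw i) (hw.bdd_deriv i) (G i) +
        mulL (ddw i) (hw.bdd_deriv_two i) u) with hS
  set φ := mulL w hw.bdd u with hφu
  rw [← eφ'] at hen'
  set q := hamiltonian V ⟨φ, hφ⟩ with hq
  have hwvg : mulL w hw.bdd (mulL v hv g) = g := by
    refine Lp.ext ?_
    filter_upwards [coeFn_mulL hw.bdd (mulL v hv g), coeFn_mulL hv g] with x a b
    rw [a, b, ← mul_assoc, ← Complex.ofReal_mul, hwv, Complex.ofReal_one, one_mul]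
  -- Here `φ = wu` with `(H - z)u = vg` and `wv = 1`, so only the commutator term `S` perturbs `g`.
  -- The choice of `α` makes `‖S‖ ≤ N/2`, which is absorbed since `N` is finite for bounded weights.
  have hN : q - z • φ = g - S := by
    rw [eφ, ← e, hφu, ← map_smul, sub_right_comm, ← map_sub, hRg, hwvg]
  set N := ‖q - z • φ‖ with hNdef
  have hN0 : 0 ≤ N := norm_nonneg _
  have hφN : ‖φ‖ ≤ r * N := by
    have h3 := hR.2 ⟨φ, hφ⟩
    calc ‖φ‖ = ‖R (q - z • φ)‖ := congrArg _ h3.symm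
      _ ≤ r * N := (R.le_opNorm _).trans (mul_le_mul_of_nonneg_right hRr hN0)
  have hqN : ‖q‖ ≤ (1 + r ^ 2) * N := by
    have h3 : ‖q‖ ≤ N + ‖z‖ * ‖φ‖ := by
      calc ‖q‖ = ‖(q - z • φ) + z • φ‖ := by rw [sub_add_cancel]
        _ ≤ _ := (norm_add_le _ _).trans_eq (by rw [norm_smul])
    have h4 : ‖z‖ * ‖φ‖ ≤ r * (r * N) := mul_le_mul hzr hφN (norm_nonneg _) hr
    linarith
  have hgrad : ∀ i, ‖mulL w hw.bdd (G i) + mulL (dw i) (hw.bdd_deriv i) u‖ ≤ K * N := by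
    intro i
    refine (sq_le_sq₀ (norm_nonneg _) (by positivity)).mp ?_
    refine (Finset.single_le_sum (f := fun i =>
      ‖mulL w hw.bdd (G i) + mulL (dw i) (hw.bdd_deriv i) u‖ ^ 2) (fun j _ => sq_nonneg _)
      (Finset.mem_univ i)).trans (hen'.trans ?_)
    rw [mul_pow, hK2, mul_assoc]
    refine mul_le_mul_of_nonneg_left ?_ hC
    have h3 := pow_le_pow_left₀ (norm_nonneg _) hqN 2
    have h4 := pow_le_pow_left₀ (norm_nonneg _) hφN 2
    rw [mul_pow] at h3 h4
    linarith
  have hdu : ∀ i, ‖mulL (dw i) (hw.bdd_deriv i) u‖ ≤ r * N := fun i =>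
    (norm_mulL_le_mul _ hw.bdd (h1 i) u).trans ((mul_le_of_le_one_left (norm_nonneg _) hα1).trans hφN)
  have hdG : ∀ i, ‖mulL (dw i) (hw.bdd_deriv i) (G i)‖ ≤ α * (K * N + r * N) := by
    intro i
    refine (norm_mulL_le_mul _ hw.bdd (h1 i) (G i)).trans (mul_le_mul_of_nonneg_left ?_ hα0.le)
    calc ‖mulL w hw.bdd (G i)‖ = ‖(mulL w hw.bdd (G i) + mulL (dw i) (hw.bdd_deriv i) u) -
          mulL (dw i) (hw.bdd_deriv i) u‖ := by rw [add_sub_cancel_right]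
      _ ≤ _ := (norm_sub_le _ _).trans (add_le_add (hgrad i) (hdu i))
  have hddu : ∀ i, ‖mulL (ddw i) (hw.bdd_deriv_two i) u‖ ≤ 6 * α * (r * N) := fun i =>
    (norm_mulL_le_mul _ hw.bdd (h2 i) u).trans (mul_le_mul_of_nonneg_left hφN (by positivity))
  have hSN : ‖S‖ ≤ α * (6 * K + 24 * r) * N := by
    calc ‖S‖ ≤ ∑ _i : Fin 3, (2 * (α * (K * N + r * N)) + 6 * α * (r * N)) := by
          refine norm_sum_le_of_le _ fun i _ => (norm_add_le _ _).trans (add_le_add ?_ (hddu i))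
          rw [norm_smul, Complex.norm_ofNat]
          exact mul_le_mul_of_nonneg_left (hdG i) zero_le_two
      _ = α * (6 * K + 24 * r) * N := by
          rw [Finset.sum_const, Finset.card_fin, nsmul_eq_mul]; push_cast; ring
  have hfin : N ≤ ‖g‖ + N / 2 := by
    calc N = ‖g - S‖ := by rw [hNdef, hN]
      _ ≤ ‖g‖ + ‖S‖ := norm_sub_le _ _
      _ ≤ _ := by nlinarith
  calc ‖φ‖ ≤ r * N := hφN
    _ ≤ r * (2 * ‖g‖) := mul_le_mul_of_nonneg_left (by linarith) hr
    _ = 2 * r * ‖g‖ := by ring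

theorem norm_mulOp_mulL_le {a b w : Space → ℝ} (hw : IsBdd w) (ha : AEStronglyMeasurable a volume)
    {c : ℝ} (h : ∀ x, |a x * w x| ≤ c * |b x|) (u : (mulOp b).domain) :
    ∃ hu : mulL w hw u ∈ (mulOp a).domain, ‖mulOp a ⟨_, hu⟩‖ ≤ c * ‖mulOp b u‖ := by
  have hle : ∀ᵐ x, ‖(a x : ℂ) * mulL w hw u x‖ ≤ c * ‖mulOp b u x‖ := by
    filter_upwards [coeFn_mulL hw u, coeFn_mulOp u] with x h1 h2
    rw [h1, h2, ← mul_assoc, ← Complex.ofReal_mul, norm_mul, norm_mul, Complex.norm_real,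
      Complex.norm_real, Real.norm_eq_abs, Real.norm_eq_abs, ← mul_assoc]
    exact mul_le_mul_of_nonneg_right (h x) (norm_nonneg _)
  have hu : mulL w hw u ∈ (mulOp a).domain := MemLp.of_le_mul (Lp.memLp (mulOp b u))
    ((Complex.continuous_ofReal.comp_aestronglyMeasurable ha).mul (Lp.aestronglyMeasurable _)) hle
  refine ⟨hu, Lp.norm_le_mul_norm_of_ae_le_mul ?_⟩
  filter_upwards [hle, coeFn_mulOp ⟨_, hu⟩] with x h1 h2
  rwa [h2]

/-- The pointwise bound is summed over `i` before integrating, which keeps the sharp constant for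
the full gradient. A loss here would prevent reaching all `α < √E₊`. -/
theorem sum_norm_mulL_sq_le {w : Space → ℝ} {dw : Fin 3 → Space → ℝ} (hw : IsBdd w)
    (hdw : ∀ i, IsBdd (dw i)) {c : ℝ} (h : ∀ x, ∑ i, dw i x ^ 2 ≤ c * w x ^ 2) (u : L2) :
    ∑ i, ‖mulL (dw i) (hdw i) u‖ ^ 2 ≤ c * ‖mulL w hw u‖ ^ 2 := by
  have key : ∀ {v : Space → ℝ} (hv : IsBdd v),
      (‖mulL v hv u‖ ^ 2 : ℝ) = (inner ℂ u (mulL _ (hv.mul hv) u)).re := fun hv => by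
    rw [← mulL_mulL, ← inner_mulL]
    exact (inner_self_eq_norm_sq (𝕜 := ℂ) _).symm
  have hint : ∀ {v : Space → ℝ} (hv : IsBdd v), (inner ℂ u (mulL v hv u)).re =
      ∫ x, v x * ‖u x‖ ^ 2 := fun {v} hv => by
    rw [L2.inner_def, ← RCLike.re_eq_complex_re, ← integral_re (L2.integrable_inner _ _)]
    refine integral_congr_ae ?_
    filter_upwards [coeFn_mulL hv u] with x hx
    rw [hx]
    simp only [RCLike.inner_apply, mul_assoc, Complex.mul_conj]
    rw [← Complex.ofReal_mul, RCLike.re_eq_complex_re, Complex.ofReal_re, Complex.normSq_eq_norm_sq]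
  have hI : ∀ {v : Space → ℝ} (hv : IsBdd v), Integrable fun x => v x * ‖u x‖ ^ 2 := by
    intro v hv
    obtain ⟨D, hD⟩ := hv.bdd
    exact ((Lp.memLp u).integrable_norm_pow two_ne_zero).bdd_mul hv.aesm (Eventually.of_forall hD)
  simp only [key, hint]
  rw [← integral_finsetSum _ fun i _ => hI ((hdw i).mul (hdw i)), ← integral_const_mul]
  refine integral_mono (integrable_finsetSum _ fun i _ => hI ((hdw i).mul (hdw i)))
    ((hI (hw.mul hw)).const_mul c) fun x => ?_
  dsimp only
  rw [← Finset.sum_mul, ← mul_assoc]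
  refine mul_le_mul_of_nonneg_right ?_ (sq_nonneg _)
  simpa only [sq] using h x

/-- The localization formula for the kinetic energy. -/
theorem IsJet.re_inner_mulL {w : Space → ℝ} {dw ddw : Fin 3 → Space → ℝ}
    (hw : IsWeight w dw ddw) {u f : L2} {G : Fin 3 → L2} (hj : IsJet u G f) :
    (inner ℂ (mulL w hw.bdd u) (mulL w hw.bdd f)).re =
      ∑ i, ‖mulL (dw i) (hw.bdd_deriv i) u‖ ^ 2 -
      ∑ i, ‖mulL w hw.bdd (G i) + mulL (dw i) (hw.bdd_deriv i) u‖ ^ 2 := by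
  have h1 := hj.inner_laplacian ((hj.mul hw).mul hw)
  have h2 : (inner ℂ (mulL w hw.bdd u) (mulL w hw.bdd f)).re =
      (inner ℂ f (mulL w hw.bdd (mulL w hw.bdd u))).re := by
    rw [← inner_mulL, ← RCLike.re_eq_complex_re, inner_re_symm]
  rw [h2, h1, Complex.neg_re, Complex.re_sum, ← Finset.sum_sub_distrib, ← Finset.sum_neg_distrib]
  refine Finset.sum_congr rfl fun i _ => ?_
  set d := mulL (dw i) (hw.bdd_deriv i) u
  set Φ := mulL w hw.bdd (G i) + d with hΦ
  have e : mulL w hw.bdd (G i) = Φ - d := by rw [hΦ, add_sub_cancel_right]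
  have h3 := inner_self_eq_norm_sq (𝕜 := ℂ) Φ
  have h4 := inner_self_eq_norm_sq (𝕜 := ℂ) d
  have h5 := inner_re_symm (𝕜 := ℂ) Φ d
  rw [RCLike.re_eq_complex_re] at h3 h4 h5
  rw [inner_add_right, ← inner_mulL, mulL_comm (hw.bdd_deriv i) hw.bdd, ← inner_mulL hw.bdd, e,
    inner_sub_left, inner_sub_left, Complex.add_re, Complex.sub_re, Complex.sub_re, h3, h4, h5]
  ring

theorem perpNorm_le_of_dist_le {x y : Space} (h : dist y x ≤ 1) : perpNorm y ≤ perpNorm x + 1 := by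
  have hp : 0 ≤ perpNorm x := Real.sqrt_nonneg _
  have hp2 : perpNorm x ^ 2 = x 1 ^ 2 + x 2 ^ 2 := Real.sq_sqrt (by positivity)
  have hd : (y 1 - x 1) ^ 2 + (y 2 - x 2) ^ 2 ≤ 1 := by
    have h1 := pow_le_pow_left₀ dist_nonneg h 2
    rw [EuclideanSpace.dist_sq_eq, Fin.sum_univ_three] at h1
    simp only [Real.dist_eq, sq_abs] at h1
    nlinarith [sq_nonneg (y 0 - x 0)]
  have hc : x 1 * (y 1 - x 1) + x 2 * (y 2 - x 2) ≤ perpNorm x := by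
    refine abs_le_of_sq_le_sq' ?_ hp |>.2
    rw [hp2]
    nlinarith [sq_nonneg (x 1 * (y 2 - x 2) - x 2 * (y 1 - x 1)), sq_nonneg (x 1), sq_nonneg (x 2)]
  exact Real.sqrt_le_iff.mpr ⟨by positivity, by nlinarith⟩

theorem exists_localMass_indicator_le
    (hdec : Tendsto (tailMass V) atTop (𝓝 0)) {m : ℝ} (hm : 0 < m) : ∃ R : ℝ, ∀ x,
      localMass ({y | R < perpNorm y}.indicator V) x ≤ ENNReal.ofReal m ^ 2 := by
  have hpos : (0 : ℝ≥0∞) < ENNReal.ofReal m ^ 2 := by positivity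
  obtain ⟨R, hR⟩ := (hdec.eventually (gt_mem_nhds hpos)).exists
  -- A unit ball centred within distance `R` of the axis stays within distance `R + 1`, where the
  -- truncated potential vanishes.
  refine ⟨R + 1, fun x => ?_⟩
  rcases le_or_gt R (perpNorm x) with h | h
  · refine le_trans ?_ hR.le
    refine le_trans (lintegral_mono fun y => ?_)
      (le_iSup₂ (f := fun (x : Space) (_ : R ≤ perpNorm x) => localMass V x) x h)
    gcongr
    exact enorm_indicator_le_enorm_self _ _
  · refine le_trans (le_of_eq ?_) zero_le
    refine (setLIntegral_congr_fun Metric.isClosed_closedBall.measurableSet fun y hy => ?_).trans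
      lintegral_zero
    have hy' : y ∉ {y | R + 1 < perpNorm y} := fun hlt =>
      absurd hlt (not_lt.mpr ((perpNorm_le_of_dist_le hy).trans (by linarith)))
    rw [indicator_of_notMem hy']
    simp

/-- The Agmon estimate: the weighted Hamiltonian is bounded below, up to a weight-independent
multiple of the graph norm, by minus the square of the logarithmic slope of the weight. -/
theorem exists_agmon_bound (hV : UniformlyLocallyL2 V) (hdec : Tendsto (tailMass V) atTop (𝓝 0))
    {α κ : ℝ} (hα : 0 < α) (hκ : α ^ 2 < κ) : ∃ C : ℝ, 0 ≤ C ∧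
      ∀ {w : Space → ℝ} {dw ddw : Fin 3 → Space → ℝ} (hw : IsWeight w dw ddw),
      (∀ x, ∑ i, dw i x ^ 2 ≤ α ^ 2 * w x ^ 2) → (∀ x, |w x| ≤ Real.exp (α * gPerp x)) →
      ∀ u : (hamiltonian V).domain,
        -(inner ℂ (mulL w hw.bdd u) (mulL w hw.bdd (hamiltonian V u))).re ≤
          κ * ‖mulL w hw.bdd u‖ ^ 2 + C * (‖hamiltonian V u‖ ^ 2 + ‖(u : L2)‖ ^ 2) := by
  obtain ⟨C, hC, hen⟩ := exists_energy_bound hV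
  obtain ⟨K, hK, hform⟩ := exists_form_bound (ε := 1) one_pos
  -- The bound `m ≤ 1` lets the kinetic energy of `wu` absorb that of the outer potential, and `mK ≤
  -- κ - α²` fits the remainder into the gap.
  set m := min 1 ((κ - α ^ 2) / (K + 1)) with hm
  have hm0 : 0 < m := lt_min one_pos (div_pos (by linarith) (by positivity))
  have hm1 : m ≤ 1 := min_le_left _ _
  have hmK : m * K ≤ κ - α ^ 2 := by
    have := min_le_right 1 ((κ - α ^ 2) / (K + 1))
    rw [← hm, le_div_iff₀ (by positivity)] at this
    linarith
  obtain ⟨R, hR⟩ := exists_localMass_indicator_le hdec hm0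
  set s := {y : Space | R < perpNorm y} with hs
  have hsm : MeasurableSet s := by
    refine measurableSet_lt measurable_const ?_
    unfold perpNorm
    fun_prop
  -- This bounds every admissible weight on the tube `|x_⊥| ≤ R`, so the inner potential costs only
  -- a multiple of the graph norm of `u`.
  set D := Real.exp (α * √(R ^ 2 + 1)) with hD
  refine ⟨D ^ 2 * C, by positivity, fun {w dw ddw} hw h1 h2 u => ?_⟩
  obtain ⟨u, hu⟩ := u
  obtain ⟨G, f, hj, huV, e⟩ := exists_isJet_of_mem_domain hu
  obtain ⟨huV', eV⟩ := mulL_mem_mulOp_domain hw.bdd huV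
  obtain ⟨_, hs', hen'⟩ := hen _ _ _ hj huV
  obtain ⟨ha, hle⟩ := hform (s.indicator V) (hV.1.indicator hsm) m hm0.le hR _ _ _ (hj.mul hw)
  obtain ⟨hb, hle'⟩ := norm_mulOp_mulL_le (a := fun x => √|sᶜ.indicator V x|)
    (b := fun x => √|V x|) hw.bdd
    (Real.continuous_sqrt.comp_aestronglyMeasurable (hV.1.indicator hsm.compl).norm) (c := D)
    (fun x => by
      by_cases hx : x ∈ s
      · rw [indicator_of_notMem (by simpa using hx)]
        simp only [abs_zero, Real.sqrt_zero, zero_mul]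
        positivity
      · rw [indicator_of_mem hx, abs_mul, mul_comm]
        refine mul_le_mul_of_nonneg_right ((h2 x).trans (Real.exp_le_exp.mpr ?_)) (abs_nonneg _)
        refine mul_le_mul_of_nonneg_left (Real.sqrt_le_sqrt ?_) hα.le
        have : perpNorm x ≤ R := not_lt.mp hx
        have := pow_le_pow_left₀ (Real.sqrt_nonneg _) this 2
        exact add_le_add_left this 1) ⟨u, hs'⟩
  have hpot := norm_inner_mulOp_le (V := V) (W₁ := s.indicator V) (W₂ := sᶜ.indicator V) (fun x => by
    by_cases hx : x ∈ s
    · rw [indicator_of_mem hx]; exact le_add_of_nonneg_right (abs_nonneg _)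
    · rw [indicator_of_mem (s := sᶜ) hx]; exact le_add_of_nonneg_left (abs_nonneg _))
    huV' ha hb (hV.1.indicator hsm)
  have hkin := hj.re_inner_mulL hw
  have hdu := sum_norm_mulL_sq_le hw.bdd hw.bdd_deriv h1 u
  have hre := (abs_le.mp ((Complex.abs_re_le_norm _).trans hpot)).1
  have hle2 := pow_le_pow_left₀ (norm_nonneg _) hle' 2
  rw [mul_pow] at hle2
  have hle3 := mul_le_mul_of_nonneg_left hen' (sq_nonneg D)
  rw [e]
  dsimp only
  rw [map_add, map_neg, inner_add_right, inner_neg_right, Complex.add_re, Complex.neg_re, hkin,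
    ← eV]
  set Φ := ∑ i, ‖mulL w hw.bdd (G i) + mulL (dw i) (hw.bdd_deriv i) u‖ ^ 2
  have hΦ : 0 ≤ Φ := Finset.sum_nonneg fun i _ => sq_nonneg _
  have h5 : m * Φ ≤ Φ := mul_le_of_le_one_left hΦ hm1
  have h6 := mul_le_mul_of_nonneg_right hmK (sq_nonneg ‖mulL w hw.bdd u‖)
  linarith

end weightedEstimates

/-! ### A Lyapunov inequality for bounded operators. -/

/-- A Lyapunov-type bound: if `B` is negative on the range of `P`, with top `-e`, and `T`
conjugates it into an operator that is bounded below by `-κ` up to an error, with `κ < e`, then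
`T` is bounded in terms of the error only. -/
theorem opNorm_sq_mul_le_of_lyapunov {T P B : L2 →L[ℂ] L2} {e κ C : ℝ} (hTP : T * P = T)
    (hT : ∀ x, -(inner ℂ (T x) (T (B x))).re ≤ κ * ‖T x‖ ^ 2 + C * ‖P x‖ ^ 2)
    (hB : ∀ x, (inner ℂ x (B x)).re ≤ -e * ‖P x‖ ^ 2) (hκ : 0 ≤ κ)
    (hC : 0 ≤ C) :
    ‖T‖ ^ 2 * (e - κ) ≤ C := by
  by_contra! hlt
  set l := ‖T‖ ^ 2 with hl
  have hl0 : 0 ≤ l := sq_nonneg _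
  have hTPx : ∀ x, ‖T x‖ ^ 2 ≤ l * ‖P x‖ ^ 2 := fun x => by
    have h1 : T x = T (P x) := (DFunLike.congr_fun hTP x).symm
    have := pow_le_pow_left₀ (norm_nonneg _) (T.le_opNorm (P x)) 2
    rwa [← h1, mul_pow] at this
  set D := l * (e - κ) - C with hD
  have hD0 : 0 < D := by linarith
  -- The norm of `T` need not be attained, so near-maximizers are used. As `s → ‖T‖` the right side
  -- vanishes while the left tends to `D ‖T‖² > 0`.
  have key : ∀ s : ℝ, 0 ≤ s → s < ‖T‖ → D * s ^ 2 ≤ l * (√(l * (l - s ^ 2)) * ‖B‖) := by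
    intro s hs0 hs
    obtain ⟨x, hx1, hxs⟩ := T.exists_lt_apply_of_lt_opNorm hs
    set t := ‖T x‖ ^ 2 with ht
    have hst : s ^ 2 ≤ t := pow_le_pow_left₀ hs0 hxs.le 2
    set S := T.adjoint (T x) with hS
    have hSn : ‖S‖ ^ 2 ≤ l * t := by
      rw [hl, ht, ← mul_pow]
      refine pow_le_pow_left₀ (norm_nonneg _) ((T.adjoint.le_opNorm _).trans_eq ?_) 2
      rw [LinearIsometryEquiv.norm_map]
    have hSx : ∀ y, inner ℂ (T x) (T y) = inner ℂ S y := fun y =>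
      (ContinuousLinearMap.adjoint_inner_left T y (T x)).symm
    have hxx : ‖x‖ ^ 2 ≤ 1 := pow_le_one₀ (norm_nonneg _) hx1.le
    set d := S - (l : ℂ) • x with hd
    -- Expanding the square shows that a near-maximizer is almost an eigenvector of `T*T` with
    -- eigenvalue `‖T‖²`.
    have hdn : ‖d‖ ^ 2 ≤ l * (l - s ^ 2) := by
      have h1 := norm_sub_sq (𝕜 := ℂ) S ((l : ℂ) • x)
      have h2 : inner ℂ S ((l : ℂ) • x) = (l * t : ℝ) := by
        rw [inner_smul_right, ← hSx, inner_self_eq_norm_sq_to_K, ht]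
        push_cast; rfl
      rw [h2, RCLike.re_eq_complex_re, Complex.ofReal_re, norm_smul, Complex.norm_real,
        Real.norm_eq_abs, mul_pow, sq_abs, ← hd] at h1
      nlinarith [mul_le_mul_of_nonneg_left hxx (sq_nonneg l), mul_le_mul_of_nonneg_left hst hl0]
    have hdB : (inner ℂ d (B x)).re ≤ ‖d‖ * ‖B‖ := by
      refine (Complex.re_le_norm _).trans ((norm_inner_le_norm _ _).trans ?_)
      exact mul_le_mul_of_nonneg_left (B.unit_le_opNorm x hx1.le) (norm_nonneg _)
    have h3 : (inner ℂ (T x) (T (B x))).re =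
        l * (inner ℂ x (B x)).re + (inner ℂ d (B x)).re := by
      have : S = (l : ℂ) • x + d := by rw [hd]; abel
      rw [hSx, this, inner_add_left, inner_smul_left, Complex.conj_ofReal, Complex.add_re,
        Complex.re_ofReal_mul]
    have h4 : D * ‖P x‖ ^ 2 ≤ √(l * (l - s ^ 2)) * ‖B‖ := by
      have h5 := mul_le_mul_of_nonneg_right (Real.le_sqrt_of_sq_le hdn) (norm_nonneg B)
      have h6 := hT x
      have h7 := mul_le_mul_of_nonneg_left (hTPx x) hκ
      have h8 := mul_le_mul_of_nonneg_left (hB x) hl0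
      rw [h3] at h6
      rw [hD]
      linarith
    have h5 := mul_le_mul_of_nonneg_left h4 hl0
    have h6 := mul_le_mul_of_nonneg_left (hst.trans (hTPx x)) hD0.le
    linarith
  have hT0 : 0 < ‖T‖ := by
    refine lt_of_le_of_ne (norm_nonneg _) fun h => ?_
    rw [hD, hl, ← h] at hD0
    linarith
  have hcont : Continuous fun s : ℝ => l * (√(l * (l - s ^ 2)) * ‖B‖) - D * s ^ 2 := by fun_prop
  have hlim : 0 ≤ l * (√(l * (l - ‖T‖ ^ 2)) * ‖B‖) - D * ‖T‖ ^ 2 := by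
    refine ge_of_tendsto (x := 𝓝[<] ‖T‖) (hcont.tendsto _ |>.mono_left nhdsWithin_le_nhds) ?_
    filter_upwards [Ioo_mem_nhdsLT hT0] with s hs
    exact sub_nonneg.mpr (key s hs.1.le hs.2)
  rw [← hl, sub_self, mul_zero, Real.sqrt_zero, zero_mul, mul_zero, zero_sub] at hlim
  have : 0 < D * l := by positivity
  linarith

/-! ### Bounded smooth approximations of exponential weights -/

/-- The squared distance from `a` in the directions selected by `c`. -/
def quad (c a : Fin 3 → ℝ) (x : Space) : ℝ := ∑ i, c i * (x i - a i) ^ 2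

/-- A bounded smooth function that tends to `√(1 + quad c a x)` as `δ → 0`. -/
def tameDist (c a : Fin 3 → ℝ) (δ : ℝ) (x : Space) : ℝ :=
  (1 + quad c a x) ^ (1 / 2 : ℝ) * (1 + δ * quad c a x) ^ (-1 / 2 : ℝ)

section quad

variable {c a : Fin 3 → ℝ} {δ : ℝ}

/-- The condition `c i ^ 2 = c i` means `c i ∈ {0, 1}`: `c` selects coordinates, so one family of
weights serves both `g_a` and `g_⊥`. -/
theorem quad_nonneg (hc : ∀ i, c i ^ 2 = c i) (x : Space) : 0 ≤ quad c a x :=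
  Finset.sum_nonneg fun i _ => mul_nonneg (hc i ▸ sq_nonneg _) (sq_nonneg _)

theorem mul_sq_le_quad (hc : ∀ i, c i ^ 2 = c i) (x : Space) (i : Fin 3) :
    c i * (x i - a i) ^ 2 ≤ quad c a x :=
  Finset.single_le_sum (f := fun i => c i * (x i - a i) ^ 2)
    (fun i _ => mul_nonneg (hc i ▸ sq_nonneg _) (sq_nonneg _)) (Finset.mem_univ i)

theorem hasLineDerivAt_coord (x : Space) (i : Fin 3) :
    HasDerivAt (fun t : ℝ => (x + t • dir i) i) 1 0 := by
  have : (fun t : ℝ => (x + t • dir i) i) = fun t => x i + t := by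
    ext t; simp [dir]
  rw [this]
  exact (hasDerivAt_id 0).const_add (x i)

theorem hasLineDerivAt_quad (x : Space) (i : Fin 3) :
    HasLineDerivAt ℝ (quad c a) (2 * c i * (x i - a i)) x (dir i) := by
  have : (fun t : ℝ => quad c a (x + t • dir i)) = fun t =>
      quad c a x + 2 * c i * (x i - a i) * t + c i * t ^ 2 := by
    ext t
    have : ∀ j, (x + t • dir i) j = x j + if j = i then t else 0 := fun j => by
      simp [dir]
    simp only [quad, this, Fin.sum_univ_three]
    fin_cases i <;> simp <;> ring
  unfold HasLineDerivAt
  rw [this]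
  have h := (((hasDerivAt_id (0 : ℝ)).const_mul (2 * c i * (x i - a i))).const_add
    (quad c a x)).add (((hasDerivAt_id (0 : ℝ)).pow 2).const_mul (c i))
  refine h.congr_deriv ?_
  simp

/-- Writing `quad` as the squared norm of an affine map transfers the temperate growth of powers of
`1 + ‖x‖²`. -/
theorem exists_quad_eq (hc : ∀ i, c i ^ 2 = c i) : ∃ L : Space →L[ℝ] Space, ∃ b : Space,
    ∀ x, quad c a x = ‖L x - b‖ ^ 2 := by
  refine ⟨∑ i, c i • (EuclideanSpace.proj i).smulRight (dir i),
    WithLp.toLp 2 fun i => c i * a i, fun x => ?_⟩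
  rw [EuclideanSpace.norm_sq_eq]
  refine Finset.sum_congr rfl fun j _ => ?_
  have : ((∑ i, c i • (EuclideanSpace.proj i).smulRight (dir i) : Space →L[ℝ] Space) x) j =
      c j * x j := by
    fin_cases j <;> simp [dir, Fin.sum_univ_three]
  rw [PiLp.sub_apply, this, Real.norm_eq_abs, sq_abs]
  nth_rewrite 1 [← hc j]
  ring

theorem hasTemperateGrowth_one_add_mul_quad_rpow (hc : ∀ i, c i ^ 2 = c i) (hδ : 0 ≤ δ) (r : ℝ) :
    (fun x => (1 + δ * quad c a x) ^ r).HasTemperateGrowth := by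
  obtain ⟨L, b, hL⟩ := exists_quad_eq (a := a) hc
  have h1 : (fun x => √δ • (L x - b)).HasTemperateGrowth :=
    (Function.HasTemperateGrowth.const √δ).smul
      (L.hasTemperateGrowth.sub (Function.HasTemperateGrowth.const b))
  convert! (Function.hasTemperateGrowth_one_add_norm_sq_rpow Space r).comp h1 using 2 with x
  simp [hL, norm_smul, mul_pow, Real.sq_sqrt hδ]

theorem tameDist_temperate (hc : ∀ i, c i ^ 2 = c i) (hδ : 0 ≤ δ) :
    (tameDist c a δ).HasTemperateGrowth := by
  have h1 := hasTemperateGrowth_one_add_mul_quad_rpow (a := a) hc zero_le_one (1 / 2)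
  simp only [one_mul] at h1
  exact h1.mul (hasTemperateGrowth_one_add_mul_quad_rpow hc hδ _)

end quad

/-- The `i`-th partial derivative of `tameDist`. -/
def tameDistDeriv (c a : Fin 3 → ℝ) (δ : ℝ) (i : Fin 3) (x : Space) : ℝ :=
  (1 - δ) * (c i * (x i - a i)) * tameDist c a δ x / ((1 + quad c a x) * (1 + δ * quad c a x))

/-- The second partial derivative of `tameDist` in the `i`-th direction. -/
def tameDistDerivTwo (c a : Fin 3 → ℝ) (δ : ℝ) (i : Fin 3) (x : Space) : ℝ :=
  (1 - δ) * c i * tameDist c a δ x / ((1 + quad c a x) * (1 + δ * quad c a x)) *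
    (1 + (1 - δ) * (c i * (x i - a i) ^ 2) / ((1 + quad c a x) * (1 + δ * quad c a x)) -
      2 * (c i * (x i - a i) ^ 2) / (1 + quad c a x) -
      2 * (δ * (c i * (x i - a i) ^ 2)) / (1 + δ * quad c a x))

section tameDist

variable {c a : Fin 3 → ℝ} {δ : ℝ}

theorem one_add_mul_quad_pos (hc : ∀ i, c i ^ 2 = c i) (hδ : 0 ≤ δ) (x : Space) :
    0 < 1 + δ * quad c a x := by
  have := mul_nonneg hδ (quad_nonneg (a := a) hc x)
  linarith

theorem one_add_quad_pos (hc : ∀ i, c i ^ 2 = c i) (x : Space) : 0 < 1 + quad c a x := by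
  linarith [quad_nonneg (a := a) hc x]

theorem hasLineDerivAt_tameDist (hc : ∀ i, c i ^ 2 = c i) (hδ : 0 ≤ δ) (i : Fin 3) (x : Space) :
    HasLineDerivAt ℝ (tameDist c a δ) (tameDistDeriv c a δ i x) x (dir i) := by
  have hs := one_add_quad_pos (a := a) hc x
  have ht := one_add_mul_quad_pos (a := a) hc hδ x
  have hq : HasDerivAt (fun t : ℝ => quad c a (x + t • dir i)) _ 0 := hasLineDerivAt_quad x i
  have hx : x + (0 : ℝ) • dir i = x := by simp
  have h1 := (hq.const_add 1).rpow_const (p := 1 / 2) (Or.inl (by rw [hx]; exact hs.ne'))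
  have h2 := ((hq.const_mul δ).const_add 1).rpow_const (p := -1 / 2)
    (Or.inl (by rw [hx]; exact ht.ne'))
  refine (h1.mul h2).congr_deriv ?_
  simp only [hx, tameDistDeriv, tameDist]
  rw [Real.rpow_sub_one hs.ne', Real.rpow_sub_one ht.ne']
  have hs' := hs.ne'
  have ht' := ht.ne'
  generalize (1 + quad c a x) ^ (1 / 2 : ℝ) = A
  generalize (1 + δ * quad c a x) ^ (-1 / 2 : ℝ) = B
  generalize quad c a x = q at hs' ht' ⊢
  rw [eq_div_iff (mul_ne_zero hs' ht'), neg_div]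
  have e1 : ∀ b : ℝ, b / (1 + q) * ((1 + q) * (1 + δ * q)) = b * (1 + δ * q) := fun b => by
    field_simp
  have e2 : ∀ b : ℝ, b / (1 + δ * q) * ((1 + q) * (1 + δ * q)) = b * (1 + q) := fun b => by
    field_simp
  linear_combination (c i * (x.ofLp i - a i) * B) * e1 A - (δ * c i * (x.ofLp i - a i) * A) * e2 B

theorem hasLineDerivAt_tameDistDeriv (hc : ∀ i, c i ^ 2 = c i) (hδ : 0 ≤ δ) (i : Fin 3)
    (x : Space) :
    HasLineDerivAt ℝ (tameDistDeriv c a δ i) (tameDistDerivTwo c a δ i x) x (dir i) := by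
  have hs := one_add_quad_pos (a := a) hc x
  have ht := one_add_mul_quad_pos (a := a) hc hδ x
  have hq : HasDerivAt (fun t : ℝ => quad c a (x + t • dir i)) _ 0 := hasLineDerivAt_quad x i
  have hk : HasDerivAt (fun t : ℝ => tameDist c a δ (x + t • dir i)) _ 0 :=
    hasLineDerivAt_tameDist hc hδ i x
  have hx : x + (0 : ℝ) • dir i = x := by simp
  have h1 := ((((hasLineDerivAt_coord x i).sub_const (a i)).const_mul (c i)).const_mul
    (1 - δ)).mul hk
  have h2 := (hq.const_add 1).mul ((hq.const_mul δ).const_add 1)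
  have h3 := h1.div h2 (by simp only [Pi.mul_apply, hx]; positivity)
  refine h3.congr_deriv ?_
  simp only [Pi.mul_apply, hx, tameDistDerivTwo, tameDistDeriv]
  have hs' := hs.ne'
  have ht' := ht.ne'
  generalize quad c a x = q at hs' ht' ⊢
  field_simp
  ring

theorem tameDist_nonneg (hc : ∀ i, c i ^ 2 = c i) (hδ : 0 ≤ δ) (x : Space) :
    0 ≤ tameDist c a δ x :=
  mul_nonneg (Real.rpow_nonneg (one_add_quad_pos hc x).le _)
    (Real.rpow_nonneg (one_add_mul_quad_pos hc hδ x).le _)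

theorem tameDist_sq (hc : ∀ i, c i ^ 2 = c i) (hδ : 0 ≤ δ) (x : Space) :
    tameDist c a δ x ^ 2 = (1 + quad c a x) / (1 + δ * quad c a x) := by
  rw [tameDist, mul_pow, ← Real.rpow_natCast, ← Real.rpow_natCast,
    ← Real.rpow_mul (one_add_quad_pos hc x).le, ← Real.rpow_mul (one_add_mul_quad_pos hc hδ x).le]
  norm_num [Real.rpow_neg_one, div_eq_mul_inv]

theorem tameDist_le_sqrt (hc : ∀ i, c i ^ 2 = c i) (hδ : 0 ≤ δ) (x : Space) :
    tameDist c a δ x ≤ √(1 + quad c a x) := by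
  refine Real.le_sqrt_of_sq_le ?_
  rw [tameDist_sq hc hδ]
  exact div_le_self (one_add_quad_pos hc x).le
    (le_add_of_nonneg_right (mul_nonneg hδ (quad_nonneg hc x)))

theorem tameDist_le (hc : ∀ i, c i ^ 2 = c i) (hδ : 0 < δ) (hδ1 : δ ≤ 1) (x : Space) :
    tameDist c a δ x ≤ √(1 / δ) := by
  refine Real.le_sqrt_of_sq_le ?_
  rw [tameDist_sq hc hδ.le, div_le_div_iff₀ (one_add_mul_quad_pos hc hδ.le x) hδ]
  linarith

/-- With `q = quad c a x` the sum equals `q(1 - δ)² / ((1 + q)(1 + δq)³)`. Taming the distance thus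
keeps its Lipschitz constant 1. -/
theorem sum_tameDistDeriv_sq_le (hc : ∀ i, c i ^ 2 = c i) (hδ : 0 ≤ δ) (hδ1 : δ ≤ 1) (x : Space) :
    ∑ i, tameDistDeriv c a δ i x ^ 2 ≤ 1 := by
  have hs := one_add_quad_pos (a := a) hc x
  have ht := one_add_mul_quad_pos (a := a) hc hδ x
  have hq := quad_nonneg (a := a) hc x
  have h1 : ∀ i, tameDistDeriv c a δ i x ^ 2 = c i * (x i - a i) ^ 2 *
      ((1 - δ) ^ 2 / ((1 + quad c a x) * (1 + δ * quad c a x) ^ 3)) := fun i => by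
    rw [tameDistDeriv, div_pow, mul_pow, mul_pow, mul_pow, hc, tameDist_sq hc hδ]
    field_simp
  simp only [h1]
  rw [← Finset.sum_mul]
  change quad c a x * _ ≤ 1
  rw [← mul_div_assoc, div_le_one (by positivity)]
  have h2 : 1 ≤ (1 + δ * quad c a x) ^ 3 := one_le_pow₀ (by nlinarith)
  have h3 : (1 - δ) ^ 2 ≤ 1 := pow_le_one₀ (by linarith) (by linarith)
  nlinarith [mul_le_mul_of_nonneg_left h3 hq, mul_le_mul_of_nonneg_left h2 hs.le]

theorem abs_tameDistDerivTwo_le (hc : ∀ i, c i ^ 2 = c i) (hδ : 0 ≤ δ) (hδ1 : δ ≤ 1) (i : Fin 3)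
    (x : Space) : |tameDistDerivTwo c a δ i x| ≤ 3 := by
  have hs := one_add_quad_pos (a := a) hc x
  have ht := one_add_mul_quad_pos (a := a) hc hδ x
  have hq := quad_nonneg (a := a) hc x
  have hu := mul_sq_le_quad (a := a) hc x i
  have hci : 0 ≤ c i := hc i ▸ sq_nonneg _
  have hci1 : c i ≤ 1 := by nlinarith [hc i, sq_nonneg (1 - c i)]
  have hk0 := tameDist_nonneg (a := a) hc hδ x
  have hk : tameDist c a δ x ≤ 1 + quad c a x :=
    (tameDist_le_sqrt hc hδ x).trans (Real.sqrt_le_iff.mpr ⟨hs.le, by nlinarith⟩)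
  rw [tameDistDerivTwo, abs_mul]
  have hu0 : 0 ≤ c i * (x i - a i) ^ 2 := by positivity
  have ht1 : 1 ≤ 1 + δ * quad c a x := by nlinarith
  have hst : 1 + quad c a x ≤ (1 + quad c a x) * (1 + δ * quad c a x) :=
    le_mul_of_one_le_right hs.le ht1
  set u := c i * (x i - a i) ^ 2
  set s := 1 + quad c a x with hs_def
  set τ := 1 + δ * quad c a x with hτ_def
  have hA : |(1 - δ) * c i * tameDist c a δ x / (s * τ)| ≤ 1 := by
    have h1 : (1 - δ) * c i ≤ 1 := mul_le_one₀ (by linarith) hci hci1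
    rw [abs_of_nonneg (div_nonneg (mul_nonneg (mul_nonneg (by linarith) hci) hk0) (by positivity)),
      div_le_one (by positivity)]
    exact (mul_le_of_le_one_left hk0 h1).trans (hk.trans hst)
  have hX0 : 0 ≤ (1 - δ) * u / (s * τ) :=
    div_nonneg (mul_nonneg (by linarith) hu0) (by positivity)
  have hX1 : (1 - δ) * u / (s * τ) ≤ 1 := by
    rw [div_le_one (by positivity)]
    exact (mul_le_of_le_one_left hu0 (by linarith)).trans (by linarith)
  have hY0 : 0 ≤ 2 * u / s := by positivity
  have hY1 : 2 * u / s ≤ 2 := by rw [div_le_iff₀ hs]; linarith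
  have hZ0 : 0 ≤ 2 * (δ * u) / τ := by positivity
  have hZ1 : 2 * (δ * u) / τ ≤ 2 := by
    rw [div_le_iff₀ ht]; nlinarith [mul_le_mul_of_nonneg_left hu hδ]
  -- The three fractions lie in `[0, 1]`, `[0, 2]` and `[0, 2]`, so the expression lies in `[-3,
  -- 2]`.
  have hB : |1 + (1 - δ) * u / (s * τ) - 2 * u / s - 2 * (δ * u) / τ| ≤ 3 :=
    abs_le.mpr ⟨by linarith, by linarith⟩
  calc _ ≤ 1 * 3 := mul_le_mul hA hB (abs_nonneg _) zero_le_one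
    _ = 3 := one_mul 3

theorem continuous_quad : Continuous (quad c a) := by
  unfold quad
  fun_prop

theorem continuous_tameDist (hc : ∀ i, c i ^ 2 = c i) (hδ : 0 ≤ δ) : Continuous (tameDist c a δ) :=
  (tameDist_temperate hc hδ).1.continuous

theorem continuous_tameDistDeriv (hc : ∀ i, c i ^ 2 = c i) (hδ : 0 ≤ δ) (i : Fin 3) :
    Continuous (tameDistDeriv c a δ i) := by
  have h1 := continuous_tameDist (a := a) hc hδ
  have h2 := continuous_quad (c := c) (a := a)
  have hs := fun x => (one_add_quad_pos (a := a) hc x).ne'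
  have ht := fun x => (one_add_mul_quad_pos (a := a) hc hδ x).ne'
  unfold tameDistDeriv
  fun_prop (disch := intro x; exact mul_ne_zero (hs x) (ht x))

theorem continuous_tameDistDerivTwo (hc : ∀ i, c i ^ 2 = c i) (hδ : 0 ≤ δ) (i : Fin 3) :
    Continuous (tameDistDerivTwo c a δ i) := by
  have h1 := continuous_tameDist (a := a) hc hδ
  have h2 := continuous_quad (c := c) (a := a)
  have hs := fun x => (one_add_quad_pos (a := a) hc x).ne'
  have ht := fun x => (one_add_mul_quad_pos (a := a) hc hδ x).ne'
  have hst := fun x => mul_ne_zero (hs x) (ht x)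
  unfold tameDistDerivTwo
  fun_prop (disch := assumption)

end tameDist

/-- Bounded smooth weights which converge to `exp (α √(1 + quad c a x))` as `n → ∞`. -/
def expWeight (c a : Fin 3 → ℝ) (α : ℝ) (n : ℕ) (x : Space) : ℝ :=
  (1 + α * tameDist c a (1 / (n + 2 : ℕ)) x / (n + 2 : ℕ)) ^ (n + 2)

/-- The `i`-th partial derivative of `expWeight`. -/
def expWeightDeriv (c a : Fin 3 → ℝ) (α : ℝ) (n : ℕ) (i : Fin 3) (x : Space) : ℝ :=
  α * (1 + α * tameDist c a (1 / (n + 2 : ℕ)) x / (n + 2 : ℕ)) ^ (n + 1) *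
    tameDistDeriv c a (1 / (n + 2 : ℕ)) i x

/-- The second partial derivative of `expWeight` in the `i`-th direction. -/
def expWeightDerivTwo (c a : Fin 3 → ℝ) (α : ℝ) (n : ℕ) (i : Fin 3) (x : Space) : ℝ :=
  α ^ 2 * ((n + 1 : ℕ) / (n + 2 : ℕ)) *
    (1 + α * tameDist c a (1 / (n + 2 : ℕ)) x / (n + 2 : ℕ)) ^ n *
      tameDistDeriv c a (1 / (n + 2 : ℕ)) i x ^ 2 +
  α * (1 + α * tameDist c a (1 / (n + 2 : ℕ)) x / (n + 2 : ℕ)) ^ (n + 1) *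
    tameDistDerivTwo c a (1 / (n + 2 : ℕ)) i x

theorem IsBdd.of_continuous {w : Space → ℝ} (hw : Continuous w) {C : ℝ} (h : ∀ x, |w x| ≤ C) :
    IsBdd w :=
  ⟨hw.aestronglyMeasurable, C, h⟩

section expWeight

variable {c a : Fin 3 → ℝ} {α : ℝ}

theorem inv_step_nonneg (n : ℕ) : (0 : ℝ) ≤ 1 / (n + 2 : ℕ) := by positivity

theorem inv_step_le_one (n : ℕ) : (1 / (n + 2 : ℕ) : ℝ) ≤ 1 :=
  div_le_one_of_le₀ (by exact_mod_cast (by omega : 1 ≤ n + 2)) (by positivity)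

theorem one_le_expWeight_base (hc : ∀ i, c i ^ 2 = c i) (hα : 0 ≤ α) (n : ℕ) (x : Space) :
    1 ≤ 1 + α * tameDist c a (1 / (n + 2 : ℕ)) x / (n + 2 : ℕ) :=
  le_add_of_nonneg_right (div_nonneg (mul_nonneg hα (tameDist_nonneg hc (inv_step_nonneg n) x))
    (by positivity))

theorem one_le_expWeight (hc : ∀ i, c i ^ 2 = c i) (hα : 0 ≤ α) (n : ℕ) (x : Space) :
    1 ≤ expWeight c a α n x :=
  one_le_pow₀ (one_le_expWeight_base hc hα n x)

theorem expWeight_le (hc : ∀ i, c i ^ 2 = c i) (hα : 0 ≤ α) (n : ℕ) (x : Space) :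
    expWeight c a α n x ≤ Real.exp (α * √(1 + quad c a x)) := by
  have hk := tameDist_le_sqrt (a := a) hc (inv_step_nonneg n) x
  have h1 := one_le_expWeight_base (a := a) hc hα n x
  calc expWeight c a α n x
      ≤ Real.exp (α * tameDist c a (1 / (n + 2 : ℕ)) x / (n + 2 : ℕ)) ^ (n + 2) := by
        refine pow_le_pow_left₀ (by linarith) ?_ _
        rw [add_comm]
        exact Real.add_one_le_exp _
    _ = Real.exp (α * tameDist c a (1 / (n + 2 : ℕ)) x) := by
        rw [← Real.exp_nat_mul, mul_div_cancel₀ _ (by positivity)]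
    _ ≤ _ := Real.exp_le_exp.mpr (mul_le_mul_of_nonneg_left hk hα)

theorem tendsto_expWeight (x : Space) :
    Tendsto (fun n => expWeight c a α n x) atTop (𝓝 (Real.exp (α * √(1 + quad c a x)))) := by
  have h1 : Tendsto (fun n : ℕ => tameDist c a (1 / (n : ℝ)) x) atTop (𝓝 √(1 + quad c a x)) := by
    have h2 : ContinuousAt (fun δ : ℝ => tameDist c a δ x) 0 := by
      refine ContinuousAt.mul continuousAt_const (ContinuousAt.rpow_const ?_ (Or.inl ?_))
      · fun_prop
      · simp
    have h3 := h2.tendsto.comp tendsto_one_div_atTop_nhds_zero_nat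
    simpa [tameDist, Real.sqrt_eq_rpow, Function.comp_def] using h3
  have h2 : Tendsto (fun n : ℕ => (1 + α * tameDist c a (1 / (n : ℝ)) x / n) ^ n) atTop
      (𝓝 (Real.exp (α * √(1 + quad c a x)))) := by
    refine Real.tendsto_one_add_pow_exp_of_tendsto ((h1.const_mul α).congr' ?_)
    filter_upwards [eventually_ne_atTop 0] with n hn
    rw [mul_div_cancel₀ _ (Nat.cast_ne_zero.mpr hn)]
  exact h2.comp (tendsto_add_atTop_nat 2)

theorem sum_expWeightDeriv_sq_le (hc : ∀ i, c i ^ 2 = c i) (hα : 0 ≤ α) (n : ℕ) (x : Space) :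
    ∑ i, expWeightDeriv c a α n i x ^ 2 ≤ α ^ 2 * expWeight c a α n x ^ 2 := by
  have h1 := one_le_expWeight_base (a := a) hc hα n x
  have h2 := sum_tameDistDeriv_sq_le (a := a) hc (inv_step_nonneg n) (inv_step_le_one n) x
  simp only [expWeightDeriv, expWeight, mul_pow α, mul_pow _ (tameDistDeriv _ _ _ _ _),
    ← Finset.mul_sum]
  refine (mul_le_of_le_one_right (by positivity) h2).trans
    (mul_le_mul_of_nonneg_left ?_ (sq_nonneg α))
  exact pow_le_pow_left₀ (by positivity) (pow_le_pow_right₀ h1 (Nat.le_succ _)) 2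

theorem abs_expWeightDeriv_le (hc : ∀ i, c i ^ 2 = c i) (hα : 0 ≤ α) (n : ℕ) (i : Fin 3)
    (x : Space) : |expWeightDeriv c a α n i x| ≤ α * |expWeight c a α n x| := by
  rw [← abs_of_nonneg hα, ← abs_mul, abs_of_nonneg hα]
  refine sq_le_sq.mp ?_
  rw [mul_pow]
  exact (Finset.single_le_sum (f := fun i => expWeightDeriv c a α n i x ^ 2)
    (fun j _ => sq_nonneg _) (Finset.mem_univ i)).trans (sum_expWeightDeriv_sq_le hc hα n x)

theorem abs_expWeightDerivTwo_le (hc : ∀ i, c i ^ 2 = c i) (hα : 0 ≤ α) (n : ℕ) (i : Fin 3)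
    (x : Space) :
    |expWeightDerivTwo c a α n i x| ≤ (α ^ 2 + 3 * α) * |expWeight c a α n x| := by
  have h1 := one_le_expWeight_base (a := a) hc hα n x
  have h2 : tameDistDeriv c a (1 / (n + 2 : ℕ)) i x ^ 2 ≤ 1 :=
    (Finset.single_le_sum (f := fun i => tameDistDeriv c a (1 / (n + 2 : ℕ)) i x ^ 2)
      (fun j _ => sq_nonneg _) (Finset.mem_univ i)).trans
      (sum_tameDistDeriv_sq_le hc (inv_step_nonneg n) (inv_step_le_one n) x)
  have h3 := abs_tameDistDerivTwo_le (a := a) hc (inv_step_nonneg n) (inv_step_le_one n) i x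
  rw [expWeightDerivTwo, expWeight]
  set m := 1 + α * tameDist c a (1 / (n + 2 : ℕ)) x / (n + 2 : ℕ)
  set y := tameDistDeriv c a (1 / (n + 2 : ℕ)) i x ^ 2
  have hy : 0 ≤ y := sq_nonneg _
  have hm0 : 0 ≤ m := by linarith
  have h4 : ((n + 1 : ℕ) / (n + 2 : ℕ) : ℝ) ≤ 1 :=
    div_le_one_of_le₀ (by exact_mod_cast Nat.le_succ _) (by positivity)
  rw [abs_of_nonneg (pow_nonneg hm0 (n + 2)), add_mul]
  refine (abs_add_le _ _).trans (add_le_add ?_ ?_)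
  · rw [abs_of_nonneg (by positivity)]
    refine (mul_le_of_le_one_right (by positivity) h2).trans ?_
    refine mul_le_mul (mul_le_of_le_one_right (by positivity) h4)
      (pow_le_pow_right₀ h1 (by omega)) (by positivity) (by positivity)
  · rw [abs_mul, abs_of_nonneg (by positivity : 0 ≤ α * m ^ (n + 1))]
    have h5 : m ^ (n + 1) ≤ m ^ (n + 2) := pow_le_pow_right₀ h1 (by omega)
    calc _ ≤ α * m ^ (n + 2) * 3 := by gcongr
      _ = _ := by ring

theorem hasLineDerivAt_expWeight (hc : ∀ i, c i ^ 2 = c i) (n : ℕ) (i : Fin 3) (x : Space) :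
    HasLineDerivAt ℝ (expWeight c a α n) (expWeightDeriv c a α n i x) x (dir i) := by
  have hk : HasDerivAt (fun t : ℝ => tameDist c a (1 / (n + 2 : ℕ)) (x + t • dir i)) _ 0 :=
    hasLineDerivAt_tameDist hc (inv_step_nonneg n) i x
  have h := (((hk.const_mul α).div_const ((n + 2 : ℕ) : ℝ)).const_add 1).pow (n + 2)
  have hn : ((n + 2 : ℕ) : ℝ) ≠ 0 := by positivity
  refine h.congr_deriv ?_
  simp only [zero_smul, add_zero, expWeightDeriv]
  rw [show n + 2 - 1 = n + 1 from rfl]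
  field_simp

theorem hasLineDerivAt_expWeightDeriv (hc : ∀ i, c i ^ 2 = c i) (n : ℕ) (i : Fin 3) (x : Space) :
    HasLineDerivAt ℝ (expWeightDeriv c a α n i) (expWeightDerivTwo c a α n i x) x (dir i) := by
  have hk : HasDerivAt (fun t : ℝ => tameDist c a (1 / (n + 2 : ℕ)) (x + t • dir i)) _ 0 :=
    hasLineDerivAt_tameDist hc (inv_step_nonneg n) i x
  have hk' : HasDerivAt (fun t : ℝ => tameDistDeriv c a (1 / (n + 2 : ℕ)) i (x + t • dir i)) _ 0 :=
    hasLineDerivAt_tameDistDeriv hc (inv_step_nonneg n) i x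
  have h := (((((hk.const_mul α).div_const ((n + 2 : ℕ) : ℝ)).const_add 1).pow
    (n + 1)).const_mul α).mul hk'
  refine h.congr_deriv ?_
  simp only [Pi.pow_apply, zero_smul, add_zero, expWeightDerivTwo, Nat.add_sub_cancel]
  ring

/-- The power `(1 + y/(n+2))^(n+2)` replaces `e^y` because a polynomial in `tameDist` visibly has
temperate growth. The shift by 2 keeps the exponents of both derivatives natural numbers. -/
theorem isWeight_expWeight (hc : ∀ i, c i ^ 2 = c i) (hα : 0 ≤ α) (n : ℕ) :
    IsWeight (expWeight c a α n) (expWeightDeriv c a α n) (expWeightDerivTwo c a α n) := by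
  have hk := continuous_tameDist (a := a) hc (inv_step_nonneg n)
  have hk' := continuous_tameDistDeriv (a := a) hc (inv_step_nonneg n)
  have hk'' := continuous_tameDistDerivTwo (a := a) hc (inv_step_nonneg n)
  have hbdd : ∃ C, ∀ x, |expWeight c a α n x| ≤ C := by
    refine ⟨(1 + α * √(1 / (1 / (n + 2 : ℕ))) / (n + 2 : ℕ)) ^ (n + 2), fun x => ?_⟩
    have h1 := one_le_expWeight_base (a := a) hc hα n x
    have h2 := tameDist_le (a := a) hc (by positivity) (inv_step_le_one n) x
    rw [expWeight, abs_of_nonneg (by positivity)]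
    gcongr
  obtain ⟨C, hC⟩ := hbdd
  refine ⟨?_, .of_continuous (C := C) ?_ hC, fun i => .of_continuous (C := α * C) ?_ fun x => ?_,
    fun i => .of_continuous (C := (α ^ 2 + 3 * α) * C) ?_ fun x => ?_,
    hasLineDerivAt_expWeight hc n, hasLineDerivAt_expWeightDeriv hc n⟩
  · convert! ((Function.HasTemperateGrowth.const (1 : ℝ)).add
      ((Function.HasTemperateGrowth.const (α / (n + 2 : ℕ))).mul
        (tameDist_temperate (a := a) hc (inv_step_nonneg n)))).pow (n + 2) using 1
    ext x
    simp only [expWeight, Pi.pow_apply, Pi.add_apply, Pi.mul_apply, div_mul_eq_mul_div]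
  · unfold expWeight
    fun_prop
  · unfold expWeightDeriv
    have := hk' i
    fun_prop
  · exact (abs_expWeightDeriv_le hc hα n i x).trans (mul_le_mul_of_nonneg_left (hC x) hα)
  · unfold expWeightDerivTwo
    have := hk' i
    have := hk'' i
    fun_prop
  · exact (abs_expWeightDerivTwo_le hc hα n i x).trans
      (mul_le_mul_of_nonneg_left (hC x) (by positivity))

end expWeight

/-! ### Exponential decay of spectral projections -/

theorem WeightedNormLE.mono {h₁ h₂ : Space → ℝ} {B : L2 →L[ℂ] L2} {M N : ℝ}
    (h : WeightedNormLE h₁ B h₂ M) (hMN : M ≤ N) : WeightedNormLE h₁ B h₂ N :=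
  ⟨h.1, fun f => (h.2 f).imp fun _ hf =>
    hf.trans (mul_le_mul_of_nonneg_right hMN (norm_nonneg _))⟩

theorem continuous_gPar (a : ℝ) : Continuous (gPar a) := by
  unfold gPar
  fun_prop

theorem continuous_gPerp : Continuous gPerp := by
  unfold gPerp perpNorm
  fun_prop

theorem sqrt_one_add_quad_par (a : ℝ) (x : Space) :
    √(1 + quad ![1, 0, 0] ![a, 0, 0] x) = gPar a x := by
  simp [quad, gPar, Fin.sum_univ_three, add_comm]

theorem sqrt_one_add_quad_perp (x : Space) : √(1 + quad ![0, 1, 1] 0 x) = gPerp x := by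
  rw [gPerp, perpNorm, Real.sq_sqrt (by positivity)]
  simp [quad, Fin.sum_univ_three, add_comm]

/-- The rate `α` depends only on `V` and on bounds for `|z|` and the resolvent over the compact
contour; translating the weight changes none of these, which gives uniformity in `a`. -/
theorem exists_weightedNormLE_par {V : Space → ℝ} (hV : UniformlyLocallyL2 V) {Γ : Contour}
    (hΓ : Γ.trace ⊆ rho (hamiltonian V)) : ∃ α : ℝ, 0 < α ∧ ∃ M : ℝ, ∀ a : ℝ,
      WeightedNormLE (fun x => α * gPar a x) (spectralProjection (hamiltonian V) Γ)
        (fun x => -(α * gPar a x)) M := by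
  have hcont := (continuousOn_resolventOp (hamiltonian V)).mono hΓ
  obtain ⟨r₁, hr₁⟩ := Γ.isCompact_trace.exists_bound_of_continuousOn hcont
  obtain ⟨r₂, hr₂⟩ := Γ.isCompact_trace.exists_bound_of_continuousOn continuousOn_id
  set r := max 0 (max r₁ r₂) with hr
  have hr0 : 0 ≤ r := le_max_left _ _
  obtain ⟨α, hα, hα1, hCT⟩ := exists_conjugated_resolvent_bound hV hr0
  obtain ⟨L, hL, hint⟩ := Γ.exists_norm_integral_le
  refine ⟨α, hα, ‖Complex.I / (2 * Real.pi)‖ * (L * (2 * r)), fun a => ?_⟩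
  set P := spectralProjection (hamiltonian V) Γ with hP
  have hc : ∀ i, (![1, 0, 0] : Fin 3 → ℝ) i ^ 2 = (![1, 0, 0] : Fin 3 → ℝ) i := by
    intro i; fin_cases i <;> simp
  set w := expWeight ![1, 0, 0] ![a, 0, 0] α with hw
  have hW : ∀ n, IsWeight (w n) _ _ := isWeight_expWeight hc hα.le
  have hw1 : ∀ n x, 1 ≤ w n x := one_le_expWeight hc hα.le
  have hwle : ∀ n x, w n x ≤ Real.exp (α * gPar a x) := fun n x => by
    rw [← sqrt_one_add_quad_par]; exact expWeight_le hc hα.le n x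
  have hv : ∀ n, IsBdd fun x => (w n x)⁻¹ := fun n =>
    ⟨(hW n).bdd.aesm.aemeasurable.inv.aestronglyMeasurable, 1, fun x => by
      rw [abs_of_nonneg (inv_nonneg.mpr (zero_le_one.trans (hw1 n x)))]
      exact inv_le_one_of_one_le₀ (hw1 n x)⟩
  have hwv : ∀ n x, w n x * (w n x)⁻¹ = 1 := fun n x =>
    mul_inv_cancel₀ (zero_lt_one.trans_le (hw1 n x)).ne'
  have hbound : ∀ n g, ‖mulL (w n) (hW n).bdd (P (mulL _ (hv n) g))‖ ≤
      ‖Complex.I / (2 * Real.pi)‖ * (L * (2 * r)) * ‖g‖ := by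
    intro n g
    have hmap := Γ.integral_map ((mulL (w n) (hW n).bdd).comp
      (ContinuousLinearMap.apply ℂ L2 (mulL _ (hv n) g))) (f := resolventOp (hamiltonian V)) hcont
    have hz := hint (fun z => mulL (w n) (hW n).bdd (resolventOp (hamiltonian V) z
      (mulL _ (hv n) g))) (2 * r * ‖g‖) (fun z hz => ?_) (by positivity)
    · rw [hP, spectralProjection, _root_.smul_apply, map_smul, norm_smul, mul_assoc,
        mul_assoc L]
      refine mul_le_mul_of_nonneg_left (le_trans (le_of_eq (congrArg norm ?_)) hz) (norm_nonneg _)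
      exact hmap.symm
    · refine hCT (hW n) (hv n) (hwv n) (fun i x => abs_expWeightDeriv_le hc hα.le n i x)
        (fun i x => (abs_expWeightDerivTwo_le hc hα.le n i x).trans ?_)
        (isResolventAt_resolventOp (hΓ hz)) ?_ ?_ g
      -- Since `α ≤ 1`, the second-derivative constant `α² + 3α` is below `6α`.
      · refine mul_le_mul_of_nonneg_right ?_ (abs_nonneg _)
        nlinarith
      · exact (hr₁ z hz).trans ((le_max_left _ _).trans (le_max_right _ _))
      · exact (hr₂ z hz).trans ((le_max_right _ _).trans (le_max_right _ _))
  have he : IsBdd fun x => Real.exp (-(α * gPar a x)) := by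
    have := continuous_gPar a
    refine .of_continuous (C := 1) (by fun_prop) fun x => ?_
    rw [Real.abs_exp, Real.exp_le_one_iff, neg_nonpos]
    exact mul_nonneg hα.le (Real.sqrt_nonneg _)
  refine ⟨?_, fun f => ?_⟩
  · convert! dense_univ
    exact eq_univ_of_forall he.mem_domain
  refine exists_mulOp_le_of_tendsto (fun n => (hW n).bdd)
    (fun x => ?_) (by positivity) fun n => ?_
  · dsimp only
    rw [← sqrt_one_add_quad_par]
    exact tendsto_expWeight x
  -- The function `e^{-h} f` is `w⁻¹` times `w e^{-h} f`, whose norm is at most `‖f‖` because `w ≤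
  -- e^h`.
  · have h1 : mulL _ (hv n) (mulL (w n) (hW n).bdd (mulL _ he f)) =
        mulOp (fun x => Real.exp (-(α * gPar a x))) f := by
      refine Lp.ext ?_
      filter_upwards [coeFn_mulL (hv n) (mulL (w n) (hW n).bdd (mulL _ he f)),
        coeFn_mulL (hW n).bdd (mulL _ he f)] with x h1 h2
      rw [h1, h2, ← mul_assoc, ← Complex.ofReal_mul, mul_comm _ (w n x), hwv, Complex.ofReal_one,
        one_mul]
      rfl
    rw [← h1]
    refine (hbound n _).trans (mul_le_mul_of_nonneg_left ?_ (by positivity))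
    rw [mulL_mulL]
    refine (norm_mulL_le _ (C := 1) (fun x => ?_) _).trans_eq (one_mul _)
    have := hw1 n x
    rw [abs_of_nonneg (by positivity)]
    calc w n x * Real.exp (-(α * gPar a x))
        ≤ Real.exp (α * gPar a x) * Real.exp (-(α * gPar a x)) :=
          mul_le_mul_of_nonneg_right (hwle n x) (Real.exp_pos _).le
      _ = 1 := by rw [← Real.exp_add, add_neg_cancel, Real.exp_zero]

/-- If `u` is orthogonal to the domain, testing against `e^{-h} u`, which lies in it, gives
`‖e^{-h/2} u‖ = 0`. -/
theorem dense_mulOp_exp_domain {h : Space → ℝ} (hh : Continuous h) (h0 : ∀ x, 0 ≤ h x) :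
    Dense ((mulOp fun x => Real.exp (h x)).domain : Set L2) := by
  have he : IsBdd fun x => Real.exp (-(h x / 2)) := by
    refine .of_continuous (C := 1) (by fun_prop) fun x => ?_
    rw [Real.abs_exp, Real.exp_le_one_iff, neg_nonpos]
    exact div_nonneg (h0 x) zero_le_two
  rw [Submodule.dense_iff_topologicalClosure_eq_top, Submodule.topologicalClosure_eq_top_iff,
    Submodule.eq_bot_iff]
  intro u hu
  have hmem : mulL _ he (mulL _ he u) ∈ (mulOp fun x => Real.exp (h x)).domain := by
    refine (memLp_congr_ae ?_).mpr (Lp.memLp u)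
    filter_upwards [coeFn_mulL he (mulL _ he u), coeFn_mulL he u] with x h1 h2
    rw [h1, h2, ← mul_assoc, ← mul_assoc, ← Complex.ofReal_mul, ← Complex.ofReal_mul,
      ← Real.exp_add, ← Real.exp_add]
    ring_nf
    simp
  have h1 : inner ℂ (mulL _ he (mulL _ he u)) u = 0 := hu _ hmem
  rw [inner_mulL, inner_self_eq_zero] at h1
  refine Lp.ext ?_
  filter_upwards [coeFn_mulL he u, Lp.coeFn_zero ℂ 2 (volume : Measure Space),
    (Lp.ext_iff.mp h1)] with x e1 e2 e3
  rw [e1, e2] at e3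
  rw [e2]
  exact (mul_eq_zero.mp e3).resolve_left (Complex.ofReal_ne_zero.mpr (Real.exp_ne_zero _))

theorem exists_weightedNormLE_perp {V : Space → ℝ} (hV : UniformlyLocallyL2 V)
    (hdec : Tendsto (tailMass V) atTop (𝓝 0)) {P B : L2 →L[ℂ] L2}
    (hPB : IsReducedBy (hamiltonian V) P B) {e : ℝ}
    (hB : ∀ u, (inner ℂ u (B u)).re ≤ -e * ‖P u‖ ^ 2) {α : ℝ} (hα : 0 < α) (hαe : α ^ 2 < e) :
    ∃ M : ℝ, WeightedNormLE (fun x => α * gPerp x) P (fun x => α * gPerp x) M := by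
  set κ := (α ^ 2 + e) / 2 with hκ
  have hκ1 : α ^ 2 < κ := by rw [hκ]; linarith
  have hκ2 : κ < e := by rw [hκ]; linarith
  obtain ⟨C, hC, hag⟩ := exists_agmon_bound hV hdec hα hκ1
  -- On the range of `P` the graph norm of `H` is equivalent to the norm, because `HPx = BPx` with
  -- `B` bounded.
  set C' := C * (‖B‖ ^ 2 + 1) with hC'
  have hC'0 : 0 ≤ C' := by positivity
  set M := C' / (e - κ) with hM
  have hM0 : 0 ≤ M := div_nonneg hC'0 (by linarith)
  have hc : ∀ i, (![0, 1, 1] : Fin 3 → ℝ) i ^ 2 = (![0, 1, 1] : Fin 3 → ℝ) i := by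
    intro i; fin_cases i <;> simp
  set w := expWeight ![0, 1, 1] 0 α with hw
  have hW : ∀ n, IsWeight (w n) _ _ := isWeight_expWeight hc hα.le
  have hPP : ∀ x, P (P x) = P x := DFunLike.congr_fun hPB.mul_self
  have hBP : ∀ x, B (P x) = B x := DFunLike.congr_fun hPB.mul_proj
  have hPBx : ∀ x, P (B x) = B x := DFunLike.congr_fun hPB.proj_mul
  have hbound : ∀ n x, ‖mulL (w n) (hW n).bdd (P x)‖ ≤ √M * ‖x‖ := by
    intro n x
    have h1 : ‖(mulL (w n) (hW n).bdd).comp P‖ ^ 2 * (e - κ) ≤ C' := by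
      refine opNorm_sq_mul_le_of_lyapunov (P := P) (B := B) ?_ (fun x => ?_) hB
        ((sq_nonneg α).trans hκ1.le) hC'0
      · ext1 x
        exact congrArg (mulL (w n) (hW n).bdd) (hPP x)
      · obtain ⟨hd, hx⟩ := hPB.apply_eq x
        have h2 := hag (hW n) (sum_expWeightDeriv_sq_le hc hα.le n) (fun x => ?_) ⟨P x, hd⟩
        · rw [hx] at h2
          simp only [ContinuousLinearMap.comp_apply, hPBx]
          refine h2.trans (add_le_add le_rfl ?_)
          rw [hC', mul_assoc, add_mul, one_mul, ← mul_pow, ← hBP x]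
          gcongr
          exact B.le_opNorm _
        · rw [abs_of_nonneg (zero_le_one.trans (one_le_expWeight hc hα.le n x)),
            ← sqrt_one_add_quad_perp]
          exact expWeight_le hc hα.le n x
    refine ((mulL (w n) (hW n).bdd).comp P).le_of_opNorm_le ?_ x
    refine Real.le_sqrt_of_sq_le ?_
    rwa [hM, le_div_iff₀ (by linarith)]
  have hexp : ∀ x, ∃ h : P x ∈ (mulOp fun x => Real.exp (α * gPerp x)).domain,
      ‖mulOp (fun x => Real.exp (α * gPerp x)) ⟨P x, h⟩‖ ≤ √M * ‖x‖ := fun x =>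
    exists_mulOp_le_of_tendsto (fun n => (hW n).bdd)
      (fun x => by rw [← sqrt_one_add_quad_perp]; exact tendsto_expWeight x)
      (by positivity) fun n => hbound n x
  refine ⟨M, dense_mulOp_exp_domain (continuous_const.mul continuous_gPerp)
    (fun x => mul_nonneg hα.le (Real.sqrt_nonneg _)), fun f => ?_⟩
  set y := mulOp (fun x => Real.exp (α * gPerp x)) f with hy
  obtain ⟨h, hle⟩ := hexp (P y)
  -- With `y = e^h f`, one has `‖Py‖² = ⟨P(Py), y⟩ = ⟨e^h P(Py), f⟩`, so the bound on `e^h P` yields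
  -- the same bound on `P e^h`. Their product gives the constant `M`.
  have hdual : ‖P y‖ ≤ √M * ‖(f : L2)‖ := by
    by_cases h0 : ‖P y‖ = 0
    · rw [h0]; positivity
    have h1 : inner ℂ (P (P y)) y = (‖P y‖ ^ 2 : ℂ) := by
      exact (hPB.isSelfAdjoint.isSymmetric (P y) y).trans (inner_self_eq_norm_sq_to_K _)
    have h2 : ‖P y‖ ^ 2 ≤ √M * ‖P y‖ * ‖(f : L2)‖ := by
      calc ‖P y‖ ^ 2 = ‖inner ℂ (P (P y)) y‖ := by simp [h1]
        _ = ‖inner ℂ (mulOp (fun x => Real.exp (α * gPerp x)) ⟨_, h⟩) (f : L2)‖ := by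
            exact congrArg norm (inner_mulOp ⟨_, h⟩ f).symm
        _ ≤ _ := (norm_inner_le_norm _ _).trans (mul_le_mul_of_nonneg_right hle (norm_nonneg _))
    have h3 : 0 < ‖P y‖ := lt_of_le_of_ne (norm_nonneg _) (Ne.symm h0)
    nlinarith
  have hyy : P (P y) = P y := hPP y
  have hmem : P y ∈ (mulOp fun x => Real.exp (α * gPerp x)).domain := hyy ▸ h
  refine ⟨hmem, ?_⟩
  have h4 : mulOp (fun x => Real.exp (α * gPerp x)) ⟨P y, hmem⟩ =
      mulOp (fun x => Real.exp (α * gPerp x)) ⟨P (P y), h⟩ := by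
    congr 1
    exact Subtype.ext hyy.symm
  calc ‖mulOp (fun x => Real.exp (α * gPerp x)) ⟨P y, hmem⟩‖
      ≤ √M * ‖P y‖ := by rw [h4]; exact hle
    _ ≤ √M * (√M * ‖(f : L2)‖) := mul_le_mul_of_nonneg_left hdual (Real.sqrt_nonneg _)
    _ = M * ‖(f : L2)‖ := by rw [← mul_assoc, Real.mul_self_sqrt hM0]

end QuasiOneD

end

/-! ### The theorem. -/

theorem proposition2p1
    (V : QuasiOneD.Space → ℝ)
    (hV : QuasiOneD.UniformlyLocallyL2 V)
    (hV_decay : Tendsto (QuasiOneD.tailMass V) atTop (𝓝 0))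
    (σ₀ : Set ℝ) (hσ₀ : QuasiOneD.IsIsolatedPart (QuasiOneD.hamiltonian V) σ₀)
    (Eplus : ℝ) (hEplus : IsLUB σ₀ (-Eplus)) (hEplus_pos : 0 < Eplus)
    (Γ : QuasiOneD.Contour) (hΓ : Γ.Encloses (QuasiOneD.hamiltonian V) σ₀)
    (P₀ : QuasiOneD.L2 →L[ℂ] QuasiOneD.L2)
    (hP₀ : P₀ = QuasiOneD.spectralProjection (QuasiOneD.hamiltonian V) Γ) :
    ∃ αPar : ℝ, 0 < αPar ∧
      ∀ αPerp : ℝ, 0 < αPerp → αPerp < √Eplus →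
        ∃ M : ℝ,
          (∀ a : ℝ, QuasiOneD.WeightedNormLE (fun x => αPar * QuasiOneD.gPar a x) P₀
            (fun x => -(αPar * QuasiOneD.gPar a x)) M) ∧
          QuasiOneD.WeightedNormLE (fun x => αPerp * QuasiOneD.gPerp x) P₀
            (fun x => αPerp * QuasiOneD.gPerp x) M := by
  subst hP₀
  obtain ⟨α, hα, M₁, h₁⟩ := QuasiOneD.exists_weightedNormLE_par hV hΓ.1
  obtain ⟨B, hPB, hB⟩ := QuasiOneD.exists_isReducedBy_spectralProjection
    QuasiOneD.hamiltonian_symm hσ₀.1 hΓ fun E hE => hEplus.1 hE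
  refine ⟨α, hα, fun β hβ hβE => ?_⟩
  obtain ⟨M₂, h₂⟩ := QuasiOneD.exists_weightedNormLE_perp hV hV_decay hPB hB hβ
    ((Real.lt_sqrt hβ.le).mp hβE)
  exact ⟨max M₁ M₂, fun a => (h₁ a).mono (le_max_left _ _), h₂.mono (le_max_right _ _)⟩
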